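/- **Setting.** Let $k,\gamma\in C^2((0,\infty))$ be positive, with constants $\alpha\in(0,1)$, $\beta\in(1,2)$, $\tilde\beta<\beta$, $\bar\alpha,\bar\beta>1$, $k_i,\gamma_i>0$ ($i=0,1,2$) such that $k(\xi)\sim\xi^{\alpha+1}$ and $\gamma(\xi)=\xi^\beta+O(\xi^{\tilde\beta})$ as $\xi\to\infty$; $k(\xi)=k_0+O(\xi^{\bar\alpha})$ and $\gamma(\xi)=\gamma_0+O(\xi^{\bar\beta})$ as $\xi\to0^+$; $|k'(\xi)|\le k_1\xi^{\alpha}$, $|k''(\xi)|\le k_2\xi^{\alpha-1}$, $|\gamma'(\xi)|\le\gamma_1\xi^{\beta-1}$, $|\gamma''(\xi)|\le\gamma_2\xi^{\beta-2}$ for $\xi\ge1$; and $|k'(\xi)|\le k_1\xi^{\bar\alpha-1}$, $|k''(\xi)|\le k_2\xi^{\bar\alpha-2}$, $|\gamma'(\xi)|\le\gamma_1\xi^{\bar\beta-1}$, $|\gamma''(\xi)|\le\gamma_2\xi^{\bar\beta-2}$ for $0<\xi\le1$. These data, and a number $\bar\theta_1\in(\beta-1,1)$, are fixed; all constants below may depend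 on them. For $\theta\in\mathbb R$ and a real sequence $y=\{y_n\}_{n\in\mathbb Z}$ put $$\|y\|_\theta:=\sup_{n\le0}2^n|y_n|+\sup_{n>0}2^{\theta n}|y_n|,\qquad \mathcal Y_\theta:=\{y:\|y\|_\theta<\infty\},\qquad D^+(y):=\{y_{n+1}-y_n\}_{n\in\mathbb Z}.$$ For a bounded sequence $p=\{p_n\}_{n\in\mathbb Z}$ and $A>0$ put $$\zeta_n(p):=\frac{\ln2}{2^{n+p_n}}\,\frac{k(2^{n+p_n})}{\gamma(2^{n+1+p_{n+1}})},\qquad \theta_n(p):=\frac{2\zeta_{n+1}(p)}{\zeta_n(p)},$$ $$\bar\mu_n(A,p):=e^{-A2^n}\exp\Bigl(-2^n\sum_{j=n+1}^\infty2^{-j}\ln\theta_{j-1}(p)\Bigr).$$ Given $M>0$, let $A_M>0$ be the value of $A$ for which the positive bounded solution $\{a_n\}_{n\in\mathbb Z}$ of $a_{n+1}=\zeta_n(0)a_n^2$ with $$a_n=\tfrac{2\gamma_0}{k_0\ln2}\,(2^n+A_02^{2n})+o(2^{2n})\ \ (n\to-\infty,\text{ for some }A_0\in\mathbb R),\qquad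 a_n\sim\tfrac{2^{\beta}\,2^{\beta-\alpha}}{\ln2}\,2^{(\beta-\alpha)n}e^{-A2^n}\ \ (n\to\infty)$$ has mass $\sum_{n\in\mathbb Z}2^na_n=M$. **Theorem.** Let $M>0$. There exist $\eta_0\in(0,1)$ and $\nu>0$, depending only on $M$, with the following property. Let $\theta\in(-1,\beta)$ and $\tilde\theta\in[\theta,\beta]$ with $\tilde\theta-\theta<\beta$. There are constants $C_1,C_2>0$, depending only on $M,\theta,\tilde\theta$, such that the following holds for every $p(t)=\{p_n(t)\}_{n\in\mathbb Z}$ whose components are differentiable in $t>0$ and satisfy, for all $t>0$ and $n\in\mathbb Z$, $$|p_n(t)|\le\eta_0,\qquad \|D^+(p(t))\|_{\bar\theta_1}\le\eta_0\,t^{-\bar\theta_1/\beta}e^{-\frac\nu2t},\qquad \Bigl\|\frac{dp(t)}{dt}\Bigr\|_{\bar\theta_1-\beta}\le\eta_0\bigl(1+t^{-\bar\theta_1/\beta}\bigr)e^{-\frac\nu2t},$$ for every $t_0\ge0$, and for every $y^0\in\mathcal Y_\theta$. (i) There is a unique solution $t\mapsto y(t)=T(t;t_0)(y^0)$, $t\in[t_0,\infty)$,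 of $$\frac{dy_n}{dt}=\frac{\gamma(2^{n+p_n(t)})}{4}\Bigl(y_{n-1}-y_n-\sigma_n(t)(y_n-y_{n+1})\Bigr)\quad(t>t_0,\ n\in\mathbb Z),\qquad \sigma_n(t):=8\bar\mu_n(A_M,p(t))\,\frac{\gamma(2^{n+1+p_{n+1}(t)})}{\gamma(2^{n+p_n(t)})},$$ with $y(t_0)=y^0$, in the class of maps whose components are continuous on $[t_0,\infty)$ and which take values in $\mathcal Y_{\min\{\theta,0\}}$ and are bounded in $\mathcal Y_{\min\{\theta,0\}}$ on every bounded time interval $[t_0,T]$. (ii) For all $t>t_0$ one has $$\|D^+(y(t))\|_{\tilde\theta}\le C_1\|y^0\|_\theta\,(t-t_0)^{-\frac{\tilde\theta-\theta}{\beta}}e^{-\nu(t-t_0)}.$$ (iii) For all $t>t_0$ the limit $y_\infty(t):=\lim_{n\to\infty}y_n(t)$ exists and, if $\tilde\theta>0$, $$\|y(t)-y_\infty(t)\|_{\tilde\theta}\le C_2\|y^0\|_\theta\,(t-t_0)^{-\frac{\tilde\theta-\theta}{\beta}}e^{-\nu(t-t_0)}.$$ -/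

import Mathlib

open Set Filter Topology Asymptotics
open scoped ENNReal

namespace CoagFrag

/-- The coefficient functions `k` (coagulation) and `γ` (fragmentation) of the kernels, with the
exponents and constants in their growth conditions. -/
structure Kernels where
  k : ℝ → ℝ
  γ : ℝ → ℝ
  α : ℝ
  αbar : ℝ
  k₀ : ℝ
  k₁ : ℝ
  k₂ : ℝ
  β : ℝ
  βtilde : ℝ
  βbar : ℝ
  γ₀ : ℝ
  γ₁ : ℝ
  γ₂ : ℝ
  α_mem : α ∈ Ioo (0 : ℝ) 1
  αbar_gt : 1 < αbar
  k₀_pos : 0 < k₀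
  k₁_pos : 0 < k₁
  k₂_pos : 0 < k₂
  k_contDiffOn : ContDiffOn ℝ 2 k (Ioi 0)
  k_pos : ∀ ξ, 0 < ξ → 0 < k ξ
  k_atTop : k ~[atTop] fun ξ => ξ ^ (α + 1)
  k_zero : (fun ξ => k ξ - k₀) =O[𝓝[>] 0] fun ξ => ξ ^ αbar
  k_deriv_large : ∀ ξ, 1 ≤ ξ → |deriv k ξ| ≤ k₁ * ξ ^ α
  k_deriv_small : ∀ ξ, 0 < ξ → ξ ≤ 1 → |deriv k ξ| ≤ k₁ * ξ ^ (αbar - 1)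
  k_deriv2_large : ∀ ξ, 1 ≤ ξ → |deriv (deriv k) ξ| ≤ k₂ * ξ ^ (α - 1)
  k_deriv2_small : ∀ ξ, 0 < ξ → ξ ≤ 1 → |deriv (deriv k) ξ| ≤ k₂ * ξ ^ (αbar - 2)
  β_mem : β ∈ Ioo (1 : ℝ) 2
  βtilde_lt : βtilde < β
  βbar_gt : 1 < βbar
  γ₀_pos : 0 < γ₀
  γ₁_pos : 0 < γ₁
  γ₂_pos : 0 < γ₂
  γ_contDiffOn : ContDiffOn ℝ 2 γ (Ioi 0)
  γ_pos : ∀ ξ, 0 < ξ → 0 < γ ξ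
  γ_atTop : (fun ξ => γ ξ - ξ ^ β) =O[atTop] fun ξ => ξ ^ βtilde
  γ_zero : (fun ξ => γ ξ - γ₀) =O[𝓝[>] 0] fun ξ => ξ ^ βbar
  γ_deriv_large : ∀ ξ, 1 ≤ ξ → |deriv γ ξ| ≤ γ₁ * ξ ^ (β - 1)
  γ_deriv_small : ∀ ξ, 0 < ξ → ξ ≤ 1 → |deriv γ ξ| ≤ γ₁ * ξ ^ (βbar - 1)
  γ_deriv2_large : ∀ ξ, 1 ≤ ξ → |deriv (deriv γ) ξ| ≤ γ₂ * ξ ^ (β - 2)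
  γ_deriv2_small : ∀ ξ, 0 < ξ → ξ ≤ 1 → |deriv (deriv γ) ξ| ≤ γ₂ * ξ ^ (βbar - 2)

/-- The norm `‖y‖_θ = sup_{n ≤ 0} 2^n |y_n| + sup_{n > 0} 2^{θ n} |y_n|`, with value `∞` where it
is not finite; the space `𝒴_θ` consists of the sequences with `normY θ y < ∞`. -/
noncomputable def normY (θ : ℝ) (y : ℤ → ℝ) : ℝ≥0∞ :=
  (⨆ n : ℤ, ⨆ _ : n ≤ 0, ENNReal.ofReal ((2 : ℝ) ^ n * |y n|)) +
    ⨆ n : ℤ, ⨆ _ : 0 < n, ENNReal.ofReal ((2 : ℝ) ^ (θ * (n : ℝ)) * |y n|)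

/-- The forward difference `D⁺_n(y) = y_{n+1} - y_n`. -/
def Dplus (y : ℤ → ℝ) : ℤ → ℝ := fun n => y (n + 1) - y n

namespace Kernels

variable (K : Kernels)

/-- The position `2^{n + p_n}` of the `n`-th peak. -/
noncomputable def peak (p : ℤ → ℝ) (n : ℤ) : ℝ := (2 : ℝ) ^ ((n : ℝ) + p n)

/-- `ζ_n(p) = (ln 2 / 2^{n + p_n}) k(2^{n + p_n}) / γ(2^{n + 1 + p_{n+1}})`. -/
noncomputable def zeta (p : ℤ → ℝ) (n : ℤ) : ℝ :=
  Real.log 2 / peak p n * (K.k (peak p n) / K.γ (peak p (n + 1)))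

/-- `θ_n(p) = 2 ζ_{n+1}(p) / ζ_n(p)`. -/
noncomputable def ratio (p : ℤ → ℝ) (n : ℤ) : ℝ := 2 * K.zeta p (n + 1) / K.zeta p n

/-- `μ̄_n(A, p) = e^{-A 2^n} exp(-2^n ∑_{j ≥ n+1} 2^{-j} ln θ_{j-1}(p))`, the sum being indexed by
`j = n + 1 + i`, `i ∈ ℕ`. -/
noncomputable def mubar (A : ℝ) (p : ℤ → ℝ) (n : ℤ) : ℝ :=
  Real.exp (-A * (2 : ℝ) ^ n) *
    Real.exp (-(2 : ℝ) ^ n *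
      ∑' i : ℕ, (2 : ℝ) ^ (-(n + 1 + (i : ℤ))) * Real.log (K.ratio p (n + (i : ℤ))))

/-- `σ_n = 8 μ̄_n(A, p) γ(2^{n + 1 + p_{n+1}}) / γ(2^{n + p_n})`. -/
noncomputable def sigma (A : ℝ) (p : ℤ → ℝ) (n : ℤ) : ℝ :=
  8 * K.mubar A p n * (K.γ (peak p (n + 1)) / K.γ (peak p n))

/-- The linear operator
`ℒ_n(y) = (γ(2^{n + p_n}) / 4) (y_{n-1} - y_n - σ_n (y_n - y_{n+1}))`. -/
noncomputable def linOp (A : ℝ) (p y : ℤ → ℝ) (n : ℤ) : ℝ :=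
  K.γ (peak p n) / 4 * (y (n - 1) - y n - K.sigma A p n * (y n - y (n + 1)))

/-- `a` is the family of coefficients of the stationary solution `∑ a_n δ(x - n)` with decay
parameter `A` (peaks at the integers, that is, shift `0`): positive, bounded, solving
`a_{n+1} = ζ_{n,0} a_n²`, and with the prescribed behaviour as `n → ±∞`. -/
structure IsStationaryCoeff (A : ℝ) (a : ℤ → ℝ) : Prop where
  pos : ∀ n, 0 < a n
  bounded : ∃ B : ℝ, ∀ n, a n ≤ B
  recurrence : ∀ n, a (n + 1) = K.zeta (fun _ => 0) n * a n ^ 2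
  at_bot : ∃ A₀ : ℝ,
    (fun n : ℤ => a n - K.γ₀ * 2 / (K.k₀ * Real.log 2) * ((2 : ℝ) ^ n + A₀ * (2 : ℝ) ^ (2 * n)))
      =o[atBot] fun n : ℤ => (2 : ℝ) ^ (2 * n)
  at_top : a ~[atTop] fun n : ℤ =>
    (Real.log 2)⁻¹ * (2 : ℝ) ^ K.β * (2 : ℝ) ^ (K.β - K.α) *
      (2 : ℝ) ^ ((K.β - K.α) * (n : ℝ)) * Real.exp (-A * (2 : ℝ) ^ n)

/-- `A = A_M`: the stationary solution with decay parameter `A > 0` and peaks at the integers has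
total mass `∑ 2^n a_n = M`. -/
def IsMassParameter (M A : ℝ) : Prop :=
  0 < A ∧ ∃ a : ℤ → ℝ, K.IsStationaryCoeff A a ∧ HasSum (fun n : ℤ => (2 : ℝ) ^ n * a n) M

/-- The smallness and decay assumptions on the time-dependent shifts `p(t)`, `t > 0`. -/
structure IsAdmissibleShift (θ₁ η₀ ν : ℝ) (p : ℝ → ℤ → ℝ) : Prop where
  differentiable : ∀ t, 0 < t → ∀ n, DifferentiableAt ℝ (fun s => p s n) t
  bound : ∀ t, 0 < t → ∀ n, |p t n| ≤ η₀
  bound_diff : ∀ t, 0 < t →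
    normY θ₁ (Dplus (p t)) ≤
      ENNReal.ofReal (η₀ * t ^ (-θ₁ / K.β) * Real.exp (-(ν / 2) * t))
  bound_deriv : ∀ t, 0 < t →
    normY (θ₁ - K.β) (fun n => deriv (fun s => p s n) t) ≤
      ENNReal.ofReal (η₀ * (1 + t ^ (-θ₁ / K.β)) * Real.exp (-(ν / 2) * t))

/-- `y` solves `dy_n/dt = ℒ_n(y; t)` for `t > t₀` with `y(t₀) = y⁰`, as a map from `[t₀, ∞)` to
`𝒴_κ` which is bounded in `𝒴_κ` on bounded time intervals. -/
structure IsSolution (A : ℝ) (p : ℝ → ℤ → ℝ) (κ t₀ : ℝ) (y₀ : ℤ → ℝ) (y : ℝ → ℤ → ℝ) : Prop where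
  init : y t₀ = y₀
  continuousOn : ∀ n, ContinuousOn (fun t => y t n) (Ici t₀)
  ode : ∀ t, t₀ < t → ∀ n, HasDerivAt (fun s => y s n) (K.linOp A (p t) (y t) n) t
  locally_bounded : ∀ T : ℝ, ∃ B : ℝ, ∀ t ∈ Icc t₀ T, normY κ (y t) ≤ ENNReal.ofReal B

end Kernels

end CoagFrag

/-! The equation is the backward equation of a birth-death chain on `ℤ`, with rates `A_n =
γ(2^{n+p_n})/4` for jumps down and `B_n = 2 μ̄_n γ(2^{n+1+p_{n+1}})` for jumps up. As `n → -∞` these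
tend to `g = γ₀/4` and `8g`; as `n → ∞` the down rate grows like `2^{βn}` and the up rate decays
faster than any power of `2^n`. The differences `d_n = y_{n+1} - y_n` solve a cooperative
tridiagonal system of their own. For sequences growing at most like `2^|n|` this system has a
comparison principle (`le_of_barrier`), so every estimate reduces to exhibiting a supersolution.

For `t ≥ 1` the supersolution is `e^{-νt} w_n`. For constant shifts, `w` is the difference sequence
of a solution of a Poisson equation: with `m` the reversible measure and `F` strictly increasing of
`m`-mean zero, `m_{n+1} a_{n+1} w_n = ∑_{j>n} m_j F_j`. The tail sums are positive because `F`
changes sign once, and the difference operator maps `w` to `F_n - F_{n+1} < 0`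
(`exists_static_weight`). Both `w` and its defect are controlled from below by powers of `2`, so the
inequality survives small relative perturbations of the rates, provided `A_n/a_n` varies slowly in
`n` (`exists_decaying_weight`).

For `t ≤ 1` the gain of weight comes from the scaling of `A_n`: in the variable `x = 1 + 2^{βn}t`
the system is nearly self-similar, and `2^{-θn} x^{-κ}` with `κ = (β-θ)/β` is a solution to leading
order. A lower-order correction makes it a supersolution for large `x`; a high power of `x` takes
over near `x = 1`, and an exponential factor in time pays for the indices where the asymptotics are
not available (`exists_short_time_bound`). At `t = 1` the differences have the full weight
`2^{-βn}`, which is what the long-time estimate needs (`exists_decay_estimate`).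

The kernel hypotheses enter through Lipschitz bounds for `ln k` and `ln γ` in the variable `log₂ ξ`
and the remainder in `γ(ξ) ~ ξ^β`. They show that shifts of size `η₀` give rates of the required
kind (`exists_isPerturbedRates`). Solutions come from monotone iteration of the mild formulation,
uniqueness from the comparison principle, and the limit `y_∞` from summing the differences. -/

namespace CoagFrag

open MeasureTheory

/-! ### Comparison principle for tridiagonal systems -/

/-- First contact principle: `x` stays strictly below a continuous family `w` if at a contact point
`w` admits a differentiable upper test function whose derivative exceeds that of `x`. -/
theorem lt_of_strict_barrier {t₁ T : ℝ} {x w : ℝ → ℤ → ℝ}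
    (hx : ∀ n, ContinuousOn (fun t => x t n) (Icc t₁ T))
    (hw : ∀ n, ContinuousOn (fun t => w t n) (Icc t₁ T))
    (hinit : ∀ n, x t₁ n < w t₁ n)
    (S : Finset ℤ) (hfar : ∀ n ∉ S, ∀ t ∈ Icc t₁ T, x t n < w t n)
    (hbar : ∀ t ∈ Ioc t₁ T, ∀ n, (∀ m, x t m ≤ w t m) → x t n = w t n →
      ∃ (ψ : ℝ → ℝ) (ψ' x' : ℝ), HasDerivAt ψ ψ' t ∧ HasDerivAt (fun s => x s n) x' t ∧
        ψ t = w t n ∧ (∀ s ∈ Icc t₁ t, w s n ≤ ψ s) ∧ x' < ψ') :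
    ∀ t ∈ Icc t₁ T, ∀ n, x t n < w t n := by
  by_contra! hcon
  obtain ⟨τ, hτ, n₀, hn₀⟩ := hcon
  -- Contact can occur only at the finitely many indices in `S`, so the set of contact times is a
  -- finite union of closed sets and has a smallest element.
  set Z : Set ℝ := ⋃ n ∈ S, {t | t ∈ Icc t₁ T ∧ w t n ≤ x t n} with hZ
  have hZclosed : IsClosed Z := by
    refine S.finite_toSet.isClosed_biUnion fun n _ => ?_
    exact isClosed_Icc.isClosed_le (hw n) (hx n)
  have hmemZ : ∀ t, t ∈ Icc t₁ T → (∃ n, w t n ≤ x t n) → t ∈ Z := by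
    rintro t ht ⟨n, hn⟩
    by_cases hS : n ∈ S
    · exact mem_biUnion hS ⟨ht, hn⟩
    · exact absurd (hfar n hS t ht) (not_lt.mpr hn)
  have hZsub : ∀ t ∈ Z, t ∈ Icc t₁ T ∧ ∃ n, w t n ≤ x t n := by
    intro t ht
    simp only [hZ, mem_iUnion] at ht
    obtain ⟨n, _, h1, h2⟩ := ht
    exact ⟨h1, n, h2⟩
  have hne : Z.Nonempty := ⟨τ, hmemZ τ hτ ⟨n₀, hn₀⟩⟩
  have hbdd : BddBelow Z := ⟨t₁, fun t ht => (hZsub t ht).1.1⟩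
  set s := sInf Z with hs
  have hsZ : s ∈ Z := hZclosed.csInf_mem hne hbdd
  obtain ⟨hsI, n, hn⟩ := hZsub s hsZ
  have hts : t₁ < s := by
    rcases eq_or_lt_of_le hsI.1 with h | h
    · rw [← h] at hn
      exact absurd (hinit n) (not_lt.mpr hn)
    · exact h
  have hbefore : ∀ t ∈ Ico t₁ s, ∀ m, x t m < w t m := by
    intro t ht m
    by_contra! h
    exact absurd (csInf_le hbdd (hmemZ t ⟨ht.1, ht.2.le.trans hsI.2⟩ ⟨m, h⟩)) (not_le.mpr ht.2)
  have hat : ∀ m, x s m ≤ w s m := by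
    intro m
    have hnb : (𝓝[<] s).NeBot := inferInstance
    have hmem : Icc t₁ T ∈ 𝓝[<] s := by
      filter_upwards [Ioo_mem_nhdsLT hts] with t ht using ⟨ht.1.le, ht.2.le.trans hsI.2⟩
    have hle : 𝓝[<] s ≤ 𝓝[Icc t₁ T] s := by
      rw [nhdsWithin, nhdsWithin]
      exact le_inf inf_le_left (le_principal_iff.mpr hmem)
    refine le_of_tendsto_of_tendsto ((hx m s hsI).mono_left hle) ((hw m s hsI).mono_left hle) ?_
    filter_upwards [Ioo_mem_nhdsLT hts] with t ht using (hbefore t ⟨ht.1.le, ht.2⟩ m).le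
  obtain ⟨ψ, ψ', x', hψ, hx', hψs, hψw, hlt⟩ :=
    hbar s ⟨hts, hsI.2⟩ n hat (le_antisymm (hat n) hn)
  -- At the first contact `ψ - x` vanishes and is positive just before, so its derivative cannot be
  -- positive; but `x' < ψ'`.
  have hd : HasDerivAt (fun t => ψ t - x t n) (ψ' - x') s := hψ.sub hx'
  have hsl := (hasDerivAt_iff_tendsto_slope.mp hd).mono_left
    (nhdsWithin_mono s (fun t (ht : t < s) => ne_of_lt ht : Iio s ⊆ {s}ᶜ))
  have hpos : ∀ᶠ t in 𝓝[<] s, 0 < slope (fun t => ψ t - x t n) s t :=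
    hsl.eventually (lt_mem_nhds (sub_pos.mpr hlt))
  obtain ⟨t, ht1, ht2⟩ := (hpos.and (Ioo_mem_nhdsLT hts)).exists
  have h0 : ψ s - x s n = 0 := by
    rw [hψs]; exact sub_eq_zero.mpr (le_antisymm hn (hat n))
  rw [slope_def_field, h0, sub_zero] at ht1
  have h1 : 0 < ψ t - x t n := by
    have := hbefore t ⟨ht2.1.le, ht2.2⟩ n
    have := hψw t ⟨ht2.1.le, ht2.2.le⟩
    linarith
  exact absurd ht1 (not_lt.mpr (div_nonpos_of_nonneg_of_nonpos h1.le (by linarith [ht2.2])))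

/-- As `Λ ≥ 4 = 2 · 2`, a spare factor `2^|n|` beats `B/ε` off a finite set. An arbitrarily small
multiple of `Λ^|n|` therefore confines contact to finitely many indices. -/
theorem exists_finset_growth {B Λ ε : ℝ} (hΛ : 4 ≤ Λ) (hε : 0 < ε) :
    ∃ S : Finset ℤ, ∀ n ∉ S, B * 2 ^ n.natAbs < ε * Λ ^ n.natAbs := by
  obtain ⟨N, hN⟩ := pow_unbounded_of_one_lt (B / ε) (one_lt_two (α := ℝ))
  refine ⟨Finset.Icc (-(N : ℤ)) N, fun n hn => ?_⟩
  have hNn : N ≤ n.natAbs := by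
    simp only [Finset.mem_Icc, not_and_or, not_le] at hn
    omega
  have h1 : B < ε * 2 ^ n.natAbs := by
    have : B / ε < 2 ^ n.natAbs := hN.trans_le (pow_le_pow_right₀ one_le_two hNn)
    rw [div_lt_iff₀ hε] at this
    linarith
  calc B * 2 ^ n.natAbs < ε * 2 ^ n.natAbs * 2 ^ n.natAbs := by gcongr
    _ = ε * 4 ^ n.natAbs := by rw [mul_assoc, ← mul_pow]; norm_num
    _ ≤ ε * Λ ^ n.natAbs := by gcongr

/-- Comparison principle for cooperative tridiagonal systems on `ℤ`, for solutions growing at most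
like `2^|n|` and barriers in the viscosity sense. -/
theorem le_of_barrier {t₁ T : ℝ} {x w a b c : ℝ → ℤ → ℝ} {Λ C B : ℝ}
    (ha : ∀ t ∈ Ioc t₁ T, ∀ n, 0 ≤ a t n) (hb : ∀ t ∈ Ioc t₁ T, ∀ n, 0 ≤ b t n)
    (hx : ∀ n, ContinuousOn (fun t => x t n) (Icc t₁ T))
    (hx' : ∀ t ∈ Ioc t₁ T, ∀ n, HasDerivAt (fun s => x s n)
      (a t n * x t (n - 1) - c t n * x t n + b t n * x t (n + 1)) t)
    (hΛ : 4 ≤ Λ)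
    (hV : ∀ t ∈ Ioc t₁ T, ∀ n : ℤ, a t n * Λ ^ (n - 1).natAbs - c t n * Λ ^ n.natAbs
      + b t n * Λ ^ (n + 1).natAbs ≤ C * Λ ^ n.natAbs)
    (hgrow : ∀ t ∈ Icc t₁ T, ∀ n, x t n ≤ B * 2 ^ n.natAbs)
    (hw : ∀ n, ContinuousOn (fun t => w t n) (Icc t₁ T))
    (hw0 : ∀ t ∈ Icc t₁ T, ∀ n, 0 ≤ w t n)
    (hinit : ∀ n, x t₁ n ≤ w t₁ n)
    (hbar : ∀ t ∈ Ioc t₁ T, ∀ n, ∃ (ψ : ℝ → ℝ) (ψ' : ℝ), HasDerivAt ψ ψ' t ∧ ψ t = w t n ∧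
      (∀ s ∈ Icc t₁ t, w s n ≤ ψ s) ∧
      a t n * w t (n - 1) - c t n * w t n + b t n * w t (n + 1) ≤ ψ') :
    ∀ t ∈ Icc t₁ T, ∀ n, x t n ≤ w t n := by
  have hΛ0 : ∀ n : ℕ, 0 < Λ ^ n := fun n => pow_pos (by linarith) n
  have key : ∀ ε, 0 < ε → ∀ t ∈ Icc t₁ T, ∀ n : ℤ,
      x t n < w t n + ε * Real.exp ((|C| + 1) * (t - t₁)) * Λ ^ n.natAbs := by
    intro ε hε
    obtain ⟨S, hS⟩ := exists_finset_growth (B := B) hΛ hε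
    have hexp : ∀ t ∈ Icc t₁ T, 1 ≤ Real.exp ((|C| + 1) * (t - t₁)) := by
      intro t ht
      apply Real.one_le_exp
      have := ht.1
      have := abs_nonneg C
      exact mul_nonneg (by linarith) (by linarith)
    -- The barrier is made strict by adding `ε e^{(|C|+1)(t-t₁)} Λ^|n|`: its time derivative exceeds
    -- the contribution `C Λ^|n|` of the spatial operator. Afterwards `ε → 0`.
    refine lt_of_strict_barrier
      (w := fun t n => w t n + ε * Real.exp ((|C| + 1) * (t - t₁)) * Λ ^ n.natAbs)
      hx (fun n => ?_) (fun n => ?_) S (fun n hn t ht => ?_) ?_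
    · exact (hw n).add (Continuous.continuousOn (by fun_prop))
    · have : 0 < ε * Real.exp ((|C| + 1) * (t₁ - t₁)) * Λ ^ n.natAbs :=
        mul_pos (by positivity) (hΛ0 _)
      linarith [hinit n]
    · have h1 := hgrow t ht n
      have h2 := hS n hn
      have h3 := hw0 t ht n
      have h4 : ε * Λ ^ n.natAbs ≤ ε * Real.exp ((|C| + 1) * (t - t₁)) * Λ ^ n.natAbs := by
        have := hexp t ht
        have := (hΛ0 n.natAbs).le
        gcongr
        nlinarith
      linarith
    · intro t ht n hle heq
      obtain ⟨ψ, ψ', hψ, hψt, hψw, hψ'⟩ := hbar t ht n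
      have hE : HasDerivAt (fun s => ε * Real.exp ((|C| + 1) * (s - t₁)) * Λ ^ n.natAbs)
          (ε * (Real.exp ((|C| + 1) * (t - t₁)) * (|C| + 1)) * Λ ^ n.natAbs) t := by
        have h1 : HasDerivAt (fun s => (|C| + 1) * (s - t₁)) ((|C| + 1) * 1) t :=
          ((hasDerivAt_id t).sub_const t₁).const_mul _
        rw [mul_one] at h1
        exact (h1.exp.const_mul ε).mul_const _
      refine ⟨_, _, _, hψ.add hE, hx' t ht n, by simp [hψt], fun s hs => ?_, ?_⟩
      · have := hψw s hs
        simpa using this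
      · set e := ε * Real.exp ((|C| + 1) * (t - t₁)) with he
        have hepos : 0 < e := by positivity
        have h1 := mul_le_mul_of_nonneg_left (hle (n - 1)) (ha t ht n)
        have h2 := mul_le_mul_of_nonneg_left (hle (n + 1)) (hb t ht n)
        have h3 := mul_le_mul_of_nonneg_left (hV t ht n) hepos.le
        have h4 : e * (C * Λ ^ n.natAbs) < e * ((|C| + 1) * Λ ^ n.natAbs) := by
          have := hΛ0 n.natAbs
          have := le_abs_self C
          gcongr
          linarith
        have h5 : ε * (Real.exp ((|C| + 1) * (t - t₁)) * (|C| + 1)) * Λ ^ n.natAbs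
            = e * ((|C| + 1) * Λ ^ n.natAbs) := by rw [he]; ring
        rw [h5]
        rw [heq]
        nlinarith
  intro t ht n
  refine le_of_forall_pos_lt_add fun δ hδ => ?_
  have hp : 0 < Real.exp ((|C| + 1) * (t - t₁)) * Λ ^ n.natAbs := mul_pos (Real.exp_pos _) (hΛ0 _)
  have := key (δ / (Real.exp ((|C| + 1) * (t - t₁)) * Λ ^ n.natAbs)) (by positivity) t ht n
  rwa [mul_assoc, div_mul_cancel₀ _ hp.ne'] at this

/-! ### Existence by monotone iteration of the mild formulation -/

section Existence

variable (a b : ℝ → ℤ → ℝ) (Λ : ℤ → ℝ) (y₀ : ℤ → ℝ)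

/-- The (nonnegative) right-hand side of the backward equation after adding `Λ_n y_n`. -/
def gain (u : ℝ → ℤ → ℝ) (t : ℝ) (n : ℤ) : ℝ :=
  a t n * u t (n - 1) + b t n * u t (n + 1) + (Λ n - a t n - b t n) * u t n

/-- The fixed point map of the mild formulation of the backward equation. -/
noncomputable def mildMap (u : ℝ → ℤ → ℝ) (t : ℝ) (n : ℤ) : ℝ :=
  Real.exp (-Λ n * t) * (y₀ n + ∫ s in (0 : ℝ)..t, Real.exp (Λ n * s) * gain a b Λ u s n)

variable {a b Λ y₀}
variable {W : ℤ → ℝ} {c : ℝ}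

/-- The order interval on which the fixed point map acts. -/
structure IsSubordinate (W : ℤ → ℝ) (c : ℝ) (u : ℝ → ℤ → ℝ) : Prop where
  meas : ∀ n, AEStronglyMeasurable (fun t => u t n) (volume.restrict (Ioi 0))
  nonneg : ∀ t, 0 < t → ∀ n, 0 ≤ u t n
  le : ∀ t, 0 < t → ∀ n, u t n ≤ W n * Real.exp (c * t)

/-- Since `Λ_n` dominates `a_n + b_n`, all three coefficients in `gain` are nonnegative. -/
theorem gain_mono (ha0 : ∀ t, 0 < t → ∀ n, 0 ≤ a t n) (hb0 : ∀ t, 0 < t → ∀ n, 0 ≤ b t n)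
    (hΛ : ∀ t, 0 < t → ∀ n, a t n + b t n ≤ Λ n) {u v : ℝ → ℤ → ℝ} {t : ℝ} (ht : 0 < t)
    (huv : ∀ n, u t n ≤ v t n) (n : ℤ) : gain a b Λ u t n ≤ gain a b Λ v t n := by
  unfold gain
  have h1 := mul_le_mul_of_nonneg_left (huv (n - 1)) (ha0 t ht n)
  have h2 := mul_le_mul_of_nonneg_left (huv (n + 1)) (hb0 t ht n)
  have h3 := mul_le_mul_of_nonneg_left (huv n)
    (by linarith [hΛ t ht n] : 0 ≤ Λ n - a t n - b t n)
  linarith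

theorem gain_nonneg (ha0 : ∀ t, 0 < t → ∀ n, 0 ≤ a t n) (hb0 : ∀ t, 0 < t → ∀ n, 0 ≤ b t n)
    (hΛ : ∀ t, 0 < t → ∀ n, a t n + b t n ≤ Λ n) {u : ℝ → ℤ → ℝ} (hu : ∀ t, 0 < t → ∀ n, 0 ≤ u t n)
    {t : ℝ} (ht : 0 < t) (n : ℤ) : 0 ≤ gain a b Λ u t n := by
  have := gain_mono ha0 hb0 hΛ (u := fun _ _ => 0) (v := u) ht (hu t ht) n
  simpa [gain] using this

theorem gain_le (ha0 : ∀ t, 0 < t → ∀ n, 0 ≤ a t n) (hb0 : ∀ t, 0 < t → ∀ n, 0 ≤ b t n)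
    (hΛ : ∀ t, 0 < t → ∀ n, a t n + b t n ≤ Λ n)
    (hWs : ∀ t, 0 < t → ∀ n, a t n * (W (n - 1) - W n) + b t n * (W (n + 1) - W n) ≤ c * W n)
    {u : ℝ → ℤ → ℝ} (hu : IsSubordinate W c u) {t : ℝ} (ht : 0 < t) (n : ℤ) :
    gain a b Λ u t n ≤ (Λ n + c) * W n * Real.exp (c * t) := by
  refine (gain_mono ha0 hb0 hΛ (v := fun t n => W n * Real.exp (c * t)) ht (hu.le t ht) n).trans ?_
  have := mul_le_mul_of_nonneg_right (hWs t ht n) (Real.exp_pos (c * t)).le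
  simp only [gain]
  linarith

theorem gain_meas (hac : ∀ n, ContinuousOn (fun t => a t n) (Ioi 0))
    (hbc : ∀ n, ContinuousOn (fun t => b t n) (Ioi 0)) {u : ℝ → ℤ → ℝ}
    (hu : ∀ n, AEStronglyMeasurable (fun t => u t n) (volume.restrict (Ioi 0))) (n : ℤ) :
    AEStronglyMeasurable (fun s => Real.exp (Λ n * s) * gain a b Λ u s n)
      (volume.restrict (Ioi 0)) := by
  have ha := fun n => (hac n).aestronglyMeasurable (μ := volume) measurableSet_Ioi
  have hb := fun n => (hbc n).aestronglyMeasurable (μ := volume) measurableSet_Ioi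
  unfold gain
  refine AEStronglyMeasurable.mul (Continuous.aestronglyMeasurable (by fun_prop)) ?_
  exact (((ha n).mul (hu _)).add ((hb n).mul (hu _))).add
    (((aestronglyMeasurable_const.sub (ha n)).sub (hb n)).mul (hu _))

variable (hac : ∀ n, ContinuousOn (fun t => a t n) (Ioi 0))
    (hbc : ∀ n, ContinuousOn (fun t => b t n) (Ioi 0))
    (ha0 : ∀ t, 0 < t → ∀ n, 0 ≤ a t n) (hb0 : ∀ t, 0 < t → ∀ n, 0 ≤ b t n)
    (hΛ : ∀ t, 0 < t → ∀ n, a t n + b t n ≤ Λ n)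
    (hWs : ∀ t, 0 < t → ∀ n, a t n * (W (n - 1) - W n) + b t n * (W (n + 1) - W n) ≤ c * W n)

include hac hbc ha0 hb0 hΛ hWs

theorem gain_integrableOn {u : ℝ → ℤ → ℝ} (hu : IsSubordinate W c u) (T : ℝ) (n : ℤ) :
    IntegrableOn (fun s => Real.exp (Λ n * s) * gain a b Λ u s n) (Ioc 0 T) := by
  have hcont : Continuous fun s => Real.exp (Λ n * s) * ((Λ n + c) * W n * Real.exp (c * s)) := by
    fun_prop
  have hI : IntegrableOn
      (fun s => Real.exp (Λ n * s) * ((Λ n + c) * W n * Real.exp (c * s))) (Ioc 0 T) :=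
    (hcont.integrableOn_Icc (a := 0) (b := T)).mono_set Ioc_subset_Icc_self
  refine Integrable.mono' hI ((gain_meas hac hbc hu.meas n).mono_measure
    (Measure.restrict_mono Ioc_subset_Ioi_self le_rfl)) ?_
  filter_upwards [ae_restrict_mem measurableSet_Ioc] with s hs
  have h0 := gain_nonneg ha0 hb0 hΛ hu.nonneg hs.1 n
  rw [Real.norm_of_nonneg (mul_nonneg (Real.exp_pos _).le h0)]
  exact mul_le_mul_of_nonneg_left (gain_le ha0 hb0 hΛ hWs hu hs.1 n) (Real.exp_pos _).le

theorem gain_intervalIntegrable {u : ℝ → ℤ → ℝ} (hu : IsSubordinate W c u) {T : ℝ} (hT : 0 ≤ T)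
    (n : ℤ) :
    IntervalIntegrable (fun s => Real.exp (Λ n * s) * gain a b Λ u s n) volume 0 T :=
  (intervalIntegrable_iff_integrableOn_Ioc_of_le hT).mpr
    (gain_integrableOn hac hbc ha0 hb0 hΛ hWs hu T n)

theorem mildMap_continuousOn {u : ℝ → ℤ → ℝ} (hu : IsSubordinate W c u) (n : ℤ) :
    ContinuousOn (fun t => mildMap a b Λ y₀ u t n) (Ici 0) := by
  have h : ContinuousOn
      (fun t => ∫ s in (0 : ℝ)..t, Real.exp (Λ n * s) * gain a b Λ u s n) (Ici 0) := by
    intro t ht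
    have ht : (0 : ℝ) ≤ t := ht
    have hI := gain_integrableOn hac hbc ha0 hb0 hΛ hWs hu (t + 1) n
    rw [← integrableOn_Icc_iff_integrableOn_Ioc] at hI
    have := intervalIntegral.continuousOn_primitive_interval
      (by rwa [uIcc_of_le (by linarith : (0 : ℝ) ≤ t + 1)])
    rw [uIcc_of_le (by linarith : (0 : ℝ) ≤ t + 1)] at this
    refine (this t ⟨ht, by linarith⟩).mono_of_mem_nhdsWithin ?_
    refine mem_nhdsWithin.mpr ⟨Iio (t + 1), isOpen_Iio, by simp, ?_⟩
    rintro s ⟨hs1, hs2⟩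
    exact ⟨hs2, le_of_lt hs1⟩
  unfold mildMap
  exact (Continuous.continuousOn (by fun_prop)).mul (continuousOn_const.add h)

theorem mildMap_mono {u v : ℝ → ℤ → ℝ} (hu : IsSubordinate W c u) (hv : IsSubordinate W c v)
    (huv : ∀ t, 0 < t → ∀ n, u t n ≤ v t n) {t : ℝ} (ht : 0 ≤ t) (n : ℤ) :
    mildMap a b Λ y₀ u t n ≤ mildMap a b Λ y₀ v t n := by
  unfold mildMap
  gcongr
  refine intervalIntegral.integral_mono_on_of_le_Ioo ht
    (gain_intervalIntegrable hac hbc ha0 hb0 hΛ hWs hu ht n)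
    (gain_intervalIntegrable hac hbc ha0 hb0 hΛ hWs hv ht n) fun s hs => ?_
  exact mul_le_mul_of_nonneg_left (gain_mono ha0 hb0 hΛ hs.1 (huv s hs.1) n) (Real.exp_pos _).le

/-- The order interval is invariant because the bound `(Λ_n + c) W_n e^{ct}` on the gain integrates
exactly: `e^{Λt}` times it is the derivative of `W_n e^{(Λ_n+c)t}`. -/
theorem mildMap_isSubordinate (hy0 : ∀ n, 0 ≤ y₀ n) (hyW : ∀ n, y₀ n ≤ W n) {u : ℝ → ℤ → ℝ}
    (hu : IsSubordinate W c u) : IsSubordinate W c (mildMap a b Λ y₀ u) := by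
  refine ⟨fun n => ?_, fun t ht n => ?_, fun t ht n => ?_⟩
  · exact ((mildMap_continuousOn hac hbc ha0 hb0 hΛ hWs hu n).mono
      Ioi_subset_Ici_self).aestronglyMeasurable measurableSet_Ioi
  · refine mul_nonneg (Real.exp_pos _).le (add_nonneg (hy0 n) ?_)
    refine intervalIntegral.integral_nonneg_of_ae_restrict ht.le ?_
    rw [Filter.EventuallyLE, ← restrict_Ioc_eq_restrict_Icc]
    filter_upwards [ae_restrict_mem measurableSet_Ioc] with s hs
    exact mul_nonneg (Real.exp_pos _).le (gain_nonneg ha0 hb0 hΛ hu.nonneg hs.1 n)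
  · have hder : ∀ s ∈ uIcc 0 t, HasDerivAt (fun s => W n * Real.exp ((Λ n + c) * s))
        (Real.exp (Λ n * s) * ((Λ n + c) * W n * Real.exp (c * s))) s := by
      intro s _
      have h1 : HasDerivAt (fun s => (Λ n + c) * s) ((Λ n + c) * 1) s :=
        (hasDerivAt_id s).const_mul _
      refine (h1.exp.const_mul (W n)).congr_deriv ?_
      rw [show (Λ n + c) * s = Λ n * s + c * s by ring, Real.exp_add]
      ring
    have hcont : Continuous fun s =>
        Real.exp (Λ n * s) * ((Λ n + c) * W n * Real.exp (c * s)) := by fun_prop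
    have hint := intervalIntegral.integral_eq_sub_of_hasDerivAt hder
      (hcont.intervalIntegrable 0 t)
    have hle : ∫ s in (0 : ℝ)..t, Real.exp (Λ n * s) * gain a b Λ u s n ≤
        ∫ s in (0 : ℝ)..t, Real.exp (Λ n * s) * ((Λ n + c) * W n * Real.exp (c * s)) := by
      refine intervalIntegral.integral_mono_on_of_le_Ioo ht.le
        (gain_intervalIntegrable hac hbc ha0 hb0 hΛ hWs hu ht.le n)
        (hcont.intervalIntegrable 0 t) fun s hs => ?_
      exact mul_le_mul_of_nonneg_left (gain_le ha0 hb0 hΛ hWs hu hs.1 n) (Real.exp_pos _).le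
    rw [hint] at hle
    simp only [mul_zero, Real.exp_zero, mul_one] at hle
    calc mildMap a b Λ y₀ u t n
        ≤ Real.exp (-Λ n * t) * (W n * Real.exp ((Λ n + c) * t)) := by
          unfold mildMap
          gcongr
          linarith [hyW n]
      _ = W n * Real.exp (c * t) := by
          rw [mul_left_comm, ← Real.exp_add]
          ring_nf

/-- Iterates started from zero increase and stay below `W_n e^{ct}`, so they converge pointwise;
dominated convergence passes to the limit under the integral. -/
theorem exists_mildMap_fixedPoint (hW : ∀ n, 0 ≤ W n) (hy0 : ∀ n, 0 ≤ y₀ n) (hyW : ∀ n, y₀ n ≤ W n) :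
    ∃ u, IsSubordinate W c u ∧ ∀ t, 0 ≤ t → ∀ n, u t n = mildMap a b Λ y₀ u t n := by
  set Φ := mildMap a b Λ y₀ with hΦ
  set it : ℕ → ℝ → ℤ → ℝ := fun k => Φ^[k] (fun _ _ => 0) with hit
  have hsucc : ∀ k, it (k + 1) = Φ (it k) := fun k => Function.iterate_succ_apply' Φ k _
  have hsub : ∀ k, IsSubordinate W c (it k) := by
    intro k
    induction k with
    | zero =>
      exact ⟨fun n => aestronglyMeasurable_const, fun t _ n => le_rfl,
        fun t _ n => mul_nonneg (hW n) (Real.exp_pos _).le⟩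
    | succ k ih =>
      rw [hsucc]
      exact mildMap_isSubordinate hac hbc ha0 hb0 hΛ hWs hy0 hyW ih
  have hmono : ∀ k, ∀ t, 0 < t → ∀ n, it k t n ≤ it (k + 1) t n := by
    intro k
    induction k with
    | zero => exact fun t ht n => (hsub 1).nonneg t ht n
    | succ k ih =>
      intro t ht n
      rw [hsucc (k + 1)]
      conv_lhs => rw [hsucc k]
      exact mildMap_mono hac hbc ha0 hb0 hΛ hWs (hsub k) (hsub (k + 1)) ih ht.le n
  set v : ℝ → ℤ → ℝ := fun t n => ⨆ k, it k t n with hv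
  have hlim : ∀ t, 0 < t → ∀ n, Tendsto (fun k => it k t n) atTop (𝓝 (v t n)) := by
    intro t ht n
    refine tendsto_atTop_ciSup (monotone_nat_of_le_succ fun k => hmono k t ht n) ?_
    exact ⟨W n * Real.exp (c * t), by rintro _ ⟨k, rfl⟩; exact (hsub k).le t ht n⟩
  have hvsub : IsSubordinate W c v := by
    refine ⟨fun n => ?_, fun t ht n => ?_, fun t ht n => ?_⟩
    · refine aestronglyMeasurable_of_tendsto_ae atTop (fun k => (hsub k).meas n) ?_
      filter_upwards [ae_restrict_mem measurableSet_Ioi] with t ht using hlim t ht n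
    · exact ge_of_tendsto' (hlim t ht n) fun k => (hsub k).nonneg t ht n
    · exact le_of_tendsto' (hlim t ht n) fun k => (hsub k).le t ht n
  have hΦlim : ∀ t, 0 ≤ t → ∀ n, Tendsto (fun k => Φ (it k) t n) atTop (𝓝 (Φ v t n)) := by
    intro t ht n
    refine Tendsto.const_mul _ (tendsto_const_nhds.add ?_)
    refine intervalIntegral.tendsto_integral_filter_of_dominated_convergence
      (fun s => Real.exp (Λ n * s) * ((Λ n + c) * W n * Real.exp (c * s))) ?_ ?_ ?_ ?_
    · refine Eventually.of_forall fun k => ?_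
      rw [uIoc_of_le ht]
      exact (gain_meas hac hbc (hsub k).meas n).mono_measure
        (Measure.restrict_mono Ioc_subset_Ioi_self le_rfl)
    · refine Eventually.of_forall fun k => Eventually.of_forall fun s hs => ?_
      rw [uIoc_of_le ht] at hs
      have h0 := gain_nonneg ha0 hb0 hΛ (hsub k).nonneg hs.1 n
      rw [Real.norm_of_nonneg (mul_nonneg (Real.exp_pos _).le h0)]
      exact mul_le_mul_of_nonneg_left (gain_le ha0 hb0 hΛ hWs (hsub k) hs.1 n) (Real.exp_pos _).le
    · exact Continuous.intervalIntegrable (by fun_prop) _ _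
    · refine Eventually.of_forall fun s hs => ?_
      rw [uIoc_of_le ht] at hs
      refine Tendsto.const_mul _ ?_
      unfold gain
      exact (((hlim s hs.1 _).const_mul _).add ((hlim s hs.1 _).const_mul _)).add
        ((hlim s hs.1 _).const_mul _)
  have hvfix : ∀ t, 0 < t → ∀ n, v t n = Φ v t n := by
    intro t ht n
    have h1 := (hlim t ht n).comp (tendsto_add_atTop_nat 1)
    refine tendsto_nhds_unique h1 ((hΦlim t ht.le n).congr fun k => ?_)
    simp only [Function.comp, hsucc]
  -- The fixed point equation for `v` is known at positive times only. The map sees no other times,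
  -- so `Φ v` satisfies it at `t = 0` as well and is the solution that is returned.
  have hcongr : ∀ t n, Φ (Φ v) t n = Φ v t n ∨ t < 0 := by
    intro t n
    by_cases ht : t < 0
    · exact Or.inr ht
    left
    push Not at ht
    simp only [hΦ, mildMap]
    congr 2
    refine intervalIntegral.integral_congr_ae (Eventually.of_forall fun s hs => ?_)
    rw [uIoc_of_le ht] at hs
    simp only [gain]
    rw [hvfix s hs.1, hvfix s hs.1, hvfix s hs.1]
  refine ⟨Φ v, mildMap_isSubordinate hac hbc ha0 hb0 hΛ hWs hy0 hyW hvsub, fun t ht n => ?_⟩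
  rcases hcongr t n with h | h
  · exact h.symm
  · exact absurd h (not_lt.mpr ht)

/-- Existence of nonnegative solutions of the backward equation below a supersolution. -/
theorem exists_solution_of_nonneg (hW : ∀ n, 0 ≤ W n) (hy0 : ∀ n, 0 ≤ y₀ n)
    (hyW : ∀ n, y₀ n ≤ W n) :
    ∃ u : ℝ → ℤ → ℝ, u 0 = y₀ ∧ (∀ n, ContinuousOn (fun t => u t n) (Ici 0)) ∧
      (∀ t, 0 < t → ∀ n, HasDerivAt (fun s => u s n)
        (a t n * (u t (n - 1) - u t n) + b t n * (u t (n + 1) - u t n)) t) ∧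
      ∀ t, 0 ≤ t → ∀ n, 0 ≤ u t n ∧ u t n ≤ W n * Real.exp (c * t) := by
  obtain ⟨u, hu, hfix⟩ := exists_mildMap_fixedPoint hac hbc ha0 hb0 hΛ hWs hW hy0 hyW
  have hinit : u 0 = y₀ := by
    ext n
    rw [hfix 0 le_rfl n]
    simp [mildMap]
  have hcont : ∀ n, ContinuousOn (fun t => u t n) (Ici 0) := fun n =>
    (mildMap_continuousOn hac hbc ha0 hb0 hΛ hWs hu n).congr fun t ht => hfix t ht n
  refine ⟨u, hinit, hcont, fun t ht n => ?_, fun t ht n => ?_⟩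
  · have hcu : ∀ n, ContinuousOn (fun t => u t n) (Ioi 0) := fun n =>
      (hcont n).mono Ioi_subset_Ici_self
    have hgc : ContinuousOn (fun s => Real.exp (Λ n * s) * gain a b Λ u s n) (Ioi 0) := by
      unfold gain
      refine (Continuous.continuousOn (by fun_prop)).mul ?_
      exact (((hac n).mul (hcu _)).add ((hbc n).mul (hcu _))).add
        (((continuousOn_const.sub (hac n)).sub (hbc n)).mul (hcu _))
    have hF : HasDerivAt (fun t => ∫ s in (0 : ℝ)..t, Real.exp (Λ n * s) * gain a b Λ u s n)
        (Real.exp (Λ n * t) * gain a b Λ u t n) t := by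
      refine intervalIntegral.integral_hasDerivAt_right
        (gain_intervalIntegrable hac hbc ha0 hb0 hΛ hWs hu ht.le n) ?_
        (hgc.continuousAt (Ioi_mem_nhds ht))
      exact hgc.stronglyMeasurableAtFilter isOpen_Ioi t ht
    have hE : HasDerivAt (fun t => Real.exp (-Λ n * t)) (Real.exp (-Λ n * t) * (-Λ n * 1)) t :=
      ((hasDerivAt_id t).const_mul _).exp
    have hD := hE.mul (hF.const_add (y₀ n))
    have heq : (fun s => u s n) =ᶠ[𝓝 t] fun s => Real.exp (-Λ n * s) *
        (y₀ n + ∫ r in (0 : ℝ)..s, Real.exp (Λ n * r) * gain a b Λ u r n) := by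
      filter_upwards [Ioi_mem_nhds ht] with s hs
      exact hfix s (le_of_lt hs) n
    refine (hD.congr_of_eventuallyEq heq).congr_deriv ?_
    have h1 : Real.exp (-Λ n * t) * Real.exp (Λ n * t) = 1 := by
      rw [← Real.exp_add]; simp
    have h2 := heq.self_of_nhds
    simp only at h2
    set I := ∫ r in (0 : ℝ)..t, Real.exp (Λ n * r) * gain a b Λ u r n with hI
    calc Real.exp (-Λ n * t) * (-Λ n * 1) * (y₀ n + I) +
          Real.exp (-Λ n * t) * (Real.exp (Λ n * t) * gain a b Λ u t n)
        = -Λ n * (Real.exp (-Λ n * t) * (y₀ n + I)) +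
          (Real.exp (-Λ n * t) * Real.exp (Λ n * t)) * gain a b Λ u t n := by ring
      _ = _ := by rw [← h2, h1]; unfold gain; ring
  · rcases eq_or_lt_of_le ht with h | h
    · rw [← h, hinit]
      simpa using ⟨hy0 n, hyW n⟩
    · exact ⟨hu.nonneg t h n, hu.le t h n⟩

end Existence

/-! ### Weights and elementary limits on `ℤ` -/

/-- The weight `2^{-n}` for `n ≤ 0` and `2^{-θ n}` for `n > 0` of the space `𝒴_θ`. -/
noncomputable def wt (θ : ℝ) (n : ℤ) : ℝ :=
  if n ≤ 0 then (2 : ℝ) ^ (-(n : ℝ)) else (2 : ℝ) ^ (-(θ * (n : ℝ)))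

theorem wt_pos (θ : ℝ) (n : ℤ) : 0 < wt θ n := by
  unfold wt; split_ifs <;> positivity

theorem wt_of_nonpos {θ : ℝ} {n : ℤ} (hn : n ≤ 0) : wt θ n = (2 : ℝ) ^ (-(n : ℝ)) := if_pos hn

theorem wt_of_nonneg {θ : ℝ} {n : ℤ} (hn : 0 ≤ n) : wt θ n = (2 : ℝ) ^ (-(θ * (n : ℝ))) := by
  unfold wt
  split_ifs with h
  · have : n = 0 := le_antisymm h hn
    simp [this]
  · rfl

theorem wt_anti {θ θ' : ℝ} (h : θ ≤ θ') (n : ℤ) : wt θ' n ≤ wt θ n := by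
  rcases le_total n 0 with hn | hn
  · rw [wt_of_nonpos hn, wt_of_nonpos hn]
  · rw [wt_of_nonneg hn, wt_of_nonneg hn]
    have : (0 : ℝ) ≤ n := by exact_mod_cast hn
    apply Real.rpow_le_rpow_of_exponent_le one_le_two
    nlinarith

theorem two_pow_natAbs_of_nonneg {n : ℤ} (hn : 0 ≤ n) : (2 : ℝ) ^ n.natAbs = 2 ^ (n : ℝ) := by
  rw [← Real.rpow_natCast]
  rw [Nat.cast_natAbs, abs_of_nonneg hn]

theorem two_pow_natAbs_of_nonpos {n : ℤ} (hn : n ≤ 0) : (2 : ℝ) ^ n.natAbs = 2 ^ (-(n : ℝ)) := by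
  rw [← Real.rpow_natCast]
  rw [Nat.cast_natAbs, abs_of_nonpos hn, Int.cast_neg]

theorem wt_neg_one (n : ℤ) : wt (-1) n = (2 : ℝ) ^ n.natAbs := by
  rcases le_total n 0 with hn | hn
  · rw [wt_of_nonpos hn, two_pow_natAbs_of_nonpos hn]
  · rw [wt_of_nonneg hn, two_pow_natAbs_of_nonneg hn]; simp

theorem wt_le_two_pow {θ : ℝ} (h : -1 ≤ θ) (n : ℤ) : wt θ n ≤ (2 : ℝ) ^ n.natAbs :=
  (wt_anti h n).trans (wt_neg_one n).le

theorem one_le_two_pow_natAbs (n : ℤ) : (1 : ℝ) ≤ 2 ^ n.natAbs := one_le_pow₀ one_le_two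

theorem tendsto_wt_atTop {θ : ℝ} (hθ : 0 < θ) : Tendsto (wt θ) atTop (𝓝 0) := by
  have h : Tendsto (fun n : ℤ => (2 : ℝ) ^ (-(θ * (n : ℝ)))) atTop (𝓝 0) := by
    have h1 : Tendsto (fun n : ℤ => θ * (n : ℝ)) atTop atTop :=
      tendsto_intCast_atTop_atTop.const_mul_atTop hθ
    exact (tendsto_rpow_atBot_of_base_gt_one 2 one_lt_two).comp (tendsto_neg_atTop_atBot.comp h1)
  refine h.congr' ?_
  filter_upwards [eventually_ge_atTop 0] with n hn using (wt_of_nonneg hn).symm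

theorem tendsto_wt_atBot (θ : ℝ) : Tendsto (wt θ) atBot atTop := by
  have h : Tendsto (fun n : ℤ => (2 : ℝ) ^ (-(n : ℝ))) atBot atTop :=
    (tendsto_rpow_atTop_of_base_gt_one 2 one_lt_two).comp
      (tendsto_neg_atBot_atTop.comp (tendsto_intCast_atBot_iff.mpr tendsto_id))
  refine h.congr' ?_
  filter_upwards [eventually_le_atBot 0] with n hn using (wt_of_nonpos hn).symm

/-- A step to the right multiplies the weight by `1/2` on the left half-line and by `2^{-θ}` on the
right one. For `θ > 0` the decrement is a fixed proportion of the weight, so sums of weights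
telescope. -/
theorem wt_succ_add_le {θ : ℝ} (n : ℤ) :
    wt θ (n + 1) + min (1 / 2) (1 - 2 ^ (-θ)) * wt θ n ≤ wt θ n := by
  rcases lt_or_ge n 0 with hn | hn
  · have h1 : wt θ (n + 1) = 1 / 2 * wt θ n := by
      rw [wt_of_nonpos (by omega), wt_of_nonpos hn.le]
      push_cast
      rw [show (-((n : ℝ) + 1)) = -1 + -(n : ℝ) by ring, Real.rpow_add two_pos, Real.rpow_neg_one]
      norm_num
    have := mul_le_mul_of_nonneg_right (min_le_left (1 / 2) (1 - (2 : ℝ) ^ (-θ))) (wt_pos θ n).le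
    linarith
  · have h1 : wt θ (n + 1) = 2 ^ (-θ) * wt θ n := by
      rw [wt_of_nonneg (by omega), wt_of_nonneg hn]
      push_cast
      rw [← Real.rpow_add two_pos]
      ring_nf
    have := mul_le_mul_of_nonneg_right (min_le_right (1 / 2) (1 - (2 : ℝ) ^ (-θ))) (wt_pos θ n).le
    linarith

theorem wt_succ_le {θ : ℝ} (hθ : -1 ≤ θ) (n : ℤ) : wt θ (n + 1) ≤ 2 * wt θ n := by
  have h : -1 ≤ min (1 / 2 : ℝ) (1 - 2 ^ (-θ)) := by
    refine le_min (by norm_num) ?_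
    have : (2 : ℝ) ^ (-θ) ≤ 2 ^ (1 : ℝ) :=
      Real.rpow_le_rpow_of_exponent_le one_le_two (by linarith)
    rw [Real.rpow_one] at this
    linarith
  have := wt_succ_add_le (θ := θ) n
  nlinarith [wt_pos θ n]

/-- Tail sums are bounded through this: the bound minus the tail is monotone and tends to zero, so
no series has to be evaluated. -/
theorem nonneg_of_antitone_of_tendsto {f : ℤ → ℝ} {n : ℤ} (h : ∀ k, n ≤ k → f (k + 1) ≤ f k)
    (hf : Tendsto f atTop (𝓝 0)) : 0 ≤ f n := by
  have h1 : ∀ k : ℕ, f (n + k) ≤ f n := by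
    intro k
    induction k with
    | zero => simp
    | succ k ih =>
      push_cast
      rw [← add_assoc]
      exact (h _ (by omega)).trans ih
  refine le_of_tendsto hf ?_
  filter_upwards [eventually_ge_atTop n] with k hk
  obtain ⟨j, rfl⟩ := Int.le.dest hk
  exact h1 j

theorem nonneg_of_monotone_of_tendsto {f : ℤ → ℝ} {n : ℤ} (h : ∀ k, k ≤ n → f (k - 1) ≤ f k)
    (hf : Tendsto f atBot (𝓝 0)) : 0 ≤ f n := by
  have := nonneg_of_antitone_of_tendsto (f := fun k => f (-k)) (n := -n)
    (fun k hk => by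
      have := h (-k) (by omega)
      rwa [show -(k + 1) = -k - 1 by ring]) (hf.comp tendsto_neg_atTop_atBot)
  simpa using this

theorem exists_le_mul_of_eventually {f g : ℤ → ℝ} (hg : ∀ n, 0 < g n)
    (hbot : ∃ C, ∀ᶠ n in atBot, f n ≤ C * g n) (htop : ∃ C, ∀ᶠ n in atTop, f n ≤ C * g n) :
    ∃ C, 0 < C ∧ ∀ n, f n ≤ C * g n := by
  obtain ⟨C₁, h₁⟩ := hbot
  obtain ⟨C₂, h₂⟩ := htop
  obtain ⟨N₁, hN₁⟩ := eventually_atBot.mp h₁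
  obtain ⟨N₂, hN₂⟩ := eventually_atTop.mp h₂
  have hsum : ∀ n ∈ Finset.Icc N₁ N₂, f n / g n ≤ ∑ k ∈ Finset.Icc N₁ N₂, |f k / g k| := by
    intro n hn
    exact (le_abs_self _).trans
      (Finset.single_le_sum (f := fun k => |f k / g k|) (fun k _ => abs_nonneg _) hn)
  have h0 : 0 ≤ ∑ k ∈ Finset.Icc N₁ N₂, |f k / g k| := Finset.sum_nonneg fun k _ => abs_nonneg _
  set C₃ := ∑ k ∈ Finset.Icc N₁ N₂, |f k / g k|
  refine ⟨|C₁| + |C₂| + C₃ + 1, by positivity, fun n => ?_⟩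
  have hgn := hg n
  have a1 := abs_nonneg C₁
  have a2 := abs_nonneg C₂
  by_cases h1 : n ≤ N₁
  · refine (hN₁ n h1).trans ?_
    gcongr
    linarith [le_abs_self C₁]
  by_cases h2 : N₂ ≤ n
  · refine (hN₂ n h2).trans ?_
    gcongr
    linarith [le_abs_self C₂]
  have := hsum n (Finset.mem_Icc.mpr ⟨by omega, by omega⟩)
  rw [div_le_iff₀ hgn] at this
  refine this.trans ?_
  gcongr
  linarith

/-! ### Reference rates and their reversible measure -/

/-- Time-independent rates `a` (downwards) and `b` (upwards) with the asymptotic behaviour of those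
of the linearized problem with constant shifts. -/
structure IsReferenceRates (β g : ℝ) (a b : ℤ → ℝ) : Prop where
  g_pos : 0 < g
  a_pos : ∀ n, 0 < a n
  b_pos : ∀ n, 0 < b n
  a_bot : Tendsto a atBot (𝓝 g)
  b_bot : Tendsto b atBot (𝓝 (8 * g))
  a_top : ∃ C, 0 < C ∧ ∀ n : ℤ, 0 ≤ n → 2 ^ (β * (n : ℝ)) ≤ C * a n ∧ a n ≤ C * 2 ^ (β * (n : ℝ))
  b_top : ∀ q : ℝ, Tendsto (fun n : ℤ => 2 ^ (q * (n : ℝ)) * b n) atTop (𝓝 0)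

theorem exists_int_product (ρ : ℤ → ℝ) (hρ : ∀ n, 0 < ρ n) :
    ∃ m : ℤ → ℝ, (∀ n, 0 < m n) ∧ ∀ n, m (n + 1) = ρ n * m n := by
  let m : ℤ → ℝ := fun n => match n with
    | Int.ofNat k => ∏ i ∈ Finset.range k, ρ i
    | Int.negSucc k => ∏ i ∈ Finset.range (k + 1), (ρ (-(i : ℤ) - 1))⁻¹
  refine ⟨m, fun n => ?_, fun n => ?_⟩
  · rcases n with k | k
    · exact Finset.prod_pos fun i _ => hρ _
    · exact Finset.prod_pos fun i _ => inv_pos.mpr (hρ _)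
  · rcases n with k | k
    · change m (Int.ofNat (k + 1)) = _
      simp only [m, Finset.prod_range_succ]
      exact mul_comm _ _
    · rcases k with _ | k
      · change m (Int.ofNat 0) = ρ (Int.negSucc 0) * m (Int.negSucc 0)
        simp only [m]
        simp [(hρ (-1)).ne']
      · change m (Int.negSucc k) = ρ (Int.negSucc (k + 1)) * m (Int.negSucc (k + 1))
        simp only [m]
        rw [Finset.prod_range_succ _ (k + 1)]
        have : (-((k + 1 : ℕ) : ℤ) - 1) = Int.negSucc (k + 1) := by
          rw [Int.negSucc_eq]; push_cast; ring
        rw [this]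
        field_simp [(hρ (Int.negSucc (k + 1))).ne']

namespace IsReferenceRates

variable {β g : ℝ} {a b : ℤ → ℝ} (h : IsReferenceRates β g a b)
include h

theorem b_tendsto : Tendsto b atTop (𝓝 0) := by
  simpa using h.b_top 0

/-- The ratio of up to down rates tends to `8` at `-∞`, so the reversible measure decays there
roughly like `8^{-|n|}`, which beats the weight `2^{|n|}`. -/
theorem tendsto_ratio_bot : Tendsto (fun n => a (n + 1) / b n) atBot (𝓝 (1 / 8)) := by
  have h1 : Tendsto (fun n : ℤ => a (n + 1)) atBot (𝓝 g) :=
    h.a_bot.comp (tendsto_atBot_add_const_right _ 1 tendsto_id)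
  have := h1.div h.b_bot (by have := h.g_pos; positivity)
  have hg := h.g_pos.ne'
  rwa [show g / (8 * g) = 1 / 8 by field_simp] at this

theorem tendsto_ratio_top (hβ : 0 < β) : Tendsto (fun n => b n / a (n + 1)) atTop (𝓝 0) := by
  obtain ⟨C, hC, hCa⟩ := h.a_top
  have h1 : Tendsto (fun n => b n * C) atTop (𝓝 0) := by
    simpa using h.b_tendsto.mul_const C
  refine squeeze_zero' (Eventually.of_forall fun n => (div_pos (h.b_pos _) (h.a_pos _)).le) ?_ h1
  filter_upwards [eventually_ge_atTop 0] with n hn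
  rw [div_le_iff₀ (h.a_pos _), mul_assoc]
  have h2 := (hCa (n + 1) (by omega)).1
  have h3 : (1 : ℝ) ≤ 2 ^ (β * ((n + 1 : ℤ) : ℝ)) := by
    apply Real.one_le_rpow one_le_two
    have : (0 : ℝ) ≤ ((n + 1 : ℤ) : ℝ) := by exact_mod_cast (by omega : 0 ≤ n + 1)
    positivity
  nlinarith [h.b_pos n]

/-- The reversible measure of the birth-death chain with rates `a`, `b`. -/
theorem exists_reversible_measure (hβ : 0 < β) :
    ∃ m : ℤ → ℝ, (∀ n, 0 < m n) ∧ (∀ n, m (n + 1) * a (n + 1) = m n * b n) ∧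
      (∀ᶠ n in atTop, 4 * m (n + 1) ≤ m n) ∧ (∀ᶠ n in atBot, 4 * m n ≤ m (n + 1)) ∧
      Summable (fun n => m n * 2 ^ n.natAbs) := by
  obtain ⟨m, hm, hrec⟩ := exists_int_product (fun n => b n / a (n + 1))
    (fun n => div_pos (h.b_pos _) (h.a_pos _))
  -- A factor `4` per step, here and at `-∞`, leaves the ratio `1/2` after multiplication by
  -- `2^|n|`.
  have htop : ∀ᶠ n in atTop, 4 * m (n + 1) ≤ m n := by
    filter_upwards [(h.tendsto_ratio_top hβ).eventually_le_const
      (by norm_num : (0 : ℝ) < 1 / 4)] with n hn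
    rw [hrec]
    nlinarith [hm n]
  have hbot : ∀ᶠ n in atBot, 4 * m n ≤ m (n + 1) := by
    filter_upwards [h.tendsto_ratio_bot.eventually_le_const
      (by norm_num : (1 / 8 : ℝ) < 1 / 4)] with n hn
    rw [hrec]
    have h1 : b n / a (n + 1) = (a (n + 1) / b n)⁻¹ := by rw [inv_div]
    have h2 : 0 < a (n + 1) / b n := div_pos (h.a_pos _) (h.b_pos _)
    have h3 : (4 : ℝ) ≤ b n / a (n + 1) := by
      rw [h1, le_inv_comm₀ (by norm_num) h2]
      linarith
    nlinarith [hm n]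
  refine ⟨m, hm, fun n => ?_, htop, hbot, ?_⟩
  · rw [hrec]
    field_simp [(h.a_pos (n + 1)).ne']
  · refine Summable.of_nat_of_neg ?_ ?_
    · refine summable_of_ratio_norm_eventually_le (r := 1 / 2) (by norm_num) ?_
      filter_upwards [tendsto_natCast_atTop_atTop.eventually htop] with k hk
      rw [Real.norm_of_nonneg (by have := hm ((k + 1 : ℕ) : ℤ); positivity),
        Real.norm_of_nonneg (by have := hm (k : ℤ); positivity)]
      simp only [Int.natAbs_natCast, pow_succ]
      push_cast
      have : (0 : ℝ) < 2 ^ k := by positivity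
      nlinarith
    · have hev : ∀ᶠ k : ℕ in atTop, 4 * m (-(k : ℤ) - 1) ≤ m (-(k : ℤ) - 1 + 1) :=
        ((tendsto_atBot_add_const_right _ (-1) (tendsto_neg_atTop_atBot.comp
          (tendsto_natCast_atTop_atTop (R := ℤ))))).eventually hbot
      refine summable_of_ratio_norm_eventually_le (r := 1 / 2) (by norm_num) ?_
      filter_upwards [hev] with k hk
      rw [Real.norm_of_nonneg (by have := hm (-((k + 1 : ℕ) : ℤ)); positivity),
        Real.norm_of_nonneg (by have := hm (-(k : ℤ)); positivity)]
      simp only [Int.natAbs_neg, Int.natAbs_natCast, pow_succ]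
      rw [sub_add_cancel] at hk
      rw [show -((k + 1 : ℕ) : ℤ) = -(k : ℤ) - 1 by push_cast; ring]
      have : (0 : ℝ) < 2 ^ k := by positivity
      nlinarith

end IsReferenceRates

/-! ### Tail sums and the static supersolution -/

/-- The tail sums `∑_{j > n} f_j` of a summable family on `ℤ`. -/
noncomputable def tailSum (f : ℤ → ℝ) (n : ℤ) : ℝ := ∑' j : ℤ, if n < j then f j else 0

section TailSum

variable {f : ℤ → ℝ} (hf : Summable f)
include hf

theorem summable_tail (n : ℤ) : Summable fun j : ℤ => if n < j then f j else 0 := by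
  refine Summable.of_norm_bounded hf.norm fun j => ?_
  split_ifs
  · exact le_rfl
  · simp

theorem tailSum_sub_one (n : ℤ) : tailSum f (n - 1) = f n + tailSum f n := by
  have h1 : ∀ j : ℤ, (if n - 1 < j then f j else 0) =
      (if j = n then f n else 0) + if n < j then f j else 0 := by
    intro j
    rcases lt_trichotomy j n with h | h | h
    · simp [h.ne, h.not_gt, show ¬ n - 1 < j by omega]
    · subst h; simp
    · simp [h.ne', h, show n - 1 < j by omega]
  unfold tailSum
  simp only [h1]
  rw [Summable.tsum_add _ (summable_tail hf n), tsum_ite_eq]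
  exact (hasSum_ite_eq n (f n)).summable

theorem tendsto_tailSum_atTop : Tendsto (tailSum f) atTop (𝓝 0) := by
  have := tendsto_tsum_of_dominated_convergence (𝓕 := (atTop : Filter ℤ))
    (f := fun n j : ℤ => if n < j then f j else 0) (g := fun _ => 0) hf.norm ?_ ?_
  · rw [tsum_zero] at this
    exact this
  · intro j
    refine tendsto_const_nhds.congr' ?_
    filter_upwards [eventually_ge_atTop j] with n hn
    simp [hn.not_gt]
  · refine Eventually.of_forall fun n j => ?_
    split_ifs
    · exact le_rfl
    · simp

theorem tendsto_tailSum_atBot : Tendsto (tailSum f) atBot (𝓝 (∑' j, f j)) := by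
  refine tendsto_tsum_of_dominated_convergence (𝓕 := (atBot : Filter ℤ))
    (f := fun n j : ℤ => if n < j then f j else 0) hf.norm ?_ ?_
  · intro j
    refine tendsto_const_nhds.congr' ?_
    filter_upwards [eventually_lt_atBot j] with n hn
    simp [hn]
  · refine Eventually.of_forall fun n j => ?_
    split_ifs
    · exact le_rfl
    · simp

end TailSum

namespace IsReferenceRates

variable {β g : ℝ} {a b : ℤ → ℝ} (h : IsReferenceRates β g a b)
include h

/-- A positive static supersolution for the equation of the differences, obtained from a strictly
increasing right-hand side of mean zero with respect to the reversible measure. -/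
theorem exists_static_weight (hβ : 0 < β) {ε : ℝ} (hε : 0 < ε) :
    ∃ w F : ℤ → ℝ, ∃ C : ℝ, 0 < C ∧ (∀ n, 0 < w n) ∧ (∀ n, w n ≤ C * wt β n) ∧
      (∀ n, wt β n ≤ C * w n) ∧ (∀ n, a n * w (n - 1) - b n * w n = F n) ∧
      ∀ n, wt ε n ≤ C * (F (n + 1) - F n) := by
  obtain ⟨m, hm, hrev, htop, hbot, hsum⟩ := h.exists_reversible_measure hβ
  have hsm : Summable m := by
    refine Summable.of_nonneg_of_le (fun n => (hm n).le) (fun n => ?_) hsum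
    exact le_mul_of_one_le_right (hm n).le (one_le_two_pow_natAbs n)
  have hsw : Summable fun n => m n * wt ε n := by
    refine Summable.of_nonneg_of_le (fun n => (mul_pos (hm n) (wt_pos _ n)).le) (fun n => ?_) hsum
    exact mul_le_mul_of_nonneg_left (wt_le_two_pow (by linarith) n) (hm n).le
  have hM : 0 < ∑' n, m n := hsm.tsum_pos (fun n => (hm n).le) 0 (hm 0)
  have hG : 0 < ∑' n, m n * wt ε n :=
    hsw.tsum_pos (fun n => (mul_pos (hm n) (wt_pos _ n)).le) 0 (mul_pos (hm 0) (wt_pos _ 0))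
  -- `c` is the `m`-average of the weight, so `F = c - wt ε` has mean zero. It increases strictly,
  -- tends to `c` at `+∞`, and behaves like `-2^{|n|}` at `-∞`.
  set c := (∑' n, m n * wt ε n) / ∑' n, m n with hc
  have hc0 : 0 < c := div_pos hG hM
  set F : ℤ → ℝ := fun n => c - wt ε n with hF
  have hFsum : Summable fun n => m n * F n := by
    have := (hsm.mul_right c).sub hsw
    refine this.congr fun n => ?_
    simp only [hF]; ring
  have hFmean : ∑' n, m n * F n = 0 := by
    have h1 : ∀ n, m n * F n = m n * c - m n * wt ε n := fun n => by simp only [hF]; ring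
    simp only [h1]
    rw [Summable.tsum_sub (hsm.mul_right c) hsw, tsum_mul_right, hc, mul_div_cancel₀ _ hM.ne']
    ring
  set κ := min (1 / 2) (1 - (2 : ℝ) ^ (-ε)) with hκ
  have hκ0 : 0 < κ := by
    refine lt_min (by norm_num) ?_
    have : (2 : ℝ) ^ (-ε) < 1 := Real.rpow_lt_one_of_one_lt_of_neg one_lt_two (by linarith)
    linarith
  have hFinc : ∀ n, κ * wt ε n ≤ F (n + 1) - F n := by
    intro n
    have := wt_succ_add_le (θ := ε) n
    simp only [hF]
    linarith
  have hFlt : ∀ n, F n < F (n + 1) := fun n => by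
    have := hFinc n
    have := mul_pos hκ0 (wt_pos ε n)
    linarith
  have hFmono : StrictMono F := strictMono_int_of_lt_succ hFlt
  set S := tailSum fun n => m n * F n with hS
  have hSrec : ∀ n, S (n - 1) = m n * F n + S n := fun n => tailSum_sub_one hFsum n
  have hSrec' : ∀ n, S n = m (n + 1) * F (n + 1) + S (n + 1) := fun n => by
    have := hSrec (n + 1)
    rwa [add_sub_cancel_right] at this
  have hStop : Tendsto S atTop (𝓝 0) := tendsto_tailSum_atTop hFsum
  have hSbot : Tendsto S atBot (𝓝 0) := by
    have := tendsto_tailSum_atBot hFsum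
    rwa [hFmean] at this
  -- `F` changes sign once. Where `F ≥ 0` from `n + 1` on, `S n` is a sum of nonnegative terms, one
  -- of them positive; otherwise mean zero turns `S n` into minus a sum of negative terms from `-∞`.
  have hSpos : ∀ n, 0 < S n := by
    intro n
    rcases le_or_gt 0 (F (n + 1)) with hn | hn
    · have h1 : 0 ≤ S (n + 2) := by
        refine nonneg_of_antitone_of_tendsto (fun k hk => ?_) hStop
        rw [hSrec' k]
        have : F (n + 1) ≤ F (k + 1) := hFmono.monotone (by omega)
        have := mul_nonneg (hm (k + 1)).le (hn.trans this)
        linarith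
      have h2 := hSrec' n
      have h3 := hSrec' (n + 1)
      rw [show n + 1 + 1 = n + 2 by ring] at h3
      have h4 : 0 < F (n + 2) := hn.trans_lt (hFmono (by omega))
      have h5 := mul_pos (hm (n + 2)) h4
      have h6 := mul_nonneg (hm (n + 1)).le hn
      linarith
    · have hneg : ∀ k ≤ n, F k < 0 := fun k hk => (hFmono (by omega : k < n + 1)).trans hn
      have h1 : 0 ≤ S (n - 1) := by
        refine nonneg_of_monotone_of_tendsto (fun k hk => ?_) hSbot
        rw [hSrec k]
        have := mul_neg_of_pos_of_neg (hm k) (hneg k (by omega))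
        linarith
      have h2 := hSrec n
      have := mul_neg_of_pos_of_neg (hm n) (hneg n le_rfl)
      linarith
  -- By reversibility `m_n a_n w_{n-1} = S_{n-1}` and `m_n b_n w_n = S_n`, whose difference is `m_n
  -- F_n`.
  set w : ℤ → ℝ := fun n => S n / (m (n + 1) * a (n + 1)) with hw
  have hden : ∀ n, 0 < m n * a n := fun n => mul_pos (hm n) (h.a_pos n)
  have hwpos : ∀ n, 0 < w n := fun n => div_pos (hSpos n) (hden _)
  obtain ⟨Ca, hCa0, hCa⟩ := h.a_top
  have hzpow : ∀ n : ℤ, 0 ≤ n →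
      2 ^ (β * ((n + 1 : ℤ) : ℝ)) * wt β n = 2 ^ β := by
    intro n hn
    rw [wt_of_nonneg hn, ← Real.rpow_add two_pos]
    push_cast
    ring_nf
  have hFtend : Tendsto F atTop (𝓝 c) := by
    have := (tendsto_wt_atTop hε).const_sub c
    simpa using this
  have hFbot : ∀ᶠ n in atBot, 2 * c ≤ wt ε n := (tendsto_wt_atBot ε).eventually_ge_atTop _
  -- the four asymptotic bounds
  have hwtop : ∀ᶠ n in atTop, w n ≤ 2 * c * Ca * wt β n := by
    obtain ⟨N, hN⟩ := eventually_atTop.mp htop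
    filter_upwards [eventually_ge_atTop N, eventually_ge_atTop 0] with n hn hn0
    -- `F ≤ c` and `m` decays geometrically, so the tail is comparable with its first term; dividing
    -- by `m_{n+1} a_{n+1}` leaves a multiple of `2^{-βn}`.
    have hS1 : S n ≤ 2 * c * m (n + 1) := by
      have hT : Tendsto (fun n => 2 * c * m (n + 1) - S n) atTop (𝓝 0) := by
        have h1 : Tendsto m atTop (𝓝 0) :=
          hsm.tendsto_cofinite_zero.mono_left atTop_le_cofinite
        have h2 : Tendsto (fun n : ℤ => m (n + 1)) atTop (𝓝 0) :=
          h1.comp (tendsto_atTop_add_const_right _ 1 tendsto_id)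
        simpa using (h2.const_mul (2 * c)).sub hStop
      have := nonneg_of_antitone_of_tendsto (n := n) (fun k hk => ?_) hT
      · linarith
      · have h1 := hN (k + 1) (by omega)
        have h2 := hSrec' k
        have h3 : m (k + 1) * F (k + 1) ≤ m (k + 1) * c := by
          have : F (k + 1) ≤ c := by simp only [hF]; linarith [wt_pos ε (k + 1)]
          exact mul_le_mul_of_nonneg_left this (hm _).le
        nlinarith [hm (k + 1)]
    simp only [hw]
    rw [div_le_iff₀ (hden _)]
    have h1 := (hCa (n + 1) (by omega)).1
    have h2 : 1 ≤ Ca * a (n + 1) * wt β n := by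
      have h3 := mul_le_mul_of_nonneg_right h1 (wt_pos β n).le
      rw [hzpow n hn0] at h3
      exact (Real.one_le_rpow one_le_two hβ.le).trans h3
    have h3 : 2 * c * m (n + 1) * 1 ≤ 2 * c * m (n + 1) * (Ca * a (n + 1) * wt β n) :=
      mul_le_mul_of_nonneg_left h2 (by have := hm (n + 1); positivity)
    calc S n ≤ 2 * c * m (n + 1) * 1 := by linarith
      _ ≤ _ := h3
      _ = _ := by ring
  have hwtop' : ∀ᶠ n in atTop, wt β n ≤ 2 / c * Ca * 2 ^ β * w n := by
    filter_upwards [(tendsto_atTop_add_const_right _ 1 tendsto_id).eventually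
      (hFtend.eventually_const_le (half_lt_self hc0)), eventually_ge_atTop 0] with n hn hn0
    simp only [id] at hn
    have h1 : m (n + 1) * (c / 2) ≤ S n := by
      have := mul_le_mul_of_nonneg_left hn (hm (n + 1)).le
      linarith [hSrec' n, hSpos (n + 1)]
    have h2 := (hCa (n + 1) (by omega)).2
    have h3 : a (n + 1) * wt β n ≤ Ca * 2 ^ β := by
      have h4 := mul_le_mul_of_nonneg_right h2 (wt_pos β n).le
      rwa [mul_assoc, hzpow n hn0] at h4
    have h5 : c / 2 ≤ a (n + 1) * w n := by
      simp only [hw]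
      rw [mul_div_assoc', le_div_iff₀ (hden _)]
      nlinarith [h.a_pos (n + 1)]
    have h6 : (c / 2) * wt β n ≤ w n * (Ca * 2 ^ β) := by
      calc (c / 2) * wt β n ≤ a (n + 1) * w n * wt β n :=
            mul_le_mul_of_nonneg_right h5 (wt_pos β n).le
        _ = w n * (a (n + 1) * wt β n) := by ring
        _ ≤ _ := mul_le_mul_of_nonneg_left h3 (hwpos n).le
    calc wt β n = 2 / c * ((c / 2) * wt β n) := by field_simp
      _ ≤ 2 / c * (w n * (Ca * 2 ^ β)) := mul_le_mul_of_nonneg_left h6 (by positivity)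
      _ = _ := by ring
  have hbb : ∀ᶠ n in atBot, g ≤ b n ∧ b n ≤ 9 * g := by
    have := h.g_pos
    exact (h.b_bot.eventually_const_le (by linarith)).and
      (h.b_bot.eventually_le_const (by linarith))
  have hwbot : ∀ᶠ n in atBot, w n ≤ 2 / g * wt β n := by
    obtain ⟨N, hN⟩ := eventually_atBot.mp hbot
    filter_upwards [eventually_le_atBot N, eventually_le_atBot 0, hbb] with n hn hn0 hb
    have hw2 : ∀ k : ℤ, k ≤ 0 → wt ε (k - 1) = 2 * wt ε k := by
      intro k hk
      rw [wt_of_nonpos (by omega), wt_of_nonpos hk]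
      push_cast
      rw [show -((k : ℝ) - 1) = 1 + -(k : ℝ) by ring, Real.rpow_add two_pos, Real.rpow_one]
    -- Going left, the weight doubles while `m` shrinks by at least `4`, so the sum from `-∞` is
    -- again comparable with its last term.
    have hS1 : S n ≤ 2 * (m n * wt ε n) := by
      have hT : Tendsto (fun n => 2 * (m n * wt ε n) - S n) atBot (𝓝 0) := by
        have h1 : Tendsto (fun n => m n * wt ε n) atBot (𝓝 0) :=
          hsw.tendsto_cofinite_zero.mono_left atBot_le_cofinite
        simpa using (h1.const_mul 2).sub hSbot
      have := nonneg_of_monotone_of_tendsto (n := n) (fun k hk => ?_) hT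
      · linarith
      · have h1 := hN (k - 1) (by omega)
        rw [sub_add_cancel] at h1
        have h2 := hSrec k
        have h3 : -(m k * wt ε k) ≤ m k * F k := by
          simp only [hF]
          nlinarith [hm k]
        rw [hw2 k (by omega)]
        nlinarith [wt_pos ε k]
    have h1 : w n = S n / (m n * b n) := by simp only [hw]; rw [hrev]
    rw [h1, div_le_iff₀ (mul_pos (hm n) (h.b_pos n))]
    have h2 : wt β n = wt ε n := by rw [wt_of_nonpos hn0, wt_of_nonpos hn0]
    rw [h2]
    have hg := h.g_pos
    have h3 : 2 * (m n * wt ε n) * 1 ≤ 2 * (m n * wt ε n) * (b n / g) := by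
      refine mul_le_mul_of_nonneg_left ?_ (by have := hm n; have := wt_pos ε n; positivity)
      rw [le_div_iff₀ hg]; linarith [hb.1]
    calc S n ≤ 2 * (m n * wt ε n) * 1 := by linarith
      _ ≤ _ := h3
      _ = _ := by field_simp
  have hwbot' : ∀ᶠ n in atBot, wt β n ≤ 18 * g * w n := by
    filter_upwards [eventually_le_atBot 0, hbb, hFbot] with n hn0 hb hFn
    have h2 : wt β n = wt ε n := by rw [wt_of_nonpos hn0, wt_of_nonpos hn0]
    have h1 : w n = S n / (m n * b n) := by simp only [hw]; rw [hrev]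
    have h3 : m n * (wt ε n / 2) ≤ S n := by
      have h4 : m n * F n ≤ m n * (-(wt ε n / 2)) := by
        refine mul_le_mul_of_nonneg_left ?_ (hm n).le
        simp only [hF]; linarith
      linarith [hSrec n, hSpos (n - 1)]
    have h4 : wt ε n / 2 ≤ b n * w n := by
      rw [h1, mul_div_assoc', le_div_iff₀ (mul_pos (hm n) (h.b_pos n))]
      nlinarith [h.b_pos n]
    rw [h2]
    nlinarith [hwpos n, hb.2]
  obtain ⟨C₁, hC₁, hw1⟩ := exists_le_mul_of_eventually (wt_pos β) ⟨_, hwbot⟩ ⟨_, hwtop⟩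
  obtain ⟨C₂, hC₂, hw2⟩ := exists_le_mul_of_eventually hwpos ⟨_, hwbot'⟩ ⟨_, hwtop'⟩
  refine ⟨w, F, C₁ + C₂ + κ⁻¹, by positivity, hwpos, fun n => ?_, fun n => ?_, fun n => ?_,
    fun n => ?_⟩
  · refine (hw1 n).trans (mul_le_mul_of_nonneg_right ?_ (wt_pos _ _).le)
    have := inv_pos.mpr hκ0
    linarith
  · refine (hw2 n).trans (mul_le_mul_of_nonneg_right ?_ (hwpos _).le)
    have := inv_pos.mpr hκ0
    linarith
  · have h1 : a n * w (n - 1) = S (n - 1) / m n := by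
      simp only [hw, sub_add_cancel]
      field_simp [(h.a_pos n).ne', (hm n).ne']
    have h2 : b n * w n = S n / m n := by
      simp only [hw]
      rw [hrev]
      field_simp [(h.b_pos n).ne', (hm n).ne']
    rw [h1, h2, hSrec n]
    field_simp [(hm n).ne']
    ring
  · have h1 := hFinc n
    have h2 := hFlt n
    have h3 : wt ε n ≤ κ⁻¹ * (F (n + 1) - F n) := by
      rw [← div_eq_inv_mul, le_div_iff₀ hκ0]
      linarith
    refine h3.trans (mul_le_mul_of_nonneg_right ?_ (by linarith))
    linarith

end IsReferenceRates

namespace IsReferenceRates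

variable {β g : ℝ} {a b : ℤ → ℝ} (h : IsReferenceRates β g a b)
include h

theorem exists_b_le : ∃ K, 0 < K ∧ ∀ n, b n ≤ K := by
  have hg := h.g_pos
  obtain ⟨K, hK, hb⟩ := exists_le_mul_of_eventually (f := b) (g := fun _ => 1)
    (fun _ => one_pos)
    ⟨9 * g, by simpa using h.b_bot.eventually_le_const (by linarith : 8 * g < 9 * g)⟩
    ⟨1, by simpa using h.b_tendsto.eventually_le_const one_pos⟩
  exact ⟨K, hK, fun n => by simpa using hb n⟩

/-- Growth `2^{βn}` of the rate against decay `2^{-βn}` of the weight: the product is bounded at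
`+∞` but need not decay. This is the term for which closeness of the rates alone does not suffice in
the perturbation argument. -/
theorem exists_a_succ_le :
    ∃ K, 0 < K ∧ ∀ n, a (n + 1) * wt β n ≤ K * wt 0 n := by
  have hg := h.g_pos
  obtain ⟨C, hC, hCa⟩ := h.a_top
  refine exists_le_mul_of_eventually (wt_pos 0) ⟨2 * g, ?_⟩ ⟨C * 2 ^ β, ?_⟩
  · filter_upwards [(tendsto_atBot_add_const_right _ 1 tendsto_id).eventually
      (h.a_bot.eventually_le_const (by linarith : g < 2 * g)), eventually_le_atBot 0] with n hn hn0
    rw [wt_of_nonpos hn0, wt_of_nonpos hn0]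
    exact mul_le_mul_of_nonneg_right hn (by positivity)
  · filter_upwards [eventually_ge_atTop 0] with n hn
    have h1 := mul_le_mul_of_nonneg_right (hCa (n + 1) (by omega)).2 (wt_pos β n).le
    refine h1.trans (le_of_eq ?_)
    rw [wt_of_nonneg hn, wt_of_nonneg hn, mul_assoc, ← Real.rpow_add two_pos]
    push_cast
    ring_nf
    simp

theorem exists_a_le_of_nonpos : ∃ K, 0 < K ∧ ∀ n ≤ 0, a n ≤ K := by
  have hg := h.g_pos
  obtain ⟨K, hK, ha⟩ := exists_le_mul_of_eventually (f := fun n => if n ≤ 0 then a n else 0)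
    (g := fun _ => 1) (fun _ => one_pos)
    ⟨2 * g, by
      filter_upwards [h.a_bot.eventually_le_const (by linarith : g < 2 * g)] with n hn
      split_ifs
      · linarith
      · linarith⟩
    ⟨0, by
      filter_upwards [eventually_gt_atTop 0] with n hn
      simp [hn.not_ge]⟩
  exact ⟨K, hK, fun n hn => by simpa [hn] using ha n⟩

/-- The down rates are unbounded at `+∞`; what replaces a bound is that inflow from `n - 1` is
dominated by the outflow rate `a_{n+1}`. -/
theorem exists_a_le_mul_a_succ (hβ : 0 < β) : ∃ K, 0 < K ∧ ∀ n, a n ≤ K * a (n + 1) := by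
  have hg := h.g_pos
  obtain ⟨C, hC, hCa⟩ := h.a_top
  refine exists_le_mul_of_eventually (fun n => h.a_pos (n + 1)) ⟨4, ?_⟩ ⟨C * C, ?_⟩
  · filter_upwards [(tendsto_atBot_add_const_right _ 1 tendsto_id).eventually
      (h.a_bot.eventually_const_le (by linarith : g / 2 < g)),
      h.a_bot.eventually_le_const (by linarith : g < 2 * g)] with n hn hn'
    simp only [id] at hn
    linarith
  · filter_upwards [eventually_ge_atTop 0] with n hn
    have h1 := (hCa n hn).2
    have h2 := (hCa (n + 1) (by omega)).1
    have h3 : (2 : ℝ) ^ (β * (n : ℝ)) ≤ 2 ^ (β * ((n + 1 : ℤ) : ℝ)) := by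
      apply Real.rpow_le_rpow_of_exponent_le one_le_two
      push_cast
      nlinarith
    rw [mul_assoc]
    exact h1.trans (mul_le_mul_of_nonneg_left (h3.trans h2) hC.le)

end IsReferenceRates

/-! ### Perturbed rates and comparison for the differences -/

/-- Time-dependent rates close to reference rates `a`, `b`. The ratio `A_{n+1} / A_n` is close to
`2^β` for `2^{β n} t` large, and `A_n / a_n` varies slowly with `n` for `t ≥ 1`. -/
structure IsPerturbedRates (β : ℝ) (a b : ℤ → ℝ) (c₀ δ ε₁ ε : ℝ) (A B : ℝ → ℤ → ℝ) : Prop where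
  cont_a : ∀ n, ContinuousOn (fun t => A t n) (Ioi 0)
  cont_b : ∀ n, ContinuousOn (fun t => B t n) (Ioi 0)
  near_a : ∀ t, 0 < t → ∀ n, |A t n - a n| ≤ ε * a n
  near_b : ∀ t, 0 < t → ∀ n, |B t n - b n| ≤ ε * b n
  early : ∀ t ∈ Ioc (0 : ℝ) 1, ∀ n : ℤ, 0 ≤ n →
    (1 - c₀ * (1 + 2 ^ (β * (n : ℝ)) * t) ^ (-δ)) * (2 ^ β * A t n) ≤ A t (n + 1)
  late : ∀ t, 1 ≤ t → ∀ n : ℤ, 0 ≤ n → |A t (n + 1) / a (n + 1) - A t n / a n| ≤ ε * wt ε₁ n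

/-- Solutions of the system for the differences `d_n = y_{n+1} - y_n`. -/
structure IsDiffSolution (A B : ℝ → ℤ → ℝ) (d : ℝ → ℤ → ℝ) : Prop where
  cont : ∀ n, ContinuousOn (fun t => d t n) (Ici 0)
  deriv : ∀ t, 0 < t → ∀ n, HasDerivAt (fun s => d s n)
    (A t n * d t (n - 1) - (A t (n + 1) + B t n) * d t n + B t (n + 1) * d t (n + 1)) t
  growth : ∀ T : ℝ, ∃ M : ℝ, ∀ t ∈ Icc 0 T, ∀ n, |d t n| ≤ M * 2 ^ n.natAbs

theorem IsDiffSolution.neg {A B d : ℝ → ℤ → ℝ} (hd : IsDiffSolution A B d) :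
    IsDiffSolution A B (fun t n => -d t n) where
  cont n := (hd.cont n).neg
  deriv t ht n := (hd.deriv t ht n).neg.congr_deriv (by ring)
  growth T := by simpa using hd.growth T

/-- Supersolutions (in the viscosity sense) of the system for the differences on `[t₁, T]`. -/
structure IsDiffBarrier (A B : ℝ → ℤ → ℝ) (t₁ T : ℝ) (w : ℝ → ℤ → ℝ) : Prop where
  cont : ∀ n, ContinuousOn (fun t => w t n) (Icc t₁ T)
  nonneg : ∀ t ∈ Icc t₁ T, ∀ n, 0 ≤ w t n
  super : ∀ t ∈ Ioc t₁ T, ∀ n, ∃ (ψ : ℝ → ℝ) (ψ' : ℝ), HasDerivAt ψ ψ' t ∧ ψ t = w t n ∧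
    (∀ s ∈ Icc t₁ t, w s n ≤ ψ s) ∧
    A t n * w t (n - 1) - (A t (n + 1) + B t n) * w t n + B t (n + 1) * w t (n + 1) ≤ ψ'

theorem IsDiffBarrier.const_mul {A B : ℝ → ℤ → ℝ} {t₁ T : ℝ} {w : ℝ → ℤ → ℝ}
    (hw : IsDiffBarrier A B t₁ T w) {M : ℝ} (hM : 0 ≤ M) :
    IsDiffBarrier A B t₁ T (fun t n => M * w t n) where
  cont n := continuousOn_const.mul (hw.cont n)
  nonneg t ht n := mul_nonneg hM (hw.nonneg t ht n)
  super t ht n := by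
    obtain ⟨ψ, ψ', h1, h2, h3, h4⟩ := hw.super t ht n
    refine ⟨fun s => M * ψ s, M * ψ', h1.const_mul M, by simp [h2], fun s hs =>
      mul_le_mul_of_nonneg_left (h3 s hs) hM, ?_⟩
    have := mul_le_mul_of_nonneg_left h4 hM
    linarith

theorem natAbs_pred_succ_of_pos {n : ℤ} (hn : 1 ≤ n) :
    n.natAbs = (n - 1).natAbs + 1 ∧ (n + 1).natAbs = n.natAbs + 1 := by omega

theorem natAbs_pred_succ_of_nonpos {n : ℤ} (hn : n ≤ 0) :
    (n - 1).natAbs = n.natAbs + 1 ∧ (n + 1).natAbs ≤ n.natAbs + 1 := by omega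

namespace IsPerturbedRates

variable {β g : ℝ} {a b : ℤ → ℝ} {c₀ δ ε₁ ε : ℝ} {A B : ℝ → ℤ → ℝ}

section Basic

variable (h : IsReferenceRates β g a b) (hp : IsPerturbedRates β a b c₀ δ ε₁ ε A B) (hε : ε ≤ 1 / 2)
include h hp hε

theorem a_bounds {t : ℝ} (ht : 0 < t) (n : ℤ) : a n / 2 ≤ A t n ∧ A t n ≤ 2 * a n := by
  have h1 := abs_le.mp (hp.near_a t ht n)
  have h2 := h.a_pos n
  constructor <;> nlinarith

theorem b_bounds {t : ℝ} (ht : 0 < t) (n : ℤ) : b n / 2 ≤ B t n ∧ B t n ≤ 2 * b n := by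
  have h1 := abs_le.mp (hp.near_b t ht n)
  have h2 := h.b_pos n
  constructor <;> nlinarith

theorem a_pos {t : ℝ} (ht : 0 < t) (n : ℤ) : 0 < A t n :=
  (half_pos (h.a_pos n)).trans_le (hp.a_bounds h hε ht n).1

theorem b_pos {t : ℝ} (ht : 0 < t) (n : ℤ) : 0 < B t n :=
  (half_pos (h.b_pos n)).trans_le (hp.b_bounds h hε ht n).1

/-- The Lyapunov function is `Λ^|n|` with `Λ = 4 + 4K₃`. For `n > 0` the unbounded inflow `A_n
Λ^{n-1}` is absorbed by the loss `A_{n+1} Λ^n`, since `A_n ≤ 2a_n ≤ 2K₃ a_{n+1} ≤ 4K₃ A_{n+1}`;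
every other gain has a bounded rate. -/
theorem diff_le_of_barrier (hβ : 0 < β) {d w : ℝ → ℤ → ℝ} {t₁ T : ℝ} (ht₁ : 0 ≤ t₁)
    (hd : IsDiffSolution A B d) (hw : IsDiffBarrier A B t₁ T w) (hinit : ∀ n, d t₁ n ≤ w t₁ n) :
    ∀ t ∈ Icc t₁ T, ∀ n, d t n ≤ w t n := by
  obtain ⟨M, hM⟩ := hd.growth T
  obtain ⟨K₁, hK₁, hb⟩ := h.exists_b_le
  obtain ⟨K₂, hK₂, ha⟩ := h.exists_a_le_of_nonpos
  obtain ⟨K₃, hK₃, haa⟩ := h.exists_a_le_mul_a_succ hβ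
  set Λ := 4 + 4 * K₃ with hΛ
  have hsub : ∀ t ∈ Icc t₁ T, t ∈ Icc 0 T := fun t ht => ⟨ht₁.trans ht.1, ht.2⟩
  refine le_of_barrier (a := A) (b := fun t n => B t (n + 1))
    (c := fun t n => A t (n + 1) + B t n) (Λ := Λ) (C := 2 * K₂ * Λ + 2 * K₁ * Λ) (B := M)
    (fun t ht n => (hp.a_pos h hε (ht₁.trans_lt ht.1) n).le)
    (fun t ht n => (hp.b_pos h hε (ht₁.trans_lt ht.1) _).le)
    (fun n => (hd.cont n).mono fun t ht => (hsub t ht).1)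
    (fun t ht n => hd.deriv t (ht₁.trans_lt ht.1) n) (by linarith) ?_
    (fun t ht n => (le_abs_self _).trans (hM t (hsub t ht) n)) hw.cont hw.nonneg hinit hw.super
  intro t ht n
  have ht0 : 0 < t := ht₁.trans_lt ht.1
  have hΛ1 : 1 ≤ Λ := by linarith
  have hb' : B t (n + 1) ≤ 2 * K₁ := (hp.b_bounds h hε ht0 _).2.trans (by linarith [hb (n + 1)])
  have hAn := hp.a_pos h hε ht0 n
  have hAn1 := hp.a_pos h hε ht0 (n + 1)
  have hBn := hp.b_pos h hε ht0 n
  have hBn1 := hp.b_pos h hε ht0 (n + 1)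
  have hup : Λ ^ (n + 1).natAbs ≤ Λ * Λ ^ n.natAbs := by
    rw [← pow_succ']
    exact pow_le_pow_right₀ hΛ1 (by omega)
  have hV := pow_pos (by linarith : 0 < Λ) n.natAbs
  have hterm : B t (n + 1) * Λ ^ (n + 1).natAbs ≤ 2 * K₁ * (Λ * Λ ^ n.natAbs) :=
    mul_le_mul hb' hup (pow_nonneg (by linarith) _) (by linarith)
  have hBV := mul_pos hBn hV
  rcases le_or_gt n 0 with hn | hn
  · have ha' : A t n ≤ 2 * K₂ := (hp.a_bounds h hε ht0 n).2.trans (by linarith [ha n hn])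
    have hdown : Λ ^ (n - 1).natAbs = Λ * Λ ^ n.natAbs := by
      rw [(natAbs_pred_succ_of_nonpos hn).1, pow_succ']
    rw [hdown]
    have h1 : A t n * (Λ * Λ ^ n.natAbs) ≤ 2 * K₂ * (Λ * Λ ^ n.natAbs) :=
      mul_le_mul_of_nonneg_right ha' (by positivity)
    have h2 := mul_pos hAn1 hV
    nlinarith
  · have hdown : Λ ^ n.natAbs = Λ * Λ ^ (n - 1).natAbs := by
      rw [(natAbs_pred_succ_of_pos hn).1, pow_succ']
    have hV' := pow_pos (by linarith : 0 < Λ) (n - 1).natAbs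
    have h1 : A t n ≤ Λ * A t (n + 1) := by
      have h2 := (hp.a_bounds h hε ht0 n).2
      have h3 := (hp.a_bounds h hε ht0 (n + 1)).1
      have h4 := haa n
      have h5 := h.a_pos (n + 1)
      nlinarith
    have h2 : A t n * Λ ^ (n - 1).natAbs ≤ A t (n + 1) * Λ ^ n.natAbs := by
      rw [hdown]
      calc _ ≤ Λ * A t (n + 1) * Λ ^ (n - 1).natAbs := mul_le_mul_of_nonneg_right h1 hV'.le
        _ = _ := by ring
    have h3 : 0 ≤ 2 * K₂ * Λ * Λ ^ n.natAbs := by positivity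
    nlinarith

theorem abs_diff_le_of_barrier (hβ : 0 < β) {d w : ℝ → ℤ → ℝ} {t₁ T : ℝ} (ht₁ : 0 ≤ t₁)
    (hd : IsDiffSolution A B d) (hw : IsDiffBarrier A B t₁ T w) (hinit : ∀ n, |d t₁ n| ≤ w t₁ n) :
    ∀ t ∈ Icc t₁ T, ∀ n, |d t n| ≤ w t n := by
  intro t ht n
  refine abs_le'.mpr ⟨?_, ?_⟩
  · exact hp.diff_le_of_barrier h hε hβ ht₁ hd hw (fun n => (le_abs_self _).trans (hinit n)) t ht n
  · exact hp.diff_le_of_barrier h hε hβ ht₁ hd.neg hw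
      (fun n => (neg_le_abs _).trans (hinit n)) t ht n

end Basic

end IsPerturbedRates

/-! ### Exponential decay for `t ≥ 1` -/

/-- A weight decaying exponentially under the system for the differences, uniformly with respect
to small perturbations of the rates. -/
theorem IsReferenceRates.exists_decaying_weight {β g : ℝ} {a b : ℤ → ℝ}
    (h : IsReferenceRates β g a b) (hβ : 0 < β) {ε₁ : ℝ} (hε₁ : 0 < ε₁) (hε₁β : ε₁ ≤ β) :
    ∃ ε₀ ν C : ℝ, ∃ w : ℤ → ℝ, 0 < ε₀ ∧ ε₀ ≤ 1 / 2 ∧ 0 < ν ∧ 0 < C ∧ (∀ n, 0 < w n) ∧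
      (∀ n, w n ≤ C * wt β n) ∧ (∀ n, wt β n ≤ C * w n) ∧ ∀ c₀ δ ε A B,
      IsPerturbedRates β a b c₀ δ ε₁ ε A B → 0 ≤ ε → ε ≤ ε₀ → ∀ t, 1 ≤ t → ∀ n,
      A t n * w (n - 1) - (A t (n + 1) + B t n) * w n + B t (n + 1) * w (n + 1) ≤ -ν * w n := by
  obtain ⟨w, F, C, hC, hw, hwle, hlew, hwF, hF⟩ := h.exists_static_weight hβ hε₁
  obtain ⟨K₁, hK₁, hb⟩ := h.exists_b_le
  obtain ⟨K₂, hK₂, ha⟩ := h.exists_a_succ_le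
  set K := C * K₁ + C * K₂ with hK
  have hKpos : 0 < K := by positivity
  have hP : ∀ n, a (n + 1) * w n ≤ K * wt 0 n := by
    intro n
    have h1 := mul_le_mul_of_nonneg_left (hwle n) (h.a_pos (n + 1)).le
    have h2 := mul_le_mul_of_nonneg_left (ha n) hC.le
    have := wt_pos 0 n
    have : 0 ≤ C * K₁ * wt 0 n := by positivity
    rw [hK]; linarith
  have hww : ∀ n, w n ≤ C * wt ε₁ n := fun n =>
    (hwle n).trans (mul_le_mul_of_nonneg_left (wt_anti hε₁β n) hC.le)
  have hQ : ∀ n, b n * w n ≤ K * wt ε₁ n := by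
    intro n
    have h1 := mul_le_mul (hb n) (hww n) (hw n).le hK₁.le
    have := wt_pos ε₁ n
    have : 0 ≤ C * K₂ * wt ε₁ n := by positivity
    rw [hK]; linarith
  have hR : ∀ n, b (n + 1) * w (n + 1) ≤ 2 * K * wt ε₁ n := fun n => by
    have := mul_le_mul_of_nonneg_left (wt_succ_le (by linarith : -1 ≤ ε₁) n) hKpos.le
    linarith [hQ (n + 1)]
  -- The three error terms below add up to `8εK wt ε₁ ≤ 8εKC·D`; this choice makes that at most
  -- `D/4`, half of the available `D/2`.
  set ε₀ := min (1 / 2) (1 / (32 * K * C)) with hε₀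
  have hε₀pos : 0 < ε₀ := lt_min (by norm_num) (by positivity)
  refine ⟨ε₀, 1 / (4 * (C * C)), C, w, hε₀pos, min_le_left _ _, by positivity, hC, hw, hwle, hlew, ?_⟩
  intro c₀ δ ε A B hp hε0 hε t ht n
  have hε2 : ε ≤ 1 / 2 := hε.trans (min_le_left _ _)
  have ht0 : 0 < t := by linarith
  obtain ⟨r, hr⟩ : ∃ r : ℤ → ℝ, ∀ n, r n = A t n / a n := ⟨_, fun _ => rfl⟩
  obtain ⟨q, hq⟩ : ∃ q : ℤ → ℝ, ∀ n, q n = B t n / b n := ⟨_, fun _ => rfl⟩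
  have hA : ∀ n, A t n = r n * a n := fun n => by
    rw [hr, div_mul_cancel₀ _ (h.a_pos n).ne']
  have hB : ∀ n, B t n = q n * b n := fun n => by
    rw [hq, div_mul_cancel₀ _ (h.b_pos n).ne']
  have hr1 : ∀ n, |r n - 1| ≤ ε := fun n => by
    have := hp.near_a t ht0 n
    rw [hA, show r n * a n - a n = (r n - 1) * a n by ring, abs_mul,
      abs_of_pos (h.a_pos n)] at this
    exact le_of_mul_le_mul_right this (h.a_pos n)
  have hq1 : ∀ n, |q n - 1| ≤ ε := fun n => by
    have := hp.near_b t ht0 n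
    rw [hB, show q n * b n - b n = (q n - 1) * b n by ring, abs_mul,
      abs_of_pos (h.b_pos n)] at this
    exact le_of_mul_le_mul_right this (h.b_pos n)
  obtain ⟨P, hPdef⟩ : ∃ P, P = a (n + 1) * w n := ⟨_, rfl⟩
  obtain ⟨Q, hQdef⟩ : ∃ Q, Q = b n * w n := ⟨_, rfl⟩
  obtain ⟨R, hRdef⟩ : ∃ R, R = b (n + 1) * w (n + 1) := ⟨_, rfl⟩
  have hPpos : 0 < P := hPdef ▸ mul_pos (h.a_pos _) (hw _)
  have hQpos : 0 < Q := hQdef ▸ mul_pos (h.b_pos _) (hw _)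
  have hRpos : 0 < R := hRdef ▸ mul_pos (h.b_pos _) (hw _)
  have hbase1 := hwF n
  have hbase2 := hwF (n + 1)
  rw [add_sub_cancel_right] at hbase2
  obtain ⟨D, hD⟩ : ∃ D, D = F (n + 1) - F n := ⟨_, rfl⟩
  have hDw : wt ε₁ n ≤ C * D := hD ▸ hF n
  -- `P` is controlled only by `wt 0`. For `n ≥ 0` the missing decay comes from the slow variation
  -- of `r`, which is the condition `late`; for `n < 0` the two weights agree and smallness of `r -
  -- 1` is enough.
  have hPr : (r n - r (n + 1)) * P ≤ 2 * ε * K * wt ε₁ n := by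
    rcases lt_or_ge n 0 with hn | hn
    · have h1 : r n - r (n + 1) ≤ 2 * ε := by
        have := (abs_le.mp (hr1 n)).2
        have := (abs_le.mp (hr1 (n + 1))).1
        linarith
      have h2 : wt 0 n = wt ε₁ n := by rw [wt_of_nonpos hn.le, wt_of_nonpos hn.le]
      have h3 := hPdef ▸ hP n
      rw [h2] at h3
      have h4 := mul_le_mul h1 h3 hPpos.le (by linarith)
      linarith
    · have h1 : r n - r (n + 1) ≤ ε * wt ε₁ n := by
        have := hp.late t ht n hn
        rw [← hr, ← hr] at this
        rw [abs_sub_comm] at this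
        exact (le_abs_self _).trans this
      have h2 : wt 0 n = 1 := by rw [wt_of_nonneg hn]; simp
      have h3 := hPdef ▸ hP n
      rw [h2, mul_one] at h3
      have h5 : 0 ≤ ε * wt ε₁ n := mul_nonneg hε0 (wt_pos _ _).le
      have h4 := mul_le_mul h1 h3 hPpos.le h5
      have h6 := mul_nonneg h5 hKpos.le
      linarith
  have hQr : (r n - q n) * Q ≤ 2 * ε * (K * wt ε₁ n) := by
    refine mul_le_mul ?_ (hQdef ▸ hQ n) hQpos.le (by linarith)
    have := (abs_le.mp (hr1 n)).2
    have := (abs_le.mp (hq1 n)).1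
    linarith
  have hRr : (q (n + 1) - r n) * R ≤ 2 * ε * (2 * K * wt ε₁ n) := by
    refine mul_le_mul ?_ (hRdef ▸ hR n) hRpos.le (by linarith)
    have := (abs_le.mp (hr1 n)).1
    have := (abs_le.mp (hq1 (n + 1))).2
    linarith
  -- Freezing the ratio `r_n` produces the unperturbed defect `-r_n D`; the remaining terms contain
  -- only differences of the ratios.
  have hident : A t n * w (n - 1) - (A t (n + 1) + B t n) * w n + B t (n + 1) * w (n + 1) =
      -(r n * D) + (r n - r (n + 1)) * P + (r n - q n) * Q + (q (n + 1) - r n) * R := by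
    rw [hA n, hA (n + 1), hB n, hB (n + 1), hD, ← hbase1, ← hbase2]
    rw [hPdef, hQdef, hRdef]
    ring
  rw [hident]
  have hDpos : 0 < D := by
    have := wt_pos ε₁ n
    by_contra hcon
    push Not at hcon
    nlinarith
  have hrD : D / 2 ≤ r n * D := by
    have := (abs_le.mp (hr1 n)).1
    nlinarith
  have hεK : ε * (32 * K * C) ≤ 1 := by
    have : ε ≤ 1 / (32 * K * C) := hε.trans (min_le_right _ _)
    rwa [le_div_iff₀ (by positivity)] at this
  have hsmall : 8 * ε * K * wt ε₁ n ≤ D / 4 := by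
    have h1 : 8 * ε * K * wt ε₁ n ≤ 8 * ε * K * (C * D) :=
      mul_le_mul_of_nonneg_left hDw (by positivity)
    nlinarith
  have hνw : 1 / (4 * (C * C)) * w n ≤ D / 4 := by
    have h1 : w n ≤ C * (C * D) := (hww n).trans (mul_le_mul_of_nonneg_left hDw hC.le)
    rw [div_mul_eq_mul_div, one_mul, div_le_iff₀ (by positivity)]
    linarith
  linarith

/-- Exponential decay of differences for `t ≥ 1`. -/
theorem IsReferenceRates.exists_exponential_decay {β g : ℝ} {a b : ℤ → ℝ}
    (h : IsReferenceRates β g a b) (hβ : 0 < β) {ε₁ : ℝ} (hε₁ : 0 < ε₁) (hε₁β : ε₁ ≤ β) :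
    ∃ ε₀ ν C : ℝ, 0 < ε₀ ∧ ε₀ ≤ 1 / 2 ∧ 0 < ν ∧ 0 < C ∧ ∀ c₀ δ ε A B,
      IsPerturbedRates β a b c₀ δ ε₁ ε A B → 0 ≤ ε → ε ≤ ε₀ → ∀ d, IsDiffSolution A B d →
      ∀ M, 0 ≤ M → (∀ n, |d 1 n| ≤ M * wt β n) →
      ∀ t, 1 ≤ t → ∀ n, |d t n| ≤ C * M * Real.exp (-ν * (t - 1)) * wt β n := by
  obtain ⟨ε₀, ν, C, w, hε₀, hε₀2, hν, hC, hw, hwle, hlew, hsuper⟩ :=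
    h.exists_decaying_weight hβ hε₁ hε₁β
  refine ⟨ε₀, ν, C * C, hε₀, hε₀2, hν, by positivity, ?_⟩
  intro c₀ δ ε A B hp hε0 hε d hd M hM hinit t ht n
  have hsup := hsuper c₀ δ ε A B hp hε0 hε
  have hbarrier : IsDiffBarrier A B 1 t
      (fun s n => C * M * (Real.exp (-ν * (s - 1)) * w n)) := by
    refine IsDiffBarrier.const_mul ⟨fun n => Continuous.continuousOn (by fun_prop),
      fun s _ n => mul_nonneg (Real.exp_pos _).le (hw n).le, fun s hs n => ?_⟩ (by positivity)
    have h1 : HasDerivAt (fun s => -ν * (s - 1)) (-ν * 1) s :=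
      ((hasDerivAt_id s).sub_const 1).const_mul _
    refine ⟨_, _, h1.exp.mul_const (w n), rfl, fun _ _ => le_rfl, ?_⟩
    have := mul_le_mul_of_nonneg_left (hsup s hs.1.le n) (Real.exp_pos (-ν * (s - 1))).le
    linarith
  have hres := hp.abs_diff_le_of_barrier h (hε.trans hε₀2) hβ zero_le_one hd hbarrier (fun n => ?_) t
    ⟨ht, le_rfl⟩ n
  · refine hres.trans ?_
    have h1 := mul_le_mul_of_nonneg_left (hwle n)
      (by positivity : 0 ≤ C * M * Real.exp (-ν * (t - 1)))
    linarith
  · simp only [sub_self, mul_zero, Real.exp_zero, one_mul]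
    have := mul_le_mul_of_nonneg_left (hlew n) hM
    linarith [hinit n]

/-! ### Smoothing for `t ≤ 1`: profiles in the rescaled time -/

/-- The rescaled time `1 + 2^{β n} t`. -/
noncomputable def scaledTime (β t : ℝ) (n : ℤ) : ℝ := 1 + 2 ^ (β * (n : ℝ)) * t

section ScaledTime

variable {β t : ℝ}

theorem one_le_scaledTime (ht : 0 ≤ t) (n : ℤ) : 1 ≤ scaledTime β t n := by
  unfold scaledTime
  have : (0 : ℝ) < 2 ^ (β * (n : ℝ)) := by positivity
  nlinarith [mul_nonneg this.le ht]

theorem scaledTime_le_of_le_one (ht1 : t ≤ 1) (n : ℤ) :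
    scaledTime β t n ≤ 1 + 2 ^ (β * (n : ℝ)) := by
  unfold scaledTime
  have : (0 : ℝ) < 2 ^ (β * (n : ℝ)) := by positivity
  nlinarith

theorem hasDerivAt_scaledTime (n : ℤ) :
    HasDerivAt (fun s => scaledTime β s n) (2 ^ (β * (n : ℝ))) t := by
  unfold scaledTime
  simpa using ((hasDerivAt_id t).const_mul ((2 : ℝ) ^ (β * (n : ℝ)))).const_add 1

theorem two_rpow_mul_sub_one (n : ℤ) :
    (2 : ℝ) ^ (β * ((n - 1 : ℤ) : ℝ)) = 2 ^ (-β) * 2 ^ (β * (n : ℝ)) := by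
  rw [← Real.rpow_add two_pos]
  push_cast
  ring_nf

theorem two_rpow_mul_add_one (n : ℤ) :
    (2 : ℝ) ^ (β * ((n + 1 : ℤ) : ℝ)) = 2 ^ β * 2 ^ (β * (n : ℝ)) := by
  rw [← Real.rpow_add two_pos]
  push_cast
  ring_nf

theorem scaledTime_sub_one_le (hβ : 1 ≤ β) (ht : 0 ≤ t) (n : ℤ) :
    scaledTime β t (n - 1) ≤ 1 + (scaledTime β t n - 1) / 2 := by
  unfold scaledTime
  rw [two_rpow_mul_sub_one]
  have h1 : (2 : ℝ) ^ (-β) ≤ 1 / 2 := by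
    have := Real.rpow_le_rpow_of_exponent_le one_le_two (neg_le_neg hβ)
    rw [Real.rpow_neg_one] at this
    linarith
  have h2 : (0 : ℝ) ≤ 2 ^ (β * (n : ℝ)) * t := by positivity
  nlinarith

theorem le_scaledTime_sub_one (hβ : 1 ≤ β) (n : ℤ) :
    2 ^ (-β) * scaledTime β t n ≤ scaledTime β t (n - 1) := by
  unfold scaledTime
  rw [two_rpow_mul_sub_one]
  have h1 : (2 : ℝ) ^ (-β) ≤ 1 := Real.rpow_le_one_of_one_le_of_nonpos one_le_two (by linarith)
  linarith

theorem scaledTime_add_one_le (hβ : β ≤ 2) (ht : 0 ≤ t) (n : ℤ) :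
    scaledTime β t (n + 1) ≤ 4 * scaledTime β t n := by
  unfold scaledTime
  rw [two_rpow_mul_add_one]
  have h1 : (2 : ℝ) ^ β ≤ 4 := by
    have := Real.rpow_le_rpow_of_exponent_le one_le_two hβ
    norm_num at this
    exact this
  have h2 : (0 : ℝ) ≤ 2 ^ (β * (n : ℝ)) * t := by positivity
  nlinarith

theorem le_scaledTime_add_one (hβ : 1 ≤ β) (ht : 0 ≤ t) (n : ℤ) :
    scaledTime β t n ≤ scaledTime β t (n + 1) := by
  unfold scaledTime
  rw [two_rpow_mul_add_one]
  have h1 : (1 : ℝ) ≤ 2 ^ β := Real.one_le_rpow one_le_two (by linarith)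
  have h2 : (0 : ℝ) ≤ 2 ^ (β * (n : ℝ)) * t := by positivity
  nlinarith

end ScaledTime

theorem wt_sub_one {θ : ℝ} {n : ℤ} (hn : 1 ≤ n) : wt θ (n - 1) = 2 ^ θ * wt θ n := by
  rw [wt_of_nonneg (by omega), wt_of_nonneg (by omega), ← Real.rpow_add two_pos]
  push_cast
  ring_nf

theorem wt_sub_one_le {θ : ℝ} (hθ : θ ≤ 2) (n : ℤ) : wt θ (n - 1) ≤ 4 * wt θ n := by
  have hw := wt_pos θ n
  rcases le_or_gt n 0 with hn | hn
  · rw [wt_of_nonpos (by omega), wt_of_nonpos hn]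
    push_cast
    rw [show -((n : ℝ) - 1) = 1 + -(n : ℝ) by ring, Real.rpow_add two_pos, Real.rpow_one]
    have : (0 : ℝ) < 2 ^ (-(n : ℝ)) := by positivity
    linarith
  · rw [wt_sub_one (by omega)]
    have := Real.rpow_le_rpow_of_exponent_le one_le_two hθ
    norm_num at this
    exact mul_le_mul_of_nonneg_right this hw.le

/-- For `k` large the power `x ^ (k + 1)` grows fast enough to absorb a transport term. -/
theorem exists_pow_supersolution {C : ℝ} (hC : 0 < C) :
    ∃ k : ℕ, ∀ x y : ℝ, 1 ≤ x → 0 ≤ y → y ≤ 1 + (x - 1) / 2 →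
      8 * C * y ^ (k + 1) ≤ (k + 1) * x ^ k + x ^ (k + 1) / (4 * C) := by
  -- `k₁` serves `x ≤ 2`, where the derivative term `(k+1)x^k` must win; `k₂` serves `x > 2`, where
  -- `y ≤ 3x/4` and the power `(3/4)^{k₂}` is small.
  obtain ⟨k₁, hk₁⟩ := exists_nat_gt (16 * C)
  obtain ⟨k₂, hk₂⟩ := exists_pow_lt_of_lt_one (by positivity : 0 < 1 / (32 * C * C))
    (by norm_num : (3 / 4 : ℝ) < 1)
  refine ⟨k₁ + k₂, fun x y hx hy hyx => ?_⟩
  set k := k₁ + k₂ with hk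
  have hxk : 0 < x ^ k := by positivity
  have hxk1 : 0 < x ^ (k + 1) := by positivity
  rcases le_or_gt x 2 with hx2 | hx2
  · have h1 : y ^ (k + 1) ≤ x ^ (k + 1) := pow_le_pow_left₀ hy (by linarith) _
    have h2 : x ^ (k + 1) ≤ 2 * x ^ k := by
      rw [pow_succ]; nlinarith
    have h3 : 16 * C ≤ (k : ℝ) + 1 := by
      rw [hk]; push_cast
      have : (0 : ℝ) ≤ k₂ := Nat.cast_nonneg _
      linarith
    have h4 : 0 < x ^ (k + 1) / (4 * C) := by positivity
    nlinarith
  · have h1 : y ≤ 3 / 4 * x := by linarith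
    have h2 : y ^ (k + 1) ≤ (3 / 4) ^ (k + 1) * x ^ (k + 1) := by
      rw [← mul_pow]; exact pow_le_pow_left₀ hy h1 _
    have h3 : (3 / 4 : ℝ) ^ (k + 1) ≤ 1 / (32 * C * C) :=
      (pow_le_pow_of_le_one (by norm_num) (by norm_num) (by omega)).trans hk₂.le
    have h4 : 8 * C * y ^ (k + 1) ≤ x ^ (k + 1) / (4 * C) := by
      calc 8 * C * y ^ (k + 1) ≤ 8 * C * (1 / (32 * C * C) * x ^ (k + 1)) := by
            gcongr
            exact h2.trans (by gcongr)
        _ = _ := by field_simp; norm_num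
    have h5 : 0 ≤ ((k : ℝ) + 1) * x ^ k := by positivity
    linarith

/-- The profile `x^{-κ} (1 - x^{-η} / 2)`. -/
noncomputable def decayProfile (κ η x : ℝ) : ℝ := x ^ (-κ) * (1 - x ^ (-η) / 2)

section DecayProfile

variable {κ η x : ℝ}

theorem rpow_neg_mem (hη : 0 ≤ η) (hx : 1 ≤ x) : 0 < x ^ (-η) ∧ x ^ (-η) ≤ 1 :=
  ⟨by positivity, Real.rpow_le_one_of_one_le_of_nonpos hx (by linarith)⟩

theorem decayProfile_le (hx : 1 ≤ x) : decayProfile κ η x ≤ x ^ (-κ) := by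
  unfold decayProfile
  have h1 : 0 < x ^ (-κ) := by positivity
  have h2 : 0 < x ^ (-η) := by positivity
  nlinarith

theorem le_decayProfile (hη : 0 ≤ η) (hx : 1 ≤ x) : x ^ (-κ) / 2 ≤ decayProfile κ η x := by
  unfold decayProfile
  have h1 : 0 < x ^ (-κ) := by positivity
  have h2 := (rpow_neg_mem hη hx).2
  nlinarith

/-- The factor `1 - x^{-η}/2` is nondecreasing and at most one, so the downward slope is no worse
than that of `x^{-κ}`. -/
theorem exists_hasDerivAt_decayProfile (hκ : 0 ≤ κ) (hη : 0 ≤ η) (hx : 1 ≤ x) :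
    ∃ D, HasDerivAt (decayProfile κ η) D x ∧ -(κ * (x ^ (-κ) * x⁻¹)) ≤ D := by
  have hx0 : x ≠ 0 := by positivity
  have h1 : HasDerivAt (fun x : ℝ => x ^ (-κ)) (-κ * x ^ (-κ - 1)) x :=
    Real.hasDerivAt_rpow_const (Or.inl hx0)
  have h2 : HasDerivAt (fun x : ℝ => x ^ (-η)) (-η * x ^ (-η - 1)) x :=
    Real.hasDerivAt_rpow_const (Or.inl hx0)
  refine ⟨_, h1.mul ((h2.div_const 2).const_sub 1), ?_⟩
  rw [Real.rpow_sub_one hx0, Real.rpow_sub_one hx0]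
  have hp := rpow_neg_mem hη hx
  have hq : 0 < x ^ (-κ) := by positivity
  have hi : 0 < x⁻¹ := by positivity
  have h3 : 0 ≤ κ * (x ^ (-κ) * x⁻¹) * (x ^ (-η) / 2) :=
    mul_nonneg (mul_nonneg hκ (mul_pos hq hi).le) (by linarith [hp.1])
  have h4 : 0 ≤ x ^ (-κ) * (η * x ^ (-η) * x⁻¹ / 2) :=
    mul_nonneg hq.le (div_nonneg (mul_nonneg (mul_nonneg hη hp.1.le) hi.le) (by norm_num))
  rw [div_eq_mul_inv, div_eq_mul_inv (x ^ (-η)) x]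
  linarith

/-- The differential inequality behind the decay profile: the transport term with rates `A`, `A'`
of ratio close to `2^β` is dominated for `x` large. -/
theorem decayProfile_transport {β c₀ γ A A' B s y z : ℝ} (hκ : 0 < κ)
    (hη : 0 < η) (hη2 : η ≤ 1 / 2) (hc₀ : 0 ≤ c₀) (hβ : 1 ≤ β)
    (hx : 2 ≤ x) (hyx : y ≤ 1 + (x - 1) / 2) (hxy : 2 ^ (-β) * x ≤ y) (hxz : x ≤ z)
    (hγ : 0 < γ) (hs : 0 < s) (hxs : x ≤ 2 * s) (hA : γ * s ≤ A) (hB : 0 ≤ B)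
    (hAA' : (1 - c₀ * x ^ (-(2 * η))) * (2 ^ β * A) ≤ A')
    (hx₁ : c₀ * x ^ (-η) ≤ ((4 / 3) ^ η - 1) / 4)
    (hx₂ : κ * x ^ (-η) ≤ γ * ((4 / 3) ^ η - 1) / 8)
    (hBs : B ≤ γ * ((4 / 3) ^ η - 1) / 32) :
    2 ^ (β * (1 - κ)) * A * decayProfile κ η y - A' * decayProfile κ η x
      + 2 * B * decayProfile κ η z ≤ -(κ * (x ^ (-κ) * x⁻¹)) * s := by
  have hx0 : 0 < x := by linarith
  have hx1 : 1 ≤ x := by linarith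
  have hy0 : 0 < y := lt_of_lt_of_le (by positivity) hxy
  set G := (4 / 3 : ℝ) ^ η - 1 with hG
  have hG0 : 0 < G := by
    have : (1 : ℝ) < (4 / 3) ^ η := Real.one_lt_rpow (by norm_num) hη
    linarith
  set Z := x ^ (-η) with hZ
  obtain ⟨hZ0, hZ1⟩ := rpow_neg_mem hη.le hx1
  set Y := x ^ (-κ) with hY
  have hY0 : 0 < Y := by positivity
  have hA0 : 0 < A := lt_of_lt_of_le (by positivity) hA
  -- comparison of the powers of `y` and `z` with those of `x`
  have hyκ : y ^ (-κ) ≤ 2 ^ (β * κ) * Y := by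
    calc y ^ (-κ) ≤ (2 ^ (-β) * x) ^ (-κ) :=
          Real.rpow_le_rpow_of_nonpos (by positivity) hxy (by linarith)
      _ = _ := by
          rw [Real.mul_rpow (by positivity) hx0.le, ← Real.rpow_mul two_pos.le]
          congr 2
          ring
  have hyη : (1 + G) * Z ≤ y ^ (-η) := by
    calc (1 + G) * Z = (3 / 4 * x) ^ (-η) := by
          rw [Real.mul_rpow (by norm_num) hx0.le, hG, hZ]
          congr 1
          rw [Real.rpow_neg (by norm_num), ← Real.inv_rpow (by norm_num)]
          norm_num
      _ ≤ _ := Real.rpow_le_rpow_of_nonpos hy0 (by linarith) (by linarith)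
  have hzκ : decayProfile κ η z ≤ Y :=
    (decayProfile_le (by linarith)).trans
      (Real.rpow_le_rpow_of_nonpos hx0 hxz (by linarith))
  have hZ2 : x ^ (-(2 * η)) = Z * Z := by
    rw [hZ, ← Real.rpow_add hx0]; congr 1; ring
  rw [hZ2] at hAA'
  have hxinv : x⁻¹ ≤ Z * Z := by
    rw [← hZ2, ← Real.rpow_neg_one]
    exact Real.rpow_le_rpow_of_exponent_le hx1 (by linarith)
  have hxinvZ : x⁻¹ ≤ Z := hxinv.trans (mul_le_of_le_one_left hZ0.le hZ1)
  have hxinv0 : 0 < x⁻¹ := by positivity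
  have h2β : (1 : ℝ) ≤ 2 ^ β := Real.one_le_rpow one_le_two (by linarith)
  -- The powers combine as `2^{β(1-κ)} · 2^{βκ} = 2^β`, so inflow and outflow have the same leading
  -- term `2^β A Y`. What is left is the correction, larger at `y` than at `x` by the factor `1 + G
  -- = (4/3)^η`, because `y ≤ 3x/4`.
  have hT1 : 2 ^ (β * (1 - κ)) * A * decayProfile κ η y ≤
      2 ^ β * A * Y * (1 - (1 + G) * Z / 2) := by
    have hb : 2 ^ (β * (1 - κ)) * (2 : ℝ) ^ (β * κ) = 2 ^ β := by
      rw [← Real.rpow_add two_pos]; ring_nf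
    have hneg : 0 ≤ 1 - (1 + G) * Z / 2 := by
      have h43 : (4 / 3 : ℝ) ^ η ≤ (4 / 3) ^ (1 : ℝ) :=
        Real.rpow_le_rpow_of_exponent_le (by norm_num) (by linarith)
      rw [Real.rpow_one] at h43
      have h1G : 1 + G ≤ 4 / 3 := by rw [hG]; linarith
      have := mul_le_mul h1G hZ1 hZ0.le (by norm_num)
      linarith
    have h1 : decayProfile κ η y ≤ 2 ^ (β * κ) * Y * (1 - (1 + G) * Z / 2) := by
      unfold decayProfile
      calc y ^ (-κ) * (1 - y ^ (-η) / 2) ≤ y ^ (-κ) * (1 - (1 + G) * Z / 2) := by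
            gcongr
        _ ≤ _ := mul_le_mul_of_nonneg_right hyκ hneg
    calc _ ≤ 2 ^ (β * (1 - κ)) * A * (2 ^ (β * κ) * Y * (1 - (1 + G) * Z / 2)) := by gcongr
      _ = (2 ^ (β * (1 - κ)) * 2 ^ (β * κ)) * A * Y * (1 - (1 + G) * Z / 2) := by ring
      _ = _ := by rw [hb]
  have hT2 : 2 ^ β * A * Y * (1 - Z / 2 - c₀ * (Z * Z)) ≤ A' * decayProfile κ η x := by
    have h0 : 0 ≤ decayProfile κ η x := le_trans (by positivity) (le_decayProfile hη.le hx1)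
    have h1 := mul_le_mul_of_nonneg_right hAA' h0
    refine le_trans ?_ h1
    have h2 : decayProfile κ η x = Y * (1 - Z / 2) := rfl
    rw [h2]
    have h3 : 0 ≤ 2 ^ β * A * Y * (c₀ * (Z * Z) * (Z / 2)) := by positivity
    linarith
  have hT3 : 2 * B * decayProfile κ η z ≤ 2 * B * Y := by gcongr
  have hcZ : c₀ * (Z * Z) ≤ G / 4 * Z := by
    have := mul_le_mul_of_nonneg_right hx₁ hZ0.le
    linarith
  -- The correction yields a gain of order `GZ`, while the error in the ratio of the rates is `c₀Z²`
  -- and hence of lower order; this is why the correction exponent `η` is half the error exponent.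
  have hmain : 2 ^ β * A * Y * (1 - (1 + G) * Z / 2) -
      2 ^ β * A * Y * (1 - Z / 2 - c₀ * (Z * Z)) ≤ -(A * Y * (G / 4 * Z)) := by
    have h1 : 2 ^ β * A * Y * (1 - (1 + G) * Z / 2) -
      2 ^ β * A * Y * (1 - Z / 2 - c₀ * (Z * Z)) =
        2 ^ β * (A * Y) * (c₀ * (Z * Z) - G * Z / 2) := by ring
    have h2 : 2 ^ β * (A * Y) * (c₀ * (Z * Z) - G * Z / 2) ≤
        2 ^ β * (A * Y) * (-(G / 4 * Z)) := by
      gcongr; linarith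
    have h3 : 1 * (A * Y * (G / 4 * Z)) ≤ 2 ^ β * (A * Y * (G / 4 * Z)) := by gcongr
    rw [h1]
    linarith
  have hAs : γ * s * (Y * (G / 4 * Z)) ≤ A * (Y * (G / 4 * Z)) := by gcongr
  -- The remaining gain `γG/4 · ZYs` is split equally: one half pays for the time derivative, the
  -- other, in `hb`, for the up rate.
  have hk : κ * (Y * x⁻¹) * s ≤ γ * G / 8 * Z * Y * s := by
    have h1 : κ * x⁻¹ ≤ γ * G / 8 * Z := by
      calc κ * x⁻¹ ≤ κ * (Z * Z) := by gcongr
        _ = κ * Z * Z := by ring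
        _ ≤ _ := by gcongr
    calc κ * (Y * x⁻¹) * s = κ * x⁻¹ * (Y * s) := by ring
      _ ≤ γ * G / 8 * Z * (Y * s) := by gcongr
      _ = _ := by ring
  have hb : 2 * B * Y ≤ γ * G / 8 * Z * Y * s := by
    have h1 : 1 ≤ 2 * (Z * s) := by
      have h2 : 1 ≤ 2 * s * x⁻¹ := by
        rw [← div_eq_mul_inv, le_div_iff₀ hx0]; linarith
      have h3 := mul_le_mul_of_nonneg_left hxinvZ (by linarith : 0 ≤ 2 * s)
      linarith
    calc 2 * B * Y ≤ 2 * (γ * G / 32) * Y := by gcongr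
      _ = γ * G / 16 * Y * 1 := by ring
      _ ≤ γ * G / 16 * Y * (2 * (Z * s)) := by gcongr
      _ = _ := by ring
  linarith

end DecayProfile

/-- Barrier for short times: the minimum of a growing and a decaying profile in the rescaled time
to the right of `N`, and a small multiple of the initial weight to the left. -/
noncomputable def shortBarrier (β θ κ η D l : ℝ) (k : ℕ) (N : ℤ) (t : ℝ) (n : ℤ) : ℝ :=
  if n ≤ N then l * wt θ n
  else wt θ n * min (scaledTime β t n ^ (k + 1)) (D * decayProfile κ η (scaledTime β t n))

section ShortBarrier

variable {β θ κ η D l t : ℝ} {k : ℕ} {N : ℤ}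

theorem shortBarrier_of_le {n : ℤ} (hn : n ≤ N) :
    shortBarrier β θ κ η D l k N t n = l * wt θ n := if_pos hn

theorem shortBarrier_of_gt {n : ℤ} (hn : N < n) :
    shortBarrier β θ κ η D l k N t n = wt θ n *
      min (scaledTime β t n ^ (k + 1)) (D * decayProfile κ η (scaledTime β t n)) :=
  if_neg hn.not_ge

theorem decayProfile_nonneg {x : ℝ} (hη : 0 ≤ η) (hx : 1 ≤ x) : 0 ≤ decayProfile κ η x :=
  le_trans (by positivity) (le_decayProfile hη hx)

theorem shortBarrier_nonneg (hη : 0 ≤ η) (hD : 0 ≤ D) (hl : 0 ≤ l) (ht : 0 ≤ t) (n : ℤ) :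
    0 ≤ shortBarrier β θ κ η D l k N t n := by
  unfold shortBarrier
  have hX := one_le_scaledTime (β := β) ht n
  split_ifs
  · exact mul_nonneg hl (wt_pos _ _).le
  · exact mul_nonneg (wt_pos _ _).le (le_min (by positivity)
      (mul_nonneg hD (decayProfile_nonneg hη hX)))

theorem shortBarrier_le_mul (hκ : 0 ≤ κ) (hD : 1 ≤ D) (hl : l ≤ 1) (ht : 0 ≤ t)
    (n : ℤ) : shortBarrier β θ κ η D l k N t n ≤ D * wt θ n := by
  have hw := wt_pos θ n
  have hX := one_le_scaledTime (β := β) ht n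
  unfold shortBarrier
  split_ifs
  · exact mul_le_mul_of_nonneg_right (hl.trans hD) hw.le
  · rw [mul_comm]
    refine mul_le_mul_of_nonneg_right ((min_le_right _ _).trans ?_) hw.le
    exact mul_le_of_le_one_right (by linarith)
      ((decayProfile_le hX).trans (rpow_neg_mem hκ hX).2)

theorem continuousOn_shortBarrier (n : ℤ) :
    ContinuousOn (fun t => shortBarrier β θ κ η D l k N t n) (Ici 0) := by
  unfold shortBarrier
  split_ifs
  · exact continuousOn_const
  · have hc : Continuous fun t => scaledTime β t n := by unfold scaledTime; fun_prop
    have hr : ∀ q : ℝ, ContinuousOn (fun t => scaledTime β t n ^ q) (Ici 0) := fun q =>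
      hc.continuousOn.rpow_const fun t (ht : 0 ≤ t) =>
        Or.inl (by have := one_le_scaledTime (β := β) ht n; positivity)
    unfold decayProfile
    exact continuousOn_const.mul (ContinuousOn.inf (hc.pow _).continuousOn
      (continuousOn_const.mul ((hr _).mul (continuousOn_const.sub ((hr _).div_const 2)))))

/-- To the right of `N` (and at `N` itself) the barrier lies below both profiles. -/
theorem shortBarrier_le (hκ : 0 ≤ κ) (hη : 0 ≤ η) (hD : 1 ≤ D) (hl1 : l ≤ 1)
    (hl : l ≤ (1 + 2 ^ (β * (N : ℝ))) ^ (-κ) / 2) (ht : t ∈ Icc (0 : ℝ) 1) {n : ℤ} (hn : N ≤ n) :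
    shortBarrier β θ κ η D l k N t n ≤ wt θ n * scaledTime β t n ^ (k + 1) ∧
      shortBarrier β θ κ η D l k N t n ≤ wt θ n * (D * decayProfile κ η (scaledTime β t n)) := by
  have hw := (wt_pos θ n).le
  have hX := one_le_scaledTime (β := β) ht.1 n
  rcases eq_or_lt_of_le hn with h | h
  · subst h
    rw [shortBarrier_of_le le_rfl, mul_comm l]
    refine ⟨mul_le_mul_of_nonneg_left (hl1.trans (one_le_pow₀ hX)) hw,
      mul_le_mul_of_nonneg_left ?_ hw⟩
    have h1 : (1 + 2 ^ (β * (N : ℝ))) ^ (-κ) ≤ scaledTime β t N ^ (-κ) :=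
      Real.rpow_le_rpow_of_nonpos (by positivity) (scaledTime_le_of_le_one ht.2 N) (by linarith)
    have h2 := le_decayProfile (κ := κ) hη hX
    have h3 := decayProfile_nonneg (κ := κ) hη hX
    nlinarith
  · rw [shortBarrier_of_gt h]
    exact ⟨mul_le_mul_of_nonneg_left (min_le_left _ _) hw,
      mul_le_mul_of_nonneg_left (min_le_right _ _) hw⟩

end ShortBarrier

section RightInequalities

variable {β θ κ η C A A' B t : ℝ} {k : ℕ} {n : ℤ}

/-- The constant `8C` is `2C` from the down rate times at most `4` from the weight at `n - 1`. The
outflow provides `x^{k+1}/(2C)`: half of it enters `hk`, half absorbs the up rate. -/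
theorem growing_profile_super (hβ : 1 ≤ β) (hβ2 : β ≤ 2) (hθ : -1 ≤ θ) (hθ2 : θ ≤ 2) (hC : 0 < C)
    (hk : ∀ x y : ℝ, 1 ≤ x → 0 ≤ y → y ≤ 1 + (x - 1) / 2 →
      8 * C * y ^ (k + 1) ≤ (k + 1) * x ^ k + x ^ (k + 1) / (4 * C))
    (ht : 0 ≤ t) (hn : 1 ≤ n) (hA : A ≤ 2 * C * 2 ^ (β * (n : ℝ)))
    (hA' : 2 ^ (β * (n : ℝ)) / (2 * C) ≤ A') (hB : 0 ≤ B) (hBC : 2 * B * 4 ^ (k + 1) ≤ 1 / (4 * C)) :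
    A * (wt θ (n - 1) * scaledTime β t (n - 1) ^ (k + 1)) -
      A' * (wt θ n * scaledTime β t n ^ (k + 1)) +
      B * (wt θ (n + 1) * scaledTime β t (n + 1) ^ (k + 1)) ≤
      wt θ n * (((k : ℝ) + 1) * scaledTime β t n ^ k * 2 ^ (β * (n : ℝ))) := by
  have hn0 : (0 : ℝ) ≤ n := by exact_mod_cast (by omega : 0 ≤ n)
  have hs1 : (1 : ℝ) ≤ 2 ^ (β * (n : ℝ)) := Real.one_le_rpow one_le_two (by positivity)
  have hX := one_le_scaledTime (β := β) ht n
  have hY := one_le_scaledTime (β := β) ht (n - 1)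
  have hYX := scaledTime_sub_one_le hβ ht n
  have hZX := scaledTime_add_one_le hβ2 ht n
  have hZ := one_le_scaledTime (β := β) ht (n + 1)
  generalize (2 : ℝ) ^ (β * (n : ℝ)) = s at *
  generalize scaledTime β t n = X at *
  generalize scaledTime β t (n - 1) = Y at *
  generalize scaledTime β t (n + 1) = Z at *
  have hw := wt_pos θ n
  have hkey := hk X Y hX (by linarith) hYX
  have hYk : 0 < Y ^ (k + 1) := by positivity
  have hXk : 0 < X ^ (k + 1) := by positivity
  have hT1 : A * (wt θ (n - 1) * Y ^ (k + 1)) ≤ wt θ n * (s * (8 * C * Y ^ (k + 1))) := by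
    calc A * (wt θ (n - 1) * Y ^ (k + 1)) ≤ 2 * C * s * (4 * wt θ n * Y ^ (k + 1)) := by
          gcongr
          · exact mul_nonneg (wt_pos _ _).le hYk.le
          · exact wt_sub_one_le hθ2 n
      _ = _ := by ring
  have hT3 : B * (wt θ (n + 1) * Z ^ (k + 1)) ≤ wt θ n * (s * (X ^ (k + 1) / (4 * C))) := by
    calc B * (wt θ (n + 1) * Z ^ (k + 1)) ≤ B * (2 * wt θ n * (4 * X) ^ (k + 1)) := by
          gcongr
          exact wt_succ_le hθ n
      _ = wt θ n * (2 * B * 4 ^ (k + 1)) * X ^ (k + 1) := by rw [mul_pow]; ring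
      _ ≤ wt θ n * (1 / (4 * C)) * X ^ (k + 1) := by gcongr
      _ = wt θ n * (1 * (X ^ (k + 1) / (4 * C))) := by ring
      _ ≤ _ := by gcongr
  have hT2 : wt θ n * (s * (X ^ (k + 1) / (2 * C))) ≤ A' * (wt θ n * X ^ (k + 1)) := by
    calc wt θ n * (s * (X ^ (k + 1) / (2 * C))) = s / (2 * C) * (wt θ n * X ^ (k + 1)) := by
          field_simp
      _ ≤ _ := by gcongr
  have hfin : wt θ n * s * (8 * C * Y ^ (k + 1)) ≤
      wt θ n * s * ((k + 1) * X ^ k + X ^ (k + 1) / (4 * C)) := by gcongr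
  have hhalf : X ^ (k + 1) / (2 * C) = 2 * (X ^ (k + 1) / (4 * C)) := by field_simp; ring
  rw [hhalf] at hT2
  linarith

/-- `β(1-κ) = θ` identifies the weight ratio `2^θ` between `n - 1` and `n` with the factor that
balances the transport. Also `t ≤ 1` bounds the rescaled time by `1 + 2^{βn}`, so the rate is
comparable with it from below. -/
theorem decaying_profile_super {c₀ : ℝ} (hβ : 1 ≤ β) (hθ : -1 ≤ θ) (hκ : 0 < κ)
    (hκθ : β * (1 - κ) = θ) (hη : 0 < η) (hη2 : η ≤ 1 / 2) (hC : 0 < C) (hc₀ : 0 ≤ c₀)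
    (ht : t ∈ Icc (0 : ℝ) 1) (hn : 1 ≤ n) (hA : 2 ^ (β * (n : ℝ)) / (2 * C) ≤ A) (hB : 0 ≤ B)
    (hAA' : (1 - c₀ * scaledTime β t n ^ (-(2 * η))) * (2 ^ β * A) ≤ A')
    (hx : 2 ≤ scaledTime β t n)
    (hx₁ : c₀ * scaledTime β t n ^ (-η) ≤ ((4 / 3) ^ η - 1) / 4)
    (hx₂ : κ * scaledTime β t n ^ (-η) ≤ 1 / (2 * C) * ((4 / 3) ^ η - 1) / 8)
    (hBs : B ≤ 1 / (2 * C) * ((4 / 3) ^ η - 1) / 32) :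
    A * (wt θ (n - 1) * decayProfile κ η (scaledTime β t (n - 1))) -
      A' * (wt θ n * decayProfile κ η (scaledTime β t n)) +
      B * (wt θ (n + 1) * decayProfile κ η (scaledTime β t (n + 1))) ≤
      wt θ n * (-(κ * (scaledTime β t n ^ (-κ) * (scaledTime β t n)⁻¹)) * 2 ^ (β * (n : ℝ))) := by
  have hn0 : (0 : ℝ) ≤ n := by exact_mod_cast (by omega : 0 ≤ n)
  have hs1 : (1 : ℝ) ≤ 2 ^ (β * (n : ℝ)) := Real.one_le_rpow one_le_two (by positivity)
  have hw := wt_pos θ n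
  have key := decayProfile_transport (A := A) (A' := A') (B := B) (s := 2 ^ (β * (n : ℝ)))
    (γ := 1 / (2 * C)) hκ hη hη2 hc₀ hβ hx
    (scaledTime_sub_one_le hβ ht.1 n) (le_scaledTime_sub_one hβ n)
    (le_scaledTime_add_one hβ ht.1 n) (by positivity) (by positivity)
    (by linarith [scaledTime_le_of_le_one (β := β) ht.2 n])
    (by rw [one_div_mul_eq_div]; exact hA) hB hAA' hx₁ hx₂ hBs
  have hZ := decayProfile_nonneg (κ := κ) hη.le (one_le_scaledTime (β := β) ht.1 (n + 1))
  have h1 := mul_le_mul_of_nonneg_left key hw.le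
  rw [hκθ] at h1
  have h2 : B * (wt θ (n + 1) * decayProfile κ η (scaledTime β t (n + 1))) ≤
      wt θ n * (2 * B * decayProfile κ η (scaledTime β t (n + 1))) := by
    calc _ ≤ B * (2 * wt θ n * decayProfile κ η (scaledTime β t (n + 1))) := by
          gcongr
          exact wt_succ_le hθ n
      _ = _ := by ring
  have h3 : A * (wt θ (n - 1) * decayProfile κ η (scaledTime β t (n - 1))) =
      wt θ n * (2 ^ θ * A * decayProfile κ η (scaledTime β t (n - 1))) := by
    rw [wt_sub_one hn]; ring
  linarith

end RightInequalities

/-- A factor `e^{Kt}` allows a defect `K u` in the supersolution inequality, which is affordable on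
the unit time interval. -/
theorem IsDiffBarrier.of_exp_mul {A B : ℝ → ℤ → ℝ} {t₁ T K : ℝ} {u : ℝ → ℤ → ℝ}
    (hcont : ∀ n, ContinuousOn (fun t => u t n) (Icc t₁ T))
    (hnonneg : ∀ t ∈ Icc t₁ T, ∀ n, 0 ≤ u t n)
    (hsuper : ∀ t ∈ Ioc t₁ T, ∀ n, ∃ (ψ : ℝ → ℝ) (ψ' : ℝ), HasDerivAt ψ ψ' t ∧ ψ t = u t n ∧
      (∀ s ∈ Icc t₁ t, u s n ≤ ψ s) ∧
      A t n * u t (n - 1) - (A t (n + 1) + B t n) * u t n + B t (n + 1) * u t (n + 1) ≤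
        ψ' + K * u t n) :
    IsDiffBarrier A B t₁ T (fun t n => Real.exp (K * t) * u t n) where
  cont n := (Continuous.continuousOn (by fun_prop)).mul (hcont n)
  nonneg t ht n := mul_nonneg (Real.exp_pos _).le (hnonneg t ht n)
  super t ht n := by
    obtain ⟨ψ, ψ', h1, h2, h3, h4⟩ := hsuper t ht n
    have hexp : HasDerivAt (fun s => Real.exp (K * s)) (Real.exp (K * t) * K) t := by
      simpa using ((hasDerivAt_id t).const_mul K).exp
    refine ⟨fun s => Real.exp (K * s) * ψ s, _, hexp.mul h1, by simp only [h2], fun s hs =>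
      mul_le_mul_of_nonneg_left (h3 s hs) (Real.exp_pos _).le, ?_⟩
    have := mul_le_mul_of_nonneg_left h4 (Real.exp_pos (K * t)).le
    rw [h2]
    linarith

section ShortBarrierSuper

variable {β g c₀ δ ε₁ ε θ κ η C D l Ka Kb K : ℝ} {a b : ℤ → ℝ} {A B : ℝ → ℤ → ℝ} {k : ℕ} {N : ℤ}

/-- To the left of `N` the rates are bounded and neighbouring weights are comparable. The right
neighbour is at most `D wt θ`, hence the quotient `D/l` in `K`. -/
theorem shortBarrier_super_left (h : IsReferenceRates β g a b)
    (hp : IsPerturbedRates β a b c₀ δ ε₁ ε A B) (hε : ε ≤ 1 / 2) (hθ : -1 ≤ θ) (hθ2 : θ ≤ 2)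
    (hκ : 0 ≤ κ) (hη : 0 ≤ η) (hD : 1 ≤ D) (hl0 : 0 < l) (hl1 : l ≤ 1) (hKa : 0 < Ka)
    (hKb : 0 < Kb) (ha : ∀ n ≤ N, a n ≤ Ka) (hb : ∀ n, b n ≤ Kb)
    (hK : K = 8 * Ka + 4 * Kb * D / l) {s : ℝ} (hs0 : 0 < s) {n : ℤ} (hn : n ≤ N) :
    A s n * shortBarrier β θ κ η D l k N s (n - 1) -
      (A s (n + 1) + B s n) * shortBarrier β θ κ η D l k N s n +
      B s (n + 1) * shortBarrier β θ κ η D l k N s (n + 1) ≤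
      K * shortBarrier β θ κ η D l k N s n := by
  have hApos := hp.a_pos h hε hs0
  have hBpos := hp.b_pos h hε hs0
  have hub := shortBarrier_le_mul (β := β) (θ := θ) (η := η) (k := k) (N := N) (l := l)
    hκ hD hl1 hs0.le (n + 1)
  have hnn := fun m => shortBarrier_nonneg (β := β) (θ := θ) (κ := κ) (k := k) (N := N)
    hη (by linarith : 0 ≤ D) hl0.le hs0.le m
  have h1 : A s n * shortBarrier β θ κ η D l k N s (n - 1) ≤ 8 * Ka * (l * wt θ n) := by
    rw [shortBarrier_of_le (by omega)]
    have h2 := (hp.a_bounds h hε hs0 n).2.trans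
      (mul_le_mul_of_nonneg_left (ha n hn) two_pos.le)
    have h3 := mul_le_mul_of_nonneg_left (wt_sub_one_le hθ2 n) hl0.le
    calc _ ≤ 2 * Ka * (l * (4 * wt θ n)) :=
          mul_le_mul h2 h3 (mul_nonneg hl0.le (wt_pos _ _).le) (by positivity)
      _ = _ := by ring
  have h2 : B s (n + 1) * shortBarrier β θ κ η D l k N s (n + 1) ≤
      4 * Kb * D / l * (l * wt θ n) := by
    have h3 := (hp.b_bounds h hε hs0 (n + 1)).2.trans
      (mul_le_mul_of_nonneg_left (hb (n + 1)) two_pos.le)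
    have h4 := hub.trans (mul_le_mul_of_nonneg_left (wt_succ_le hθ n) (by linarith))
    calc _ ≤ 2 * Kb * (D * (2 * wt θ n)) := mul_le_mul h3 h4 (hnn _) (by positivity)
      _ = _ := by field_simp; ring
  have h3 : 0 ≤ (A s (n + 1) + B s n) * shortBarrier β θ κ η D l k N s n :=
    mul_nonneg (add_pos (hApos _) (hBpos _)).le (hnn _)
  rw [shortBarrier_of_le hn] at h3 ⊢
  rw [hK]
  linarith

/-- The profile attaining the minimum is the upper test function, and the neighbours lie below that
same profile, including the index `N`. Where the decaying profile is strictly smaller, `hcross`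
guarantees the size of `x` that its inequality needs. -/
theorem shortBarrier_super_right (h : IsReferenceRates β g a b)
    (hp : IsPerturbedRates β a b c₀ δ ε₁ ε A B) (hε : ε ≤ 1 / 2) (hβ : 1 ≤ β) (hβ2 : β ≤ 2)
    (hc₀ : 0 ≤ c₀) (hθ : -1 ≤ θ) (hθ2 : θ ≤ 2) (hκ : 0 < κ) (hκθ : β * (1 - κ) = θ)
    (hη : 0 < η) (hη2 : η ≤ 1 / 2) (hηδ : 2 * η = δ) (hC : 0 < C)
    (hCa : ∀ n : ℤ, 0 ≤ n → 2 ^ (β * (n : ℝ)) ≤ C * a n ∧ a n ≤ C * 2 ^ (β * (n : ℝ)))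
    (hk : ∀ x y : ℝ, 1 ≤ x → 0 ≤ y → y ≤ 1 + (x - 1) / 2 →
      8 * C * y ^ (k + 1) ≤ (k + 1) * x ^ k + x ^ (k + 1) / (4 * C))
    (hcross : ∀ x, 1 ≤ x → D * decayProfile κ η x < x ^ (k + 1) →
      2 ≤ x ∧ c₀ * x ^ (-η) ≤ ((4 / 3) ^ η - 1) / 4 ∧
      κ * x ^ (-η) ≤ 1 / (2 * C) * ((4 / 3) ^ η - 1) / 8)
    (hD : 1 ≤ D) (hl0 : 0 < l) (hl1 : l ≤ 1) (hN0 : 0 ≤ N)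
    (hl : l ≤ (1 + 2 ^ (β * (N : ℝ))) ^ (-κ) / 2)
    (hbN : ∀ n, N ≤ n → b (n + 1) ≤
      min (1 / (4 * C) / (2 * 4 ^ (k + 1)) / 2) (1 / (2 * C) * ((4 / 3) ^ η - 1) / 32 / 2))
    {s : ℝ} (hs : s ∈ Ioc (0 : ℝ) 1) {n : ℤ} (hn : N < n) :
    ∃ (ψ : ℝ → ℝ) (ψ' : ℝ), HasDerivAt ψ ψ' s ∧ ψ s = shortBarrier β θ κ η D l k N s n ∧
      (∀ r, shortBarrier β θ κ η D l k N r n ≤ ψ r) ∧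
      A s n * shortBarrier β θ κ η D l k N s (n - 1) -
      (A s (n + 1) + B s n) * shortBarrier β θ κ η D l k N s n +
      B s (n + 1) * shortBarrier β θ κ η D l k N s (n + 1) ≤ ψ' := by
  have hs0 : 0 < s := hs.1
  have hsI : s ∈ Icc (0 : ℝ) 1 := ⟨hs0.le, hs.2⟩
  have hApos := hp.a_pos h hε hs0
  have hBpos := hp.b_pos h hε hs0
  have hw := wt_pos θ n
  have hnn := shortBarrier_nonneg (β := β) (θ := θ) (κ := κ) (k := k) (N := N)
    hη.le (by linarith : 0 ≤ D) hl0.le hs0.le n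
  have hn1 : 1 ≤ n := by omega
  have hgt := fun r => shortBarrier_of_gt (β := β) (θ := θ) (κ := κ) (η := η) (D := D)
    (l := l) (t := r) (k := k) hn
  have hle := fun m (hm : N ≤ m) => shortBarrier_le (θ := θ) (k := k) hκ.le hη.le
    hD hl1 hl hsI hm
  have hA1 : A s n ≤ 2 * C * 2 ^ (β * (n : ℝ)) := by
    have := (hp.a_bounds h hε hs0 n).2
    have := (hCa n (by omega)).2
    linarith
  have hA2 : 2 ^ (β * (n : ℝ)) / (2 * C) ≤ A s n := by
    have := (hp.a_bounds h hε hs0 n).1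
    have := (hCa n (by omega)).1
    rw [div_le_iff₀ (by positivity)]
    nlinarith
  have hA3 : 2 ^ (β * (n : ℝ)) / (2 * C) ≤ A s (n + 1) := by
    have h1 := (hp.a_bounds h hε hs0 (n + 1)).1
    have h2 := (hCa (n + 1) (by omega)).1
    have h3 : (2 : ℝ) ^ (β * (n : ℝ)) ≤ 2 ^ (β * ((n + 1 : ℤ) : ℝ)) := by
      push_cast
      exact Real.rpow_le_rpow_of_exponent_le one_le_two (by nlinarith)
    rw [div_le_iff₀ (by positivity)]
    nlinarith
  have hB2 := (hp.b_bounds h hε hs0 (n + 1)).2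
  have hbn := hbN n hn.le
  have hB4 : 2 * B s (n + 1) * 4 ^ (k + 1) ≤ 1 / (4 * C) := by
    have h1 := hbn.trans (min_le_left _ _)
    have h2 : B s (n + 1) ≤ 1 / (4 * C) / (2 * 4 ^ (k + 1)) := by linarith
    rw [le_div_iff₀ (by positivity)] at h2
    linarith
  have hB5 : B s (n + 1) ≤ 1 / (2 * C) * ((4 / 3) ^ η - 1) / 32 := by
    have h1 := hbn.trans (min_le_right _ _)
    linarith
  have hX := one_le_scaledTime (β := β) hs0.le n
  have hXd := hasDerivAt_scaledTime (β := β) (t := s) n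
  have hBw : 0 ≤ B s n * shortBarrier β θ κ η D l k N s n := mul_nonneg (hBpos n).le hnn
  rcases le_or_gt (scaledTime β s n ^ (k + 1)) (D * decayProfile κ η (scaledTime β s n))
    with hcase | hcase
  · have heq : shortBarrier β θ κ η D l k N s n = wt θ n * scaledTime β s n ^ (k + 1) := by
      rw [hgt, min_eq_left hcase]
    refine ⟨fun s => wt θ n * scaledTime β s n ^ (k + 1), _,
      (hXd.pow (k + 1)).const_mul (wt θ n), heq.symm, fun r => ?_, ?_⟩
    · rw [hgt]
      exact mul_le_mul_of_nonneg_left (min_le_left _ _) hw.le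
    · have key := growing_profile_super (θ := θ) hβ hβ2 hθ hθ2 hC hk hs0.le hn1
        hA1 hA3 (hBpos (n + 1)).le hB4
      have h1 := mul_le_mul_of_nonneg_left (hle (n - 1) (by omega)).1 (hApos n).le
      have h2 := mul_le_mul_of_nonneg_left (hle (n + 1) (by omega)).1 (hBpos (n + 1)).le
      rw [heq] at hBw ⊢
      rw [Nat.add_sub_cancel]
      push_cast
      linarith
  · have heq : shortBarrier β θ κ η D l k N s n =
        wt θ n * (D * decayProfile κ η (scaledTime β s n)) := by
      rw [hgt, min_eq_right hcase.le]
    obtain ⟨hX2, hXc, hXκ⟩ := hcross _ hX hcase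
    obtain ⟨G', hG', hG'le⟩ := exists_hasDerivAt_decayProfile hκ.le hη.le hX
    have hcomp : HasDerivAt (fun s => decayProfile κ η (scaledTime β s n))
        (G' * 2 ^ (β * (n : ℝ))) s :=
      HasDerivAt.comp (h₂ := decayProfile κ η) (h := fun s => scaledTime β s n) s hG' hXd
    refine ⟨fun s => wt θ n * (D * decayProfile κ η (scaledTime β s n)), _,
      (hcomp.const_mul D).const_mul (wt θ n), heq.symm, fun r => ?_, ?_⟩
    · rw [hgt]
      exact mul_le_mul_of_nonneg_left (min_le_right _ _) hw.le
    · have hearly := hp.early s hs n (by omega)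
      rw [← hηδ] at hearly
      have key := decaying_profile_super (θ := θ) hβ hθ hκ hκθ hη hη2 hC hc₀ hsI hn1 hA2
        (hBpos (n + 1)).le hearly hX2 hXc hXκ hB5
      have h1 := mul_le_mul_of_nonneg_left (hle (n - 1) (by omega)).2 (hApos n).le
      have h2 := mul_le_mul_of_nonneg_left (hle (n + 1) (by omega)).2 (hBpos (n + 1)).le
      rw [heq] at hBw ⊢
      have hD0 : 0 ≤ D := by linarith
      have key' := mul_le_mul_of_nonneg_left key hD0
      have h0 : wt θ n * (-(κ * (scaledTime β s n ^ (-κ) * (scaledTime β s n)⁻¹)) *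
          2 ^ (β * (n : ℝ))) ≤ wt θ n * (G' * 2 ^ (β * (n : ℝ))) := by gcongr
      have h0' := mul_le_mul_of_nonneg_left h0 hD0
      linarith

end ShortBarrierSuper

/-- Smoothing of the differences on the unit time interval. -/
theorem IsReferenceRates.exists_short_time_bound {β g : ℝ} {a b : ℤ → ℝ}
    (h : IsReferenceRates β g a b) (hβ : 1 ≤ β) (hβ2 : β ≤ 2) {c₀ δ : ℝ} (hc₀ : 0 ≤ c₀)
    (hδ : 0 < δ) (hδ1 : δ ≤ 1) {θ : ℝ} (hθ : -1 ≤ θ) (hθβ : θ < β) :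
    ∃ C, 0 < C ∧ ∀ ε₁ ε A B, IsPerturbedRates β a b c₀ δ ε₁ ε A B → ε ≤ 1 / 2 →
      ∀ d, IsDiffSolution A B d → ∀ M, 0 ≤ M → (∀ n, |d 0 n| ≤ M * wt θ n) →
      ∀ t ∈ Icc (0 : ℝ) 1, ∀ n,
        |d t n| ≤ C * M * (wt θ n * scaledTime β t n ^ (-((β - θ) / β))) := by
  have hβ0 : 0 < β := by linarith
  obtain ⟨C, hC, hCa⟩ := h.a_top
  obtain ⟨k, hk⟩ := exists_pow_supersolution hC
  obtain ⟨Kb, hKb, hb⟩ := h.exists_b_le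
  -- With this exponent `2^{-θn}(2^{βn}t)^{-κ} = t^{-κ} 2^{-βn}`: the full gain from weight `θ` to
  -- weight `β`.
  set κ := (β - θ) / β with hκdef
  have hκ : 0 < κ := div_pos (by linarith) hβ0
  have hκθ : β * (1 - κ) = θ := by rw [hκdef]; field_simp; ring
  set η := δ / 2 with hη
  have hη0 : 0 < η := by positivity
  have hη2 : η ≤ 1 / 2 := by rw [hη]; linarith
  have hG : 0 < (4 / 3 : ℝ) ^ η - 1 := by
    have : (1 : ℝ) < (4 / 3) ^ η := Real.one_lt_rpow (by norm_num) hη0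
    linarith
  -- the threshold for the rescaled time
  have hlim : Tendsto (fun x : ℝ => x ^ (-η)) atTop (𝓝 0) := tendsto_rpow_neg_atTop hη0
  have hR : ∀ᶠ x : ℝ in atTop, 2 ≤ x ∧ c₀ * x ^ (-η) ≤ ((4 / 3) ^ η - 1) / 4 ∧
      κ * x ^ (-η) ≤ 1 / (2 * C) * ((4 / 3) ^ η - 1) / 8 := by
    have h1 := (hlim.const_mul c₀)
    have h2 := (hlim.const_mul κ)
    rw [mul_zero] at h1 h2
    exact (eventually_ge_atTop 2).and ((h1.eventually_le_const (by positivity)).and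
      (h2.eventually_le_const (by positivity)))
  obtain ⟨R, hRall⟩ := eventually_atTop.mp hR
  obtain ⟨R₂, hR₂⟩ : ∃ R₂, R₂ = max R 1 := ⟨_, rfl⟩
  have hR1 : 1 ≤ R₂ := hR₂ ▸ le_max_right _ _
  have hRR : R ≤ R₂ := hR₂ ▸ le_max_left _ _
  -- So large that on `1 ≤ x ≤ R₂` the decaying profile stays above `R₂^{k+1} ≥ x^{k+1}`; the
  -- profiles can cross only beyond the threshold `R`.
  obtain ⟨D, hD⟩ : ∃ D : ℝ, D = 2 * (R₂ ^ (k + 1) * R₂ ^ κ) := ⟨_, rfl⟩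
  have hD2 : 2 ≤ D := by
    have h1 : 1 ≤ R₂ ^ (k + 1) := one_le_pow₀ hR1
    have h2 : 1 ≤ R₂ ^ κ := Real.one_le_rpow hR1 hκ.le
    rw [hD]; nlinarith
  have hcross : ∀ x, 1 ≤ x → D * decayProfile κ η x < x ^ (k + 1) → R ≤ x := by
    intro x hx hlt
    by_contra! hxR
    have hxR' : x ≤ R₂ := hxR.le.trans hRR
    have h1 : x ^ (k + 1) ≤ R₂ ^ (k + 1) := pow_le_pow_left₀ (by linarith) hxR' _
    have h2 : R₂ ^ (-κ) ≤ x ^ (-κ) :=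
      Real.rpow_le_rpow_of_nonpos (by linarith) hxR' (by linarith)
    have h3 := le_decayProfile (κ := κ) hη0.le hx
    have h4 : R₂ ^ κ * R₂ ^ (-κ) = 1 := by
      rw [← Real.rpow_add (by linarith)]; simp
    have h5 : R₂ ^ (k + 1) ≤ D * decayProfile κ η x := by
      calc R₂ ^ (k + 1) = 2 * (R₂ ^ (k + 1) * R₂ ^ κ) * (R₂ ^ (-κ) / 2) := by
            linear_combination (-R₂ ^ (k + 1)) * h4
        _ ≤ D * decayProfile κ η x := by
            rw [hD]
            have : 0 ≤ 2 * (R₂ ^ (k + 1) * R₂ ^ κ) := by positivity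
            exact mul_le_mul_of_nonneg_left (by linarith) this
    linarith
  -- the threshold for the position
  have hNev : ∀ᶠ n : ℤ in atTop, b (n + 1) ≤
      min (1 / (4 * C) / (2 * 4 ^ (k + 1)) / 2) (1 / (2 * C) * ((4 / 3) ^ η - 1) / 32 / 2) :=
    (h.b_tendsto.comp (tendsto_atTop_add_const_right _ 1 tendsto_id)).eventually_le_const
      (lt_min (by positivity) (by positivity))
  obtain ⟨N', hN'⟩ := eventually_atTop.mp hNev
  obtain ⟨N, hN⟩ : ∃ N, N = max N' 0 := ⟨_, rfl⟩
  have hN0 : 0 ≤ N := hN ▸ le_max_right _ _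
  have hNN' : N' ≤ N := hN ▸ le_max_left _ _
  obtain ⟨Ka, hKa, haN⟩ : ∃ K, 0 < K ∧ ∀ n ≤ N, a n ≤ K := by
    obtain ⟨K, hK, hle⟩ := h.exists_a_le_of_nonpos
    have h1 : 0 ≤ C * 2 ^ (β * (N : ℝ)) := by positivity
    refine ⟨K + C * 2 ^ (β * (N : ℝ)), by positivity, fun n hn => ?_⟩
    rcases le_total n 0 with h0 | h0
    · linarith [hle n h0]
    · have h2 := (hCa n h0).2
      have h3 : (2 : ℝ) ^ (β * (n : ℝ)) ≤ 2 ^ (β * (N : ℝ)) := by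
        have : (n : ℝ) ≤ N := by exact_mod_cast hn
        exact Real.rpow_le_rpow_of_exponent_le one_le_two (by nlinarith)
      have h4 := mul_le_mul_of_nonneg_left h3 hC.le
      linarith
  -- A lower bound, for `t ≤ 1`, of the decaying profile at index `N`, so the left part of the
  -- barrier fits below both profiles where the two parts meet.
  obtain ⟨l, hl⟩ : ∃ l : ℝ, l = (1 + 2 ^ (β * (N : ℝ))) ^ (-κ) / 2 := ⟨_, rfl⟩
  have hbase : (1 : ℝ) ≤ 1 + 2 ^ (β * (N : ℝ)) := by
    have : (0 : ℝ) < 2 ^ (β * (N : ℝ)) := by positivity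
    linarith
  have hl0 : 0 < l := by rw [hl]; positivity
  have hl1 : l ≤ 1 := by
    have := (rpow_neg_mem hκ.le hbase).2
    rw [hl]; linarith
  obtain ⟨K, hK⟩ : ∃ K : ℝ, K = 8 * Ka + 4 * Kb * D / l := ⟨_, rfl⟩
  have hK0 : 0 < K := by rw [hK]; positivity
  refine ⟨D * Real.exp K / l, by positivity, ?_⟩
  intro ε₁ ε A B hp hε d hd M hM hinit t ht n
  have hbarrier : IsDiffBarrier A B 0 1
      (fun s n => M / l * (Real.exp (K * s) * shortBarrier β θ κ η D l k N s n)) := by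
    refine IsDiffBarrier.const_mul (IsDiffBarrier.of_exp_mul
      (fun n => (continuousOn_shortBarrier n).mono Icc_subset_Ici_self)
      (fun s hs n => shortBarrier_nonneg hη0.le (by linarith) hl0.le hs.1 n)
      (fun s hs n => ?_)) (div_nonneg hM hl0.le)
    rcases le_or_gt n N with hn | hn
    · refine ⟨fun _ => l * wt θ n, 0, hasDerivAt_const _ _, (shortBarrier_of_le hn).symm,
        fun r _ => (shortBarrier_of_le hn).le, ?_⟩
      rw [zero_add]
      exact shortBarrier_super_left h hp hε hθ (by linarith) hκ.le hη0.le (by linarith) hl0 hl1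
        hKa hKb haN hb hK hs.1 hn
    · obtain ⟨ψ, ψ', h1, h2, h3, h4⟩ := shortBarrier_super_right h hp hε hβ hβ2 hc₀ hθ
        (by linarith) hκ hκθ hη0 hη2 (by rw [hη]; ring) hC hCa hk
        (fun x hx hlt => hRall x (hcross x hx hlt)) (by linarith) hl0 hl1 hN0 hl.le
        (fun n hn => hN' n (hNN'.trans hn)) hs hn
      refine ⟨ψ, ψ', h1, h2, fun r _ => h3 r, h4.trans (le_add_of_nonneg_right ?_)⟩
      exact mul_nonneg hK0.le (shortBarrier_nonneg hη0.le (by linarith) hl0.le hs.1.le n)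
  have hres := hp.abs_diff_le_of_barrier h hε hβ0 le_rfl hd hbarrier (fun m => ?_) t ht n
  · refine hres.trans ?_
    have hw := wt_pos θ n
    have hX := one_le_scaledTime (β := β) ht.1 n
    have hXκ : 0 < scaledTime β t n ^ (-κ) := by positivity
    have h1 : shortBarrier β θ κ η D l k N t n ≤ D * (wt θ n * scaledTime β t n ^ (-κ)) := by
      rcases le_or_gt n N with hn | hn
      · rw [shortBarrier_of_le hn]
        have h2 : (1 + 2 ^ (β * (N : ℝ))) ^ (-κ) ≤ scaledTime β t n ^ (-κ) := by
          refine Real.rpow_le_rpow_of_nonpos (by positivity) ?_ (by linarith)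
          refine (scaledTime_le_of_le_one ht.2 n).trans ?_
          have : (n : ℝ) ≤ N := by exact_mod_cast hn
          have := Real.rpow_le_rpow_of_exponent_le one_le_two
            (by nlinarith : β * (n : ℝ) ≤ β * N)
          linarith
        have h3 : l ≤ D * scaledTime β t n ^ (-κ) := by rw [hl]; nlinarith
        calc l * wt θ n ≤ D * scaledTime β t n ^ (-κ) * wt θ n :=
              mul_le_mul_of_nonneg_right h3 hw.le
          _ = _ := by ring
      · rw [shortBarrier_of_gt hn]
        calc _ ≤ wt θ n * (D * scaledTime β t n ^ (-κ)) := by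
              refine mul_le_mul_of_nonneg_left ((min_le_right _ _).trans ?_) hw.le
              exact mul_le_mul_of_nonneg_left (decayProfile_le hX) (by linarith)
          _ = _ := by ring
    have h2 : Real.exp (K * t) ≤ Real.exp K :=
      Real.exp_le_exp.mpr (mul_le_of_le_one_right hK0.le ht.2)
    calc M / l * (Real.exp (K * t) * shortBarrier β θ κ η D l k N t n) ≤
          M / l * (Real.exp K * (D * (wt θ n * scaledTime β t n ^ (-κ)))) := by
          have := shortBarrier_nonneg (β := β) (θ := θ) (κ := κ) (k := k) (N := N)
            hη0.le (by linarith : 0 ≤ D) hl0.le ht.1 n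
          gcongr
      _ = _ := by ring
  · refine (hinit m).trans ?_
    -- At `t = 0` the rescaled time is one: the growing profile equals `1` and the decaying one `D/2
    -- ≥ 1`.
    have h1 : l * wt θ m ≤ shortBarrier β θ κ η D l k N 0 m := by
      rcases le_or_gt m N with hm | hm
      · rw [shortBarrier_of_le hm]
      · rw [shortBarrier_of_gt hm, mul_comm l]
        refine mul_le_mul_of_nonneg_left ?_ (wt_pos _ _).le
        have hX : scaledTime β 0 m = 1 := by simp [scaledTime]
        rw [hX]
        simp only [one_pow, decayProfile, Real.one_rpow]
        refine le_min hl1 ?_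
        linarith
    simp only [mul_zero, Real.exp_zero, one_mul]
    calc M * wt θ m = M / l * (l * wt θ m) := by field_simp
      _ ≤ _ := mul_le_mul_of_nonneg_left h1 (div_nonneg hM hl0.le)

/-! ### Solutions of the backward equation -/

/-- Solutions of the backward equation with rates `A` (downwards) and `B` (upwards), locally
bounded in `𝒴_κ`. -/
structure IsBackwardSolution (A B : ℝ → ℤ → ℝ) (κ : ℝ) (y₀ : ℤ → ℝ) (y : ℝ → ℤ → ℝ) : Prop where
  init : y 0 = y₀
  cont : ∀ n, ContinuousOn (fun t => y t n) (Ici 0)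
  deriv : ∀ t, 0 < t → ∀ n, HasDerivAt (fun s => y s n)
    (A t n * (y t (n - 1) - y t n) + B t n * (y t (n + 1) - y t n)) t
  bound : ∀ T : ℝ, ∃ M : ℝ, ∀ t ∈ Icc 0 T, ∀ n, |y t n| ≤ M * wt κ n

section Solutions

variable {β g : ℝ} {a b : ℤ → ℝ} {c₀ δ ε₁ ε κ : ℝ} {A B : ℝ → ℤ → ℝ}

theorem IsBackwardSolution.dplus {y₀ : ℤ → ℝ} {y : ℝ → ℤ → ℝ} (hκ : -1 ≤ κ)
    (hy : IsBackwardSolution A B κ y₀ y) : IsDiffSolution A B (fun t => Dplus (y t)) where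
  cont n := (hy.cont (n + 1)).sub (hy.cont n)
  deriv t ht n := by
    refine ((hy.deriv t ht (n + 1)).sub (hy.deriv t ht n)).congr_deriv ?_
    simp only [Dplus, sub_add_cancel, add_sub_cancel_right]
    ring
  growth T := by
    obtain ⟨M, hM⟩ := hy.bound T
    refine ⟨3 * |M|, fun t ht n => ?_⟩
    have h1 : ∀ n, |y t n| ≤ |M| * wt κ n := fun n =>
      (hM t ht n).trans (mul_le_mul_of_nonneg_right (le_abs_self M) (wt_pos _ _).le)
    have h2 := mul_le_mul_of_nonneg_left (wt_succ_le hκ n) (abs_nonneg M)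
    have h3 := mul_le_mul_of_nonneg_left (wt_le_two_pow hκ n) (abs_nonneg M)
    calc |Dplus (y t) n| ≤ |y t (n + 1)| + |y t n| := abs_sub _ _
      _ ≤ _ := by linarith [h1 n, h1 (n + 1)]

/-- `M e^{ct} wt κ` is a supersolution because `κ ≤ 0` makes the weight nondecreasing for `n ≥ 0`:
the unbounded down rates then contribute with a favourable sign, and all other rates are bounded. -/
theorem IsPerturbedRates.exists_solution (h : IsReferenceRates β g a b)
    (hp : IsPerturbedRates β a b c₀ δ ε₁ ε A B) (hε : ε ≤ 1 / 2) (hκ : -1 ≤ κ) (hκ0 : κ ≤ 0)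
    {y₀ : ℤ → ℝ} {M : ℝ} (hy₀ : ∀ n, |y₀ n| ≤ M * wt κ n) :
    ∃ y, IsBackwardSolution A B κ y₀ y := by
  obtain ⟨Kb, hKb, hb⟩ := h.exists_b_le
  obtain ⟨Ka, hKa, ha⟩ := h.exists_a_le_of_nonpos
  have hM : 0 ≤ M := by
    have h1 := (abs_nonneg _).trans (hy₀ 0)
    exact nonneg_of_mul_nonneg_left h1 (wt_pos _ _)
  have hW : ∀ n, 0 ≤ M * wt κ n := fun n => mul_nonneg hM (wt_pos _ _).le
  have hΛ : ∀ t, 0 < t → ∀ n, A t n + B t n ≤ 2 * a n + 2 * b n := fun t ht n =>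
    add_le_add (hp.a_bounds h hε ht n).2 (hp.b_bounds h hε ht n).2
  have hWs : ∀ t, 0 < t → ∀ n, A t n * (M * wt κ (n - 1) - M * wt κ n) +
      B t n * (M * wt κ (n + 1) - M * wt κ n) ≤ (6 * Ka + 2 * Kb) * (M * wt κ n) := by
    intro t ht n
    have hA := hp.a_pos h hε ht n
    have hB := hp.b_pos h hε ht n
    have h1 : B t n * (M * wt κ (n + 1) - M * wt κ n) ≤ 2 * Kb * (M * wt κ n) := by
      have h2 := mul_le_mul_of_nonneg_left (wt_succ_le hκ n) hM
      have h3 := (hp.b_bounds h hε ht n).2.trans (mul_le_mul_of_nonneg_left (hb n) two_pos.le)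
      calc _ ≤ B t n * (M * wt κ n) := mul_le_mul_of_nonneg_left (by linarith) hB.le
        _ ≤ _ := mul_le_mul_of_nonneg_right h3 (hW n)
    have h2 : A t n * (M * wt κ (n - 1) - M * wt κ n) ≤ 6 * Ka * (M * wt κ n) := by
      rcases le_or_gt n 0 with hn | hn
      · have h2 := mul_le_mul_of_nonneg_left (wt_sub_one_le (by linarith : κ ≤ 2) n) hM
        have h3 := (hp.a_bounds h hε ht n).2.trans
          (mul_le_mul_of_nonneg_left (ha n hn) two_pos.le)
        calc _ ≤ A t n * (3 * (M * wt κ n)) := mul_le_mul_of_nonneg_left (by linarith) hA.le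
          _ ≤ 2 * Ka * (3 * (M * wt κ n)) :=
            mul_le_mul_of_nonneg_right h3 (mul_nonneg (by norm_num) (hW n))
          _ = _ := by ring
      · have h2 : wt κ (n - 1) ≤ wt κ n := by
          rw [wt_sub_one (by omega)]
          exact mul_le_of_le_one_left (wt_pos _ _).le
            (Real.rpow_le_one_of_one_le_of_nonpos one_le_two hκ0)
        have h3 := mul_le_mul_of_nonneg_left h2 hM
        have h4 : A t n * (M * wt κ (n - 1) - M * wt κ n) ≤ 0 :=
          mul_nonpos_of_nonneg_of_nonpos hA.le (by linarith)
        have := mul_nonneg hKa.le (hW n)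
        linarith
    linarith
  -- Monotone iteration needs nonnegative data, so the positive and negative parts are solved
  -- separately and subtracted.
  have hex : ∀ v : ℤ → ℝ, (∀ n, 0 ≤ v n) → (∀ n, v n ≤ M * wt κ n) → _ := fun v hv0 hv =>
    exists_solution_of_nonneg (y₀ := v) (Λ := fun n => 2 * a n + 2 * b n) hp.cont_a hp.cont_b
      (fun t ht n => (hp.a_pos h hε ht n).le) (fun t ht n => (hp.b_pos h hε ht n).le) hΛ hWs hW
      hv0 hv
  obtain ⟨u, hu0, huc, hud, hub⟩ := hex (fun n => max (y₀ n) 0) (fun n => le_max_right _ _)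
    (fun n => max_le ((le_abs_self _).trans (hy₀ n)) (hW n))
  obtain ⟨v, hv0, hvc, hvd, hvb⟩ := hex (fun n => max (-y₀ n) 0) (fun n => le_max_right _ _)
    (fun n => max_le ((neg_le_abs _).trans (hy₀ n)) (hW n))
  refine ⟨fun t n => u t n - v t n, ?_, fun n => (huc n).sub (hvc n), fun t ht n => ?_, fun T => ?_⟩
  · ext n
    rw [hu0, hv0]
    change max (y₀ n) 0 - max (-y₀ n) 0 = y₀ n
    rcases le_total (y₀ n) 0 with h0 | h0
    · rw [max_eq_right h0, max_eq_left (by linarith)]; ring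
    · rw [max_eq_left h0, max_eq_right (by linarith)]; ring
  · exact ((hud t ht n).sub (hvd t ht n)).congr_deriv (by ring)
  · refine ⟨M * Real.exp ((6 * Ka + 2 * Kb) * T), fun t ht n => ?_⟩
    have h1 := hub t ht.1 n
    have h2 := hvb t ht.1 n
    have h3 : |u t n - v t n| ≤ M * wt κ n * Real.exp ((6 * Ka + 2 * Kb) * t) :=
      abs_le.mpr ⟨by linarith, by linarith⟩
    have h4 : Real.exp ((6 * Ka + 2 * Kb) * t) ≤ Real.exp ((6 * Ka + 2 * Kb) * T) :=
      Real.exp_le_exp.mpr (mul_le_mul_of_nonneg_left ht.2 (by positivity))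
    have h5 := mul_le_mul_of_nonneg_left h4 (hW n)
    linarith

/-- Zero is a barrier for the difference of two solutions. For `y` itself, unlike for its
differences, `4^|n|` is a Lyapunov function without further conditions, since inflow and outflow to
the left share the rate `A_n`. -/
theorem IsPerturbedRates.solution_unique (h : IsReferenceRates β g a b)
    (hp : IsPerturbedRates β a b c₀ δ ε₁ ε A B) (hε : ε ≤ 1 / 2) (hκ : -1 ≤ κ) {y₀ : ℤ → ℝ}
    {y z : ℝ → ℤ → ℝ} (hy : IsBackwardSolution A B κ y₀ y) (hz : IsBackwardSolution A B κ y₀ z) :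
    ∀ t, 0 ≤ t → z t = y t := by
  have hle : ∀ y z : ℝ → ℤ → ℝ, IsBackwardSolution A B κ y₀ y → IsBackwardSolution A B κ y₀ z →
      ∀ t, 0 ≤ t → ∀ n, z t n - y t n ≤ 0 := by
    intro y z hy hz T hT n
    obtain ⟨Kb, hKb, hb⟩ := h.exists_b_le
    obtain ⟨Ka, hKa, ha⟩ := h.exists_a_le_of_nonpos
    obtain ⟨M₁, hM₁⟩ := hy.bound T
    obtain ⟨M₂, hM₂⟩ := hz.bound T
    refine le_of_barrier (t₁ := 0) (T := T) (x := fun t n => z t n - y t n) (w := fun _ _ => 0)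
      (a := A) (b := B) (c := fun t n => A t n + B t n) (Λ := 4) (C := 8 * Ka + 8 * Kb)
      (B := |M₁| + |M₂|)
      (fun t ht n => (hp.a_pos h hε ht.1 n).le) (fun t ht n => (hp.b_pos h hε ht.1 n).le)
      (fun n => ((hz.cont n).sub (hy.cont n)).mono Icc_subset_Ici_self)
      (fun t ht n => ((hz.deriv t ht.1 n).sub (hy.deriv t ht.1 n)).congr_deriv (by ring))
      le_rfl ?_ ?_ (fun n => continuousOn_const) (fun t _ n => le_rfl)
      (fun n => by rw [hz.init, hy.init, sub_self]) ?_ T ⟨hT, le_rfl⟩ n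
    · intro t ht n
      have hA := hp.a_pos h hε ht.1 n
      have hB := hp.b_pos h hε ht.1 n
      have hB2 : B t n ≤ 2 * Kb := (hp.b_bounds h hε ht.1 n).2.trans (by linarith [hb n])
      have hV : (0 : ℝ) < 4 ^ n.natAbs := by positivity
      have hup : (4 : ℝ) ^ (n + 1).natAbs ≤ 4 * 4 ^ n.natAbs := by
        rw [← pow_succ']
        exact pow_le_pow_right₀ (by norm_num) (by omega)
      have h1 : B t n * 4 ^ (n + 1).natAbs ≤ 2 * Kb * (4 * 4 ^ n.natAbs) :=
        mul_le_mul hB2 hup (by positivity) (by linarith)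
      have hBV := mul_pos hB hV
      have hAV := mul_pos hA hV
      rcases le_or_gt n 0 with hn | hn
      · have hA2 : A t n ≤ 2 * Ka := (hp.a_bounds h hε ht.1 n).2.trans (by linarith [ha n hn])
        rw [(natAbs_pred_succ_of_nonpos hn).1, pow_succ']
        have h2 := mul_le_mul_of_nonneg_right hA2 (by positivity : (0 : ℝ) ≤ 4 * 4 ^ n.natAbs)
        linarith
      · have h2 : (4 : ℝ) ^ (n - 1).natAbs ≤ 4 ^ n.natAbs :=
          pow_le_pow_right₀ (by norm_num) (by omega)
        have h3 := mul_le_mul_of_nonneg_left h2 hA.le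
        have h4 := mul_pos hKa hV
        linarith
    · intro t ht n
      have h1 := hM₁ t ht n
      have h2 := hM₂ t ht n
      have h3 := wt_le_two_pow hκ n
      have h4 : M₁ * wt κ n ≤ |M₁| * 2 ^ n.natAbs :=
        mul_le_mul (le_abs_self _) h3 (wt_pos _ _).le (abs_nonneg _)
      have h5 : M₂ * wt κ n ≤ |M₂| * 2 ^ n.natAbs :=
        mul_le_mul (le_abs_self _) h3 (wt_pos _ _).le (abs_nonneg _)
      have h6 := le_abs_self (z t n)
      have h7 := neg_abs_le (y t n)
      linarith
    · intro t ht n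
      exact ⟨fun _ => 0, 0, hasDerivAt_const _ _, rfl, fun _ _ => le_rfl, by simp⟩
  intro t ht
  ext n
  have h1 := hle y z hy hz t ht n
  have h2 := hle z y hz hy t ht n
  linarith

end Solutions

/-! ### The decay estimate and convergence of the sequence -/

/-- For `n ≥ 0` the rescaled time is at least `2^{βn}t`, so a power of it trades the singularity
`t^{-q}` for `βq` in the weight; for `n ≤ 0` the weights agree and `t ≤ 1` suffices. -/
theorem wt_mul_scaledTime_rpow_le {β θ q t : ℝ} (hq : 0 ≤ q) (ht : t ∈ Ioc (0 : ℝ) 1) (n : ℤ) :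
    wt θ n * scaledTime β t n ^ (-q) ≤ t ^ (-q) * wt (θ + β * q) n := by
  have hX := one_le_scaledTime (β := β) ht.1.le n
  rcases le_total n 0 with hn | hn
  · rw [wt_of_nonpos hn, wt_of_nonpos hn, mul_comm]
    refine mul_le_mul_of_nonneg_right ?_ (by positivity)
    exact (rpow_neg_mem hq hX).2.trans
      (Real.one_le_rpow_of_pos_of_le_one_of_nonpos ht.1 ht.2 (by linarith))
  · have h1 : 2 ^ (β * (n : ℝ)) * t ≤ scaledTime β t n := by unfold scaledTime; linarith
    have ht0 := ht.1
    have h2 := Real.rpow_le_rpow_of_nonpos (z := -q) (by positivity) h1 (by linarith)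
    rw [Real.mul_rpow (by positivity) ht.1.le, ← Real.rpow_mul two_pos.le] at h2
    rw [wt_of_nonneg hn, wt_of_nonneg hn]
    calc _ ≤ (2 : ℝ) ^ (-(θ * (n : ℝ))) * (2 ^ (β * n * -q) * t ^ (-q)) := by gcongr
      _ = t ^ (-q) * (2 ^ (-(θ * (n : ℝ))) * 2 ^ (β * n * -q)) := by ring
      _ = _ := by
        rw [← Real.rpow_add two_pos]
        ring_nf

/-- The decay estimate for the differences, combining the smoothing for short times with the
exponential decay for long times. -/
theorem IsReferenceRates.exists_decay_estimate {β g : ℝ} {a b : ℤ → ℝ}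
    (h : IsReferenceRates β g a b) (hβ : 1 ≤ β) (hβ2 : β ≤ 2) {ε₁ : ℝ} (hε₁ : 0 < ε₁)
    (hε₁β : ε₁ ≤ β) :
    ∃ ε₀ ν : ℝ, 0 < ε₀ ∧ ε₀ ≤ 1 / 2 ∧ 0 < ν ∧ ∀ c₀ δ, 0 ≤ c₀ → 0 < δ → δ ≤ 1 →
      ∀ θ θ', -1 ≤ θ → θ < β → θ ≤ θ' → θ' ≤ β → ∃ C, 0 < C ∧ ∀ ε A B,
      IsPerturbedRates β a b c₀ δ ε₁ ε A B → 0 ≤ ε → ε ≤ ε₀ → ∀ d, IsDiffSolution A B d →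
      ∀ M, 0 ≤ M → (∀ n, |d 0 n| ≤ M * wt θ n) →
      ∀ t, 0 < t → ∀ n,
        |d t n| ≤ C * M * (t ^ (-(θ' - θ) / β) * Real.exp (-ν * t)) * wt θ' n := by
  have hβ0 : 0 < β := by linarith
  -- The smallness and the rate are fixed by the long-time estimate, which does not involve `θ` or
  -- `θ'`; this gives the order of quantifiers in the conclusion.
  obtain ⟨ε₀, ν₂, C₂, hε₀, hε₀2, hν₂, hC₂, hlong⟩ := h.exists_exponential_decay hβ0 hε₁ hε₁β
  refine ⟨ε₀, ν₂ / 2, hε₀, hε₀2, by positivity, ?_⟩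
  intro c₀ δ hc₀ hδ hδ1 θ θ' hθ hθβ hθθ' hθ'β
  obtain ⟨C₁, hC₁, hshort⟩ := h.exists_short_time_bound hβ hβ2 hc₀ hδ hδ1 hθ hθβ
  set ν := ν₂ / 2 with hν
  have hν0 : 0 < ν := by positivity
  set q := (θ' - θ) / β with hq
  have hq0 : 0 ≤ q := div_nonneg (by linarith) hβ0.le
  have hqle : q ≤ (β - θ) / β := by rw [hq]; gcongr
  have hq2 : q ≤ 2 := by
    rw [hq, div_le_iff₀ hβ0]; linarith
  have hqθ : θ + β * q = θ' := by rw [hq]; field_simp; ring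
  have hqβ : θ + β * ((β - θ) / β) = β := by field_simp; ring
  -- With `ν = ν₂/2`, `e^{-ν₂(t-1)} = e^{2ν}(e^{-νt})²`. One factor `e^{-νt}` is kept, the other is
  -- at most `(2/ν²) t^{-q}` for `t ≥ 1`, because `q ≤ 2`.
  obtain ⟨C₃, hC₃⟩ : ∃ C₃ : ℝ, C₃ = C₂ * C₁ * Real.exp (2 * ν) * (2 / ν ^ 2) := ⟨_, rfl⟩
  have hC₃0 : 0 < C₃ := by rw [hC₃]; positivity
  refine ⟨C₁ * Real.exp ν + C₃, by positivity, ?_⟩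
  intro ε A B hp hε0 hε d hd M hM hinit t ht n
  have hs := hshort ε₁ ε A B hp (hε.trans hε₀2) d hd M hM hinit
  rw [neg_div, ← hq]
  have hw := wt_pos θ' n
  have htq : 0 < t ^ (-q) := by positivity
  rcases le_or_gt t 1 with ht1 | ht1
  · have hX := one_le_scaledTime (β := β) ht.le n
    have h1 : scaledTime β t n ^ (-((β - θ) / β)) ≤ scaledTime β t n ^ (-q) :=
      Real.rpow_le_rpow_of_exponent_le hX (by linarith)
    have h2 := wt_mul_scaledTime_rpow_le (β := β) (θ := θ) hq0 ⟨ht, ht1⟩ n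
    rw [hqθ] at h2
    have h3 : 1 ≤ Real.exp ν * Real.exp (-ν * t) := by
      rw [← Real.exp_add]
      exact Real.one_le_exp (by nlinarith)
    have hwθ := wt_pos θ n
    calc |d t n| ≤ C₁ * M * (wt θ n * scaledTime β t n ^ (-((β - θ) / β))) :=
          hs t ⟨ht.le, ht1⟩ n
      _ ≤ C₁ * M * (t ^ (-q) * wt θ' n) := by
          exact mul_le_mul_of_nonneg_left ((mul_le_mul_of_nonneg_left h1 hwθ.le).trans h2)
            (by positivity)
      _ = C₁ * M * (t ^ (-q) * wt θ' n) * 1 := by ring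
      _ ≤ C₁ * M * (t ^ (-q) * wt θ' n) * (Real.exp ν * Real.exp (-ν * t)) := by gcongr
      _ = C₁ * Real.exp ν * M * (t ^ (-q) * Real.exp (-ν * t)) * wt θ' n := by ring
      _ ≤ _ := by gcongr; linarith
  · have h1 : ∀ n, |d 1 n| ≤ C₁ * M * wt β n := by
      intro n
      refine (hs 1 ⟨zero_le_one, le_rfl⟩ n).trans ?_
      have h2 := wt_mul_scaledTime_rpow_le (β := β) (θ := θ) (hq0.trans hqle)
        ⟨zero_lt_one, le_refl (1 : ℝ)⟩ n
      rw [hqβ, Real.one_rpow, one_mul] at h2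
      exact mul_le_mul_of_nonneg_left h2 (by positivity)
    have h2 := hlong c₀ δ ε A B hp hε0 hε d hd (C₁ * M) (by positivity) h1 t ht1.le n
    have h3 : t ^ q ≤ 2 / ν ^ 2 * Real.exp (ν * t) := by
      have h4 := Real.quadratic_le_exp_of_nonneg (x := ν * t) (by positivity)
      have h5 : t ^ q ≤ t ^ (2 : ℝ) := Real.rpow_le_rpow_of_exponent_le ht1.le hq2
      rw [Real.rpow_two] at h5
      have h6 : (ν * t) ^ 2 / 2 ≤ Real.exp (ν * t) := by
        have : 0 ≤ ν * t := by positivity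
        linarith
      calc t ^ q ≤ t ^ 2 := h5
        _ = 2 / ν ^ 2 * ((ν * t) ^ 2 / 2) := by field_simp
        _ ≤ _ := by gcongr
    have h4 : Real.exp (-ν * t) ≤ 2 / ν ^ 2 * t ^ (-q) := by
      have h5 : t ^ q * t ^ (-q) = 1 := by rw [← Real.rpow_add ht]; simp
      have h6 : Real.exp (ν * t) * Real.exp (-ν * t) = 1 := by rw [← Real.exp_add]; simp
      calc Real.exp (-ν * t) = t ^ q * (t ^ (-q) * Real.exp (-ν * t)) := by
            rw [← mul_assoc, h5, one_mul]
        _ ≤ 2 / ν ^ 2 * Real.exp (ν * t) * (t ^ (-q) * Real.exp (-ν * t)) := by gcongr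
        _ = 2 / ν ^ 2 * t ^ (-q) * (Real.exp (ν * t) * Real.exp (-ν * t)) := by ring
        _ = _ := by rw [h6, mul_one]
    have h5 : Real.exp (-ν₂ * (t - 1)) =
        Real.exp (2 * ν) * (Real.exp (-ν * t) * Real.exp (-ν * t)) := by
      rw [← Real.exp_add, ← Real.exp_add, hν]; ring_nf
    have hwβ := wt_anti hθ'β n
    have hwβ0 := wt_pos β n
    calc |d t n| ≤ C₂ * (C₁ * M) * Real.exp (-ν₂ * (t - 1)) * wt β n := h2
      _ ≤ C₂ * (C₁ * M) *
          (Real.exp (2 * ν) * ((2 / ν ^ 2 * t ^ (-q)) * Real.exp (-ν * t))) * wt θ' n := by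
          rw [h5]; gcongr
      _ = C₃ * M * (t ^ (-q) * Real.exp (-ν * t)) * wt θ' n := by rw [hC₃]; ring
      _ ≤ _ := by
          gcongr
          have : 0 < C₁ * Real.exp ν := by positivity
          linarith

/-- A sequence with summably decaying increments converges, at the rate of the increments. -/
theorem exists_tendsto_of_dplus_le {q E : ℝ} (hq : 0 < q) (hE : 0 ≤ E) {x : ℤ → ℝ}
    (hx : ∀ n, |Dplus x n| ≤ E * wt q n) :
    ∃ L, Tendsto x atTop (𝓝 L) ∧
      ∀ n, |x n - L| ≤ (min (1 / 2) (1 - (2 : ℝ) ^ (-q)))⁻¹ * E * wt q n := by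
  set κ := min (1 / 2) (1 - (2 : ℝ) ^ (-q)) with hκ
  have hκ0 : 0 < κ := by
    refine lt_min (by norm_num) ?_
    have : (2 : ℝ) ^ (-q) < 1 := Real.rpow_lt_one_of_one_lt_of_neg one_lt_two (by linarith)
    linarith
  set C := κ⁻¹ * E with hC
  have hstep : ∀ n, |x (n + 1) - x n| ≤ C * wt q n - C * wt q (n + 1) := by
    intro n
    have h1 := mul_le_mul_of_nonneg_left (wt_succ_add_le (θ := q) n)
      (by positivity : 0 ≤ κ⁻¹ * E)
    rw [← hκ] at h1
    have h2 : κ⁻¹ * E * (κ * wt q n) = E * wt q n := by field_simp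
    have h3 := hx n
    simp only [Dplus] at h3
    rw [hC]
    linarith
  -- Adding or subtracting a multiple of the weight makes the sequence monotone in either direction,
  -- which gives the limit and the two-sided bound together.
  have hanti : Antitone fun n => x n + C * wt q n :=
    antitone_int_of_succ_le fun n => by
      have := (abs_le.mp (hstep n)).2
      linarith
  have hmono : Monotone fun n => x n - C * wt q n :=
    monotone_int_of_le_succ fun n => by
      have := (abs_le.mp (hstep n)).1
      linarith
  have hCw : ∀ n, 0 ≤ C * wt q n := fun n => mul_nonneg (by positivity) (wt_pos _ _).le
  have hbdd : BddBelow (range fun n => x n + C * wt q n) := by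
    refine ⟨x 0 - C * wt q 0, ?_⟩
    rintro _ ⟨n, rfl⟩
    rcases le_total n 0 with hn | hn
    · have := hanti hn
      have := hCw 0
      simp only at *
      linarith
    · have := hmono hn
      have := hCw n
      simp only at *
      linarith
  have hlim := tendsto_atTop_ciInf hanti hbdd
  have hw0 : Tendsto (fun n => C * wt q n) atTop (𝓝 0) := by
    simpa using (tendsto_wt_atTop hq).const_mul C
  set L := ⨅ n, x n + C * wt q n with hL
  have hxL : Tendsto x atTop (𝓝 L) := by
    have := hlim.sub hw0
    simpa using this
  refine ⟨L, hxL, fun n => ?_⟩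
  have h1 : L ≤ x n + C * wt q n := ciInf_le hbdd n
  have h2 : x n - C * wt q n ≤ L := by
    have h3 : Tendsto (fun n => x n - C * wt q n) atTop (𝓝 L) := by
      simpa using hxL.sub hw0
    exact hmono.ge_of_tendsto h3 n
  exact abs_le.mpr ⟨by linarith, by linarith⟩

/-! ### Kernel coefficients in logarithmic coordinates -/

theorem exists_pos_le_of_eventually {G : ℝ → ℝ} (hG : Continuous G) (hpos : ∀ x, 0 < G x)
    {c₁ c₂ : ℝ} (hc₁ : 0 < c₁) (hc₂ : 0 < c₂) (hbot : ∀ᶠ x in atBot, c₁ ≤ G x)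
    (htop : ∀ᶠ x in atTop, c₂ ≤ G x) : ∃ c, 0 < c ∧ ∀ x, c ≤ G x := by
  obtain ⟨a, ha⟩ := eventually_atBot.mp hbot
  obtain ⟨b, hb⟩ := eventually_atTop.mp htop
  obtain ⟨c₃, hc₃, hle⟩ : ∃ c, 0 < c ∧ ∀ x ∈ Icc a b, c ≤ G x := by
    rcases (Icc a b).eq_empty_or_nonempty with h | h
    · exact ⟨1, one_pos, by simp [h]⟩
    · obtain ⟨x, hx, hmin⟩ := isCompact_Icc.exists_isMinOn h hG.continuousOn
      exact ⟨G x, hpos x, fun y hy => hmin hy⟩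
  refine ⟨min c₁ (min c₂ c₃), lt_min hc₁ (lt_min hc₂ hc₃), fun x => ?_⟩
  rcases le_or_gt x a with h1 | h1
  · exact (min_le_left _ _).trans (ha x h1)
  rcases le_or_gt b x with h2 | h2
  · exact (min_le_right _ _).trans ((min_le_left _ _).trans (hb x h2))
  · exact (min_le_right _ _).trans ((min_le_right _ _).trans (hle x ⟨h1.le, h2.le⟩))

theorem tendsto_two_rpow_atTop : Tendsto (fun x : ℝ => (2 : ℝ) ^ x) atTop atTop :=
  tendsto_rpow_atTop_of_base_gt_one 2 one_lt_two

theorem tendsto_two_rpow_atBot : Tendsto (fun x : ℝ => (2 : ℝ) ^ x) atBot (𝓝[>] 0) :=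
  tendsto_nhdsWithin_iff.mpr ⟨tendsto_rpow_atBot_of_base_gt_one 2 one_lt_two,
    Eventually.of_forall fun x => Real.rpow_pos_of_pos two_pos x⟩

/-- The logarithm of a kernel coefficient in logarithmic coordinates. -/
noncomputable def logScale (f : ℝ → ℝ) (x : ℝ) : ℝ := Real.log (f (2 ^ x))

theorem exp_logScale {f : ℝ → ℝ} (hf : ∀ ξ, 0 < ξ → 0 < f ξ) (x : ℝ) :
    Real.exp (logScale f x) = f (2 ^ x) := Real.exp_log (hf _ (by positivity))

section LogScale

variable {f : ℝ → ℝ} {ρ r f₀ f₁ : ℝ}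

theorem tendsto_of_isBigO_sub_rpow (hr : 0 < r)
    (h : (fun ξ => f ξ - f₀) =O[𝓝[>] 0] fun ξ => ξ ^ r) : Tendsto f (𝓝[>] 0) (𝓝 f₀) := by
  have h1 : Tendsto (fun ξ : ℝ => ξ ^ r) (𝓝[>] 0) (𝓝 0) := by
    have := (Real.continuousAt_rpow_const 0 r (Or.inr hr.le)).tendsto
    rw [Real.zero_rpow hr.ne'] at this
    exact this.mono_left nhdsWithin_le_nhds
  have h2 := h.trans_tendsto h1
  simpa using h2.add_const f₀

theorem tendsto_logScale_atBot (hf₀ : 0 < f₀) (h : Tendsto f (𝓝[>] 0) (𝓝 f₀)) :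
    Tendsto (logScale f) atBot (𝓝 (Real.log f₀)) :=
  (h.comp tendsto_two_rpow_atBot).log hf₀.ne'

theorem continuous_comp_two_rpow (hf : ContinuousOn f (Ioi 0)) :
    Continuous fun x : ℝ => f (2 ^ x) :=
  hf.comp_continuous (Real.continuous_const_rpow two_ne_zero)
    fun x => Real.rpow_pos_of_pos two_pos x

/-- A positive coefficient with power-like growth and matching derivative bounds is Lipschitz in
logarithmic coordinates. -/
theorem exists_lipschitz_logScale (hf : ContDiffOn ℝ 2 f (Ioi 0)) (hpos : ∀ ξ, 0 < ξ → 0 < f ξ)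
    (htop : f ~[atTop] fun ξ => ξ ^ ρ) (hf₀ : 0 < f₀) (hzero : Tendsto f (𝓝[>] 0) (𝓝 f₀))
    (hρ : 0 < ρ) (hr : 1 < r) (hf₁ : 0 < f₁)
    (hlarge : ∀ ξ, 1 ≤ ξ → |deriv f ξ| ≤ f₁ * ξ ^ (ρ - 1))
    (hsmall : ∀ ξ, 0 < ξ → ξ ≤ 1 → |deriv f ξ| ≤ f₁ * ξ ^ (r - 1)) :
    ∃ L, 0 < L ∧ ∀ x y, |logScale f x - logScale f y| ≤ L * |x - y| := by
  have hcont : Continuous fun x : ℝ => f (2 ^ x) := continuous_comp_two_rpow hf.continuousOn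
  have hpow : ∀ x : ℝ, (0 : ℝ) < 2 ^ x := fun x => Real.rpow_pos_of_pos two_pos x
  -- A lower bound of `f` by `1 + ξ^ρ`, matching the bound of `ξ|f'(ξ)|` by the same function; their
  -- quotient controls the logarithmic derivative.
  obtain ⟨c, hc, hle⟩ : ∃ c, 0 < c ∧ ∀ x : ℝ, c ≤ f (2 ^ x) / (1 + (2 ^ x) ^ ρ) := by
    refine exists_pos_le_of_eventually (c₁ := f₀ / 4) (c₂ := 1 / 4) ?_ (fun x => ?_)
      (by positivity) (by norm_num) ?_ ?_
    · refine hcont.div (by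
        have : Continuous fun x : ℝ => ((2 : ℝ) ^ x) ^ ρ :=
          (Real.continuous_const_rpow two_ne_zero).rpow_const fun x => Or.inl (hpow x).ne'
        fun_prop) fun x => ?_
      have := Real.rpow_pos_of_pos (hpow x) ρ
      positivity
    · have := Real.rpow_pos_of_pos (hpow x) ρ
      have := hpos _ (hpow x)
      positivity
    · have h1 := tendsto_two_rpow_atBot.eventually
        (hzero.eventually_const_le (by linarith : f₀ / 2 < f₀))
      filter_upwards [h1, eventually_le_atBot 0] with x hx hx0
      have h2 : ((2 : ℝ) ^ x) ^ ρ ≤ 1 := Real.rpow_le_one (hpow x).le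
        (Real.rpow_le_one_of_one_le_of_nonpos one_le_two hx0) hρ.le
      have h3 := Real.rpow_pos_of_pos (hpow x) ρ
      rw [le_div_iff₀ (by positivity)]
      nlinarith
    · have h1 : ∀ᶠ ξ : ℝ in atTop, 1 / 2 * ξ ^ ρ ≤ f ξ := by
        obtain ⟨φ, hφ, hfφ⟩ := htop.exists_eq_mul
        filter_upwards [hφ.eventually_const_le (by norm_num : (1 / 2 : ℝ) < 1), hfφ,
          eventually_gt_atTop 0] with ξ h1 h2 h3
        rw [h2]
        exact mul_le_mul_of_nonneg_right h1 (Real.rpow_pos_of_pos h3 ρ).le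
      filter_upwards [tendsto_two_rpow_atTop.eventually h1, eventually_ge_atTop 0] with x hx hx0
      have h2 : 1 ≤ ((2 : ℝ) ^ x) ^ ρ :=
        Real.one_le_rpow (Real.one_le_rpow one_le_two hx0) hρ.le
      rw [le_div_iff₀ (by positivity)]
      linarith
  have hderiv : ∀ x : ℝ, HasDerivAt (logScale f)
      (deriv f (2 ^ x) * (Real.log 2 * 2 ^ x) / f (2 ^ x)) x := by
    intro x
    have hd : HasDerivAt f (deriv f (2 ^ x)) (2 ^ x) :=
      ((hf.contDiffAt (Ioi_mem_nhds (hpow x))).differentiableAt (by norm_num)).hasDerivAt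
    have h2 : HasDerivAt (fun x : ℝ => (2 : ℝ) ^ x) (Real.log 2 * 2 ^ x) x := by
      simpa using (hasDerivAt_id x).const_rpow two_pos
    exact (HasDerivAt.comp (h₂ := f) x hd h2).log (hpos _ (hpow x)).ne'
  have hbound : ∀ x : ℝ, ‖deriv f (2 ^ x) * (Real.log 2 * 2 ^ x) / f (2 ^ x)‖ ≤ f₁ / c := by
    intro x
    have hlog : 0 < Real.log 2 := Real.log_pos one_lt_two
    have hlog1 : Real.log 2 ≤ 1 := by
      have := Real.log_two_lt_d9
      linarith
    have hfx := hpos _ (hpow x)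
    have hρx := Real.rpow_pos_of_pos (hpow x) ρ
    have h1 : |deriv f (2 ^ x)| * 2 ^ x ≤ f₁ * (1 + (2 ^ x) ^ ρ) := by
      rcases le_total 0 x with hx | hx
      · have h2 := hlarge _ (Real.one_le_rpow one_le_two hx)
        calc |deriv f (2 ^ x)| * 2 ^ x ≤ f₁ * (2 ^ x) ^ (ρ - 1) * 2 ^ x := by
              have := hpow x
              gcongr
          _ = f₁ * (2 ^ x) ^ ρ := by
              rw [Real.rpow_sub_one (hpow x).ne', mul_assoc, div_mul_cancel₀ _ (hpow x).ne']
          _ ≤ _ := by nlinarith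
      · have h01 := Real.rpow_le_one_of_one_le_of_nonpos one_le_two hx
        have h2 := hsmall _ (hpow x) h01
        have h3 : ((2 : ℝ) ^ x) ^ (r - 1) ≤ 1 :=
          Real.rpow_le_one (hpow x).le h01 (by linarith)
        calc |deriv f (2 ^ x)| * 2 ^ x ≤ f₁ * (2 ^ x) ^ (r - 1) * 2 ^ x := by
              have := hpow x
              gcongr
          _ ≤ f₁ * 1 * 1 := by gcongr
          _ ≤ _ := by nlinarith
    have h2 := hle x
    rw [le_div_iff₀ (by positivity)] at h2
    rw [norm_div, norm_mul, Real.norm_eq_abs, Real.norm_eq_abs, Real.norm_eq_abs,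
      abs_of_pos hfx, abs_of_pos (mul_pos hlog (hpow x)), div_le_div_iff₀ hfx hc]
    calc |deriv f (2 ^ x)| * (Real.log 2 * 2 ^ x) * c
        = Real.log 2 * (|deriv f (2 ^ x)| * 2 ^ x) * c := by ring
      _ ≤ 1 * (f₁ * (1 + (2 ^ x) ^ ρ)) * c := by
          have := hpow x
          gcongr
      _ = f₁ * (c * (1 + (2 ^ x) ^ ρ)) := by ring
      _ ≤ _ := by gcongr
  refine ⟨f₁ / c, by positivity, fun x y => ?_⟩
  have := convex_univ.norm_image_sub_le_of_norm_hasDerivWithin_le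
    (fun x _ => (hderiv x).hasDerivWithinAt) (fun x _ => hbound x) (mem_univ y) (mem_univ x)
  simpa [Real.norm_eq_abs] using this

/-- Power-law asymptotics with a remainder, in logarithmic coordinates. -/
theorem exists_logScale_remainder {β' : ℝ} (hf : ContinuousOn f (Ioi 0))
    (hpos : ∀ ξ, 0 < ξ → 0 < f ξ) (hβ' : β' < ρ)
    (h : (fun ξ => f ξ - ξ ^ ρ) =O[atTop] fun ξ => ξ ^ β') :
    ∃ C, 0 < C ∧ ∀ x : ℝ, -1 ≤ x →
      |logScale f x - ρ * x * Real.log 2| ≤ C * 2 ^ (-((ρ - β') * x)) := by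
  have hpow : ∀ x : ℝ, (0 : ℝ) < 2 ^ x := fun x => Real.rpow_pos_of_pos two_pos x
  obtain ⟨C, hC, hO⟩ := h.exists_pos
  have hev : ∀ᶠ x : ℝ in atTop,
      |logScale f x - ρ * x * Real.log 2| ≤ 2 * C * 2 ^ (-((ρ - β') * x)) := by
    have hlim : Tendsto (fun x : ℝ => C * 2 ^ (-((ρ - β') * x))) atTop (𝓝 0) := by
      have h1 : Tendsto (fun x : ℝ => (ρ - β') * x) atTop atTop :=
        tendsto_id.const_mul_atTop (by linarith)
      simpa using ((tendsto_rpow_atBot_of_base_gt_one 2 one_lt_two).comp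
        (tendsto_neg_atTop_atBot.comp h1)).const_mul C
    filter_upwards [tendsto_two_rpow_atTop.eventually hO.bound,
      hlim.eventually_le_const (by norm_num : (0 : ℝ) < 1 / 2)] with x hx hsm
    have hρx := hpow (ρ * x)
    have e1 : ((2 : ℝ) ^ x) ^ ρ = 2 ^ (ρ * x) := by
      rw [← Real.rpow_mul two_pos.le]; ring_nf
    have e2 : ((2 : ℝ) ^ x) ^ β' = 2 ^ (ρ * x) * 2 ^ (-((ρ - β') * x)) := by
      rw [← Real.rpow_mul two_pos.le, ← Real.rpow_add two_pos]; ring_nf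
    rw [Real.norm_eq_abs, Real.norm_eq_abs, abs_of_pos (Real.rpow_pos_of_pos (hpow x) _),
      e1, e2] at hx
    set u := f (2 ^ x) / 2 ^ (ρ * x) - 1 with hu
    have hfu : f (2 ^ x) = 2 ^ (ρ * x) * (1 + u) := by
      rw [hu]; field_simp; ring
    have hu1 : |u| ≤ C * 2 ^ (-((ρ - β') * x)) := by
      rw [hfu, show 2 ^ (ρ * x) * (1 + u) - 2 ^ (ρ * x) = 2 ^ (ρ * x) * u by ring, abs_mul,
        abs_of_pos hρx] at hx
      refine le_of_mul_le_mul_left ?_ hρx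
      linarith
    have hu2 : |u| ≤ 1 / 2 := hu1.trans hsm
    have hu3 := abs_le.mp hu2
    have hlog : logScale f x - ρ * x * Real.log 2 = Real.log (1 + u) := by
      unfold logScale
      rw [hfu, Real.log_mul hρx.ne' (by linarith), Real.log_rpow two_pos]
      ring
    rw [hlog]
    have h2 : |Real.log (1 + u)| ≤ 2 * |u| := by
      have hup : Real.log (1 + u) ≤ u := by
        have := Real.log_le_sub_one_of_pos (by linarith : 0 < 1 + u)
        linarith
      have hlow : 1 - (1 + u)⁻¹ ≤ Real.log (1 + u) :=
        Real.one_sub_inv_le_log_of_pos (by linarith)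
      have hinv : -(2 * |u|) ≤ 1 - (1 + u)⁻¹ := by
        have h3 : 1 - (1 + u)⁻¹ = u / (1 + u) := by
          have : 1 + u ≠ 0 := by linarith
          field_simp; ring
        rw [h3, le_div_iff₀ (by linarith)]
        rcases abs_cases u with ⟨h4, _⟩ | ⟨h4, _⟩ <;> rw [h4] <;> nlinarith
      rw [abs_le]
      constructor
      · linarith
      · linarith [le_abs_self u, abs_nonneg u]
    linarith
  -- The remaining `x ∈ [-1, X]` are covered by compactness. Starting at `-1` admits the arguments
  -- `n + p_n` with `n ≥ 0` and `|p_n| ≤ 1`.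
  obtain ⟨X, hX⟩ := eventually_atTop.mp hev
  have hcont : Continuous fun x => |logScale f x - ρ * x * Real.log 2| := by
    have : Continuous (logScale f) :=
      (continuous_comp_two_rpow hf).log fun x => (hpos _ (hpow x)).ne'
    fun_prop
  obtain ⟨M, hM⟩ := (isCompact_Icc (a := (-1 : ℝ)) (b := X)).bddAbove_image hcont.continuousOn
  refine ⟨2 * C + |M| * 2 ^ ((ρ - β') * |X|), by positivity, fun x hx => ?_⟩
  have hp := hpow (-((ρ - β') * x))
  rcases le_or_gt X x with hXx | hXx
  · refine (hX x hXx).trans (mul_le_mul_of_nonneg_right ?_ hp.le)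
    have := mul_nonneg (abs_nonneg M) (hpow ((ρ - β') * |X|)).le
    linarith
  · have h1 : |logScale f x - ρ * x * Real.log 2| ≤ |M| :=
      (hM ⟨x, ⟨hx, hXx.le⟩, rfl⟩).trans (le_abs_self M)
    have h2 : 1 ≤ (2 : ℝ) ^ ((ρ - β') * |X|) * 2 ^ (-((ρ - β') * x)) := by
      rw [← Real.rpow_add two_pos]
      refine Real.one_le_rpow one_le_two ?_
      have := le_abs_self X
      nlinarith
    have h3 := mul_le_mul_of_nonneg_left h2 (abs_nonneg M)
    have h4 : 0 < 2 * C * 2 ^ (-((ρ - β') * x)) := by positivity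
    linarith

end LogScale

/-! ### The rates of the linearized problem -/

namespace Kernels

variable (K : Kernels)

theorem exists_lipschitz_logScale_k :
    ∃ L, 0 < L ∧ ∀ x y, |logScale K.k x - logScale K.k y| ≤ L * |x - y| :=
  exists_lipschitz_logScale (ρ := K.α + 1) K.k_contDiffOn K.k_pos K.k_atTop K.k₀_pos
    (tendsto_of_isBigO_sub_rpow (by linarith [K.αbar_gt]) K.k_zero) (by linarith [K.α_mem.1])
    K.αbar_gt K.k₁_pos (by simpa using K.k_deriv_large) K.k_deriv_small

theorem γ_isEquivalent : K.γ ~[atTop] fun ξ => ξ ^ K.β := by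
  refine K.γ_atTop.trans_isLittleO (isLittleO_of_tendsto' ?_ ?_)
  · filter_upwards [eventually_gt_atTop 0] with ξ hξ h
    exact absurd h (Real.rpow_pos_of_pos hξ _).ne'
  · refine (tendsto_rpow_neg_atTop (sub_pos.mpr K.βtilde_lt)).congr' ?_
    filter_upwards [eventually_gt_atTop 0] with ξ hξ
    rw [neg_sub, Real.rpow_sub hξ]

theorem exists_lipschitz_logScale_γ :
    ∃ L, 0 < L ∧ ∀ x y, |logScale K.γ x - logScale K.γ y| ≤ L * |x - y| :=
  exists_lipschitz_logScale K.γ_contDiffOn K.γ_pos K.γ_isEquivalent K.γ₀_pos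
    (tendsto_of_isBigO_sub_rpow (by linarith [K.βbar_gt]) K.γ_zero) (by linarith [K.β_mem.1])
    K.βbar_gt K.γ₁_pos K.γ_deriv_large K.γ_deriv_small

/-- The logarithm of `θ_n(p)`. -/
noncomputable def logRatio (p : ℤ → ℝ) (n : ℤ) : ℝ :=
  Real.log 2 * (p n - p (n + 1)) +
    (logScale K.k ((n : ℝ) + 1 + p (n + 1)) - logScale K.k (n + p n)) +
    (logScale K.γ ((n : ℝ) + 1 + p (n + 1)) - logScale K.γ ((n : ℝ) + 2 + p (n + 2)))

theorem log_zeta (p : ℤ → ℝ) (n : ℤ) : Real.log (K.zeta p n) = Real.log (Real.log 2) -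
    ((n : ℝ) + p n) * Real.log 2 + logScale K.k (n + p n) -
      logScale K.γ ((n : ℝ) + 1 + p (n + 1)) := by
  have hp : ∀ m, 0 < peak p m := fun m => Real.rpow_pos_of_pos two_pos _
  have hl : 0 < Real.log 2 := Real.log_pos one_lt_two
  have hk := K.k_pos _ (hp n)
  have hγ := K.γ_pos _ (hp (n + 1))
  have hpn := hp n
  unfold zeta
  rw [Real.log_mul (by positivity) (by positivity), Real.log_div hl.ne' hpn.ne',
    Real.log_div hk.ne' hγ.ne']
  have h1 : Real.log (peak p n) = ((n : ℝ) + p n) * Real.log 2 := Real.log_rpow two_pos _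
  rw [h1]
  unfold logScale peak
  push_cast
  ring

theorem zeta_pos (p : ℤ → ℝ) (n : ℤ) : 0 < K.zeta p n := by
  have hp : ∀ m, 0 < peak p m := fun m => Real.rpow_pos_of_pos two_pos _
  have hl : 0 < Real.log 2 := Real.log_pos one_lt_two
  have hk := K.k_pos _ (hp n)
  have hγ := K.γ_pos _ (hp (n + 1))
  have hpn := hp n
  unfold zeta
  positivity

theorem log_ratio (p : ℤ → ℝ) (n : ℤ) : Real.log (K.ratio p n) = K.logRatio p n := by
  have h1 := K.zeta_pos p n
  have h2 := K.zeta_pos p (n + 1)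
  unfold ratio
  rw [Real.log_div (by positivity) h1.ne', Real.log_mul two_ne_zero h2.ne', log_zeta, log_zeta]
  unfold logRatio
  have e : n + 1 + 1 = n + 2 := by ring
  rw [e]
  push_cast
  rw [show (n : ℝ) + 1 + 1 = n + 2 by ring]
  ring

/-- `-ln μ̄_n(0, p)`. -/
noncomputable def meanLogRatio (p : ℤ → ℝ) (n : ℤ) : ℝ :=
  ∑' i : ℕ, (1 / 2 : ℝ) ^ (i + 1) * K.logRatio p (n + i)

/-- The factor `2^n` turns the series into an average of the logarithmic ratios to the right of `n`
with weights `2^{-(i+1)}` of total mass one, so bounds uniform in the index pass to it unchanged. -/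
theorem mubar_eq (A : ℝ) (p : ℤ → ℝ) (n : ℤ) :
    K.mubar A p n = Real.exp (-A * (2 : ℝ) ^ n - K.meanLogRatio p n) := by
  have h : (2 : ℝ) ^ n *
      ∑' i : ℕ, (2 : ℝ) ^ (-(n + 1 + (i : ℤ))) * Real.log (K.ratio p (n + (i : ℤ))) =
      K.meanLogRatio p n := by
    unfold meanLogRatio
    rw [← tsum_mul_left]
    refine tsum_congr fun i => ?_
    rw [log_ratio, ← mul_assoc, ← zpow_add₀ two_ne_zero,
      show n + -(n + 1 + (i : ℤ)) = -((i + 1 : ℕ) : ℤ) by push_cast; ring, zpow_neg, zpow_natCast,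
      one_div, inv_pow]
  unfold mubar
  rw [neg_mul ((2 : ℝ) ^ n), h, ← Real.exp_add]
  ring_nf

/-- The rate of the jumps `n → n - 1`. -/
noncomputable def downRate (p : ℤ → ℝ) (n : ℤ) : ℝ := Real.exp (logScale K.γ (n + p n)) / 4

/-- The rate of the jumps `n → n + 1`. -/
noncomputable def upRate (A : ℝ) (p : ℤ → ℝ) (n : ℤ) : ℝ :=
  2 * Real.exp (-A * (2 : ℝ) ^ n - K.meanLogRatio p n + logScale K.γ ((n : ℝ) + 1 + p (n + 1)))

/-- The denominator `γ(2^{n+p_n})` of `σ_n` cancels against the prefactor, leaving the up rate `2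
μ̄_n γ(2^{n+1+p_{n+1}})`. -/
theorem linOp_eq (A : ℝ) (p y : ℤ → ℝ) (n : ℤ) : K.linOp A p y n =
    K.downRate p n * (y (n - 1) - y n) + K.upRate A p n * (y (n + 1) - y n) := by
  have hp : ∀ m, 0 < peak p m := fun m => Real.rpow_pos_of_pos two_pos _
  have e1 : Real.exp (logScale K.γ (n + p n)) = K.γ (peak p n) :=
    exp_logScale K.γ_pos _
  have e2 : Real.exp (logScale K.γ ((n : ℝ) + 1 + p (n + 1))) = K.γ (peak p (n + 1)) := by
    rw [exp_logScale K.γ_pos]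
    unfold peak
    push_cast
    rfl
  have hγ := (K.γ_pos _ (hp n)).ne'
  unfold linOp sigma downRate upRate
  rw [Real.exp_add, ← K.mubar_eq, e1, e2]
  field_simp
  ring

/-- Joint Lipschitz bound for the two coefficients in logarithmic coordinates. -/
structure IsLogLipschitz (L : ℝ) : Prop where
  pos : 0 < L
  k_le : ∀ x y, |logScale K.k x - logScale K.k y| ≤ L * |x - y|
  γ_le : ∀ x y, |logScale K.γ x - logScale K.γ y| ≤ L * |x - y|

theorem exists_isLogLipschitz : ∃ L, K.IsLogLipschitz L := by
  obtain ⟨L₁, hL₁, h₁⟩ := K.exists_lipschitz_logScale_k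
  obtain ⟨L₂, hL₂, h₂⟩ := K.exists_lipschitz_logScale_γ
  refine ⟨L₁ + L₂, by positivity, fun x y => (h₁ x y).trans ?_, fun x y => (h₂ x y).trans ?_⟩
  · gcongr; linarith
  · gcongr; linarith

theorem log_two_bounds : 0 < Real.log 2 ∧ Real.log 2 ≤ 1 :=
  ⟨Real.log_pos one_lt_two, by linarith [Real.log_two_lt_d9]⟩

theorem summable_half_pow : Summable fun i : ℕ => (1 / 2 : ℝ) ^ (i + 1) :=
  (summable_nat_add_iff 1).mpr (summable_geometric_of_lt_one (by norm_num) (by norm_num))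

theorem tsum_half_pow : ∑' i : ℕ, (1 / 2 : ℝ) ^ (i + 1) = 1 := by
  simp only [pow_succ]
  rw [tsum_mul_right, tsum_geometric_of_lt_one (by norm_num) (by norm_num)]
  norm_num

section Estimates

variable {K} {L : ℝ} (hL : K.IsLogLipschitz L)
include hL

theorem IsLogLipschitz.abs_logRatio_sub_le {p q : ℤ → ℝ} {η : ℝ} (hpq : ∀ n, |p n - q n| ≤ η)
    (n : ℤ) : |K.logRatio p n - K.logRatio q n| ≤ (2 + 4 * L) * η := by
  obtain ⟨hlog, hlog1⟩ := log_two_bounds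
  have hb : ∀ f : ℝ → ℝ, (∀ x y, |logScale f x - logScale f y| ≤ L * |x - y|) →
      ∀ (c : ℝ) (m : ℤ), |logScale f (c + p m) - logScale f (c + q m)| ≤ L * η := by
    intro f hf c m
    refine (hf _ _).trans ?_
    rw [add_sub_add_left_eq_sub]
    exact mul_le_mul_of_nonneg_left (hpq m) hL.pos.le
  have h1 := abs_le.mp (hb K.k hL.k_le ((n : ℝ) + 1) (n + 1))
  have h2 := abs_le.mp (hb K.k hL.k_le n n)
  have h3 := abs_le.mp (hb K.γ hL.γ_le ((n : ℝ) + 1) (n + 1))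
  have h4 := abs_le.mp (hb K.γ hL.γ_le ((n : ℝ) + 2) (n + 2))
  have h5 : |Real.log 2 * ((p n - q n) - (p (n + 1) - q (n + 1)))| ≤ 2 * η := by
    rw [abs_mul, abs_of_pos hlog]
    have h6 := (abs_sub (p n - q n) (p (n + 1) - q (n + 1))).trans
      (add_le_add (hpq n) (hpq (n + 1)))
    calc _ ≤ 1 * (η + η) := mul_le_mul hlog1 h6 (abs_nonneg _) zero_le_one
      _ = _ := by ring
  obtain ⟨h5a, h5b⟩ := abs_le.mp h5
  unfold logRatio
  refine abs_le.mpr ⟨?_, ?_⟩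
  · linarith only [h1.1, h2.2, h3.1, h4.2, h5a]
  · linarith only [h1.2, h2.1, h3.2, h4.1, h5b]

theorem IsLogLipschitz.abs_logRatio_zero_le (n : ℤ) : |K.logRatio 0 n| ≤ 2 * L := by
  have h1 := hL.k_le ((n : ℝ) + 1 + 0) (n + 0)
  have h2 := hL.γ_le ((n : ℝ) + 1 + 0) ((n : ℝ) + 2 + 0)
  rw [show (n : ℝ) + 1 + 0 - (n + 0) = 1 by ring, abs_one] at h1
  rw [show (n : ℝ) + 1 + 0 - ((n : ℝ) + 2 + 0) = -1 by ring, abs_neg, abs_one] at h2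
  unfold logRatio
  simp only [Pi.zero_apply]
  rw [sub_self, mul_zero, zero_add]
  exact (abs_add_le _ _).trans (by linarith only [h1, h2])

theorem IsLogLipschitz.abs_logRatio_le {p : ℤ → ℝ} (hp : ∀ n, |p n| ≤ 1) (n : ℤ) :
    |K.logRatio p n| ≤ 2 + 6 * L := by
  have h1 := hL.abs_logRatio_sub_le (p := p) (q := 0) (η := 1) (by simpa using hp) n
  have h2 := hL.abs_logRatio_zero_le n
  calc |K.logRatio p n| = |(K.logRatio p n - K.logRatio 0 n) + K.logRatio 0 n| := by ring_nf
    _ ≤ _ := (abs_add_le _ _).trans (by linarith only [h1, h2])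

theorem IsLogLipschitz.norm_term_le {p : ℤ → ℝ} (hp : ∀ n, |p n| ≤ 1) (n : ℤ) (i : ℕ) :
    ‖(1 / 2 : ℝ) ^ (i + 1) * K.logRatio p (n + i)‖ ≤ (1 / 2 : ℝ) ^ (i + 1) * (2 + 6 * L) := by
  rw [norm_mul, Real.norm_of_nonneg (by positivity), Real.norm_eq_abs]
  exact mul_le_mul_of_nonneg_left (hL.abs_logRatio_le hp _) (by positivity)

theorem IsLogLipschitz.summable_term {p : ℤ → ℝ} (hp : ∀ n, |p n| ≤ 1) (n : ℤ) :
    Summable fun i : ℕ => (1 / 2 : ℝ) ^ (i + 1) * K.logRatio p (n + i) :=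
  Summable.of_norm_bounded (summable_half_pow.mul_right _) (hL.norm_term_le hp n)

theorem IsLogLipschitz.abs_meanLogRatio_le {p : ℤ → ℝ} (hp : ∀ n, |p n| ≤ 1) (n : ℤ) :
    |K.meanLogRatio p n| ≤ 2 + 6 * L := by
  have h := tsum_of_norm_bounded (summable_half_pow.mul_right (2 + 6 * L)).hasSum
    (hL.norm_term_le hp n)
  rwa [tsum_mul_right, tsum_half_pow, one_mul] at h

theorem IsLogLipschitz.abs_meanLogRatio_sub_le {p : ℤ → ℝ} {η : ℝ} (hη : η ≤ 1)
    (hp : ∀ n, |p n| ≤ η) (n : ℤ) :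
    |K.meanLogRatio p n - K.meanLogRatio 0 n| ≤ (2 + 4 * L) * η := by
  unfold meanLogRatio
  rw [← Summable.tsum_sub (hL.summable_term (fun n => (hp n).trans hη) n)
    (hL.summable_term (fun n => by simp) n)]
  have h := tsum_of_norm_bounded (summable_half_pow.mul_right ((2 + 4 * L) * η)).hasSum
    (f := fun i : ℕ => (1 / 2 : ℝ) ^ (i + 1) * K.logRatio p (n + i) -
      (1 / 2 : ℝ) ^ (i + 1) * K.logRatio 0 (n + i)) (fun i => by
    rw [← mul_sub, norm_mul, Real.norm_of_nonneg (by positivity), Real.norm_eq_abs]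
    exact mul_le_mul_of_nonneg_left
      (hL.abs_logRatio_sub_le (by simpa using hp) _) (by positivity))
  rwa [tsum_mul_right, tsum_half_pow, one_mul] at h

theorem IsLogLipschitz.continuous_logScale_γ : Continuous (logScale K.γ) :=
  (LipschitzWith.of_dist_le_mul (K := ⟨L, hL.pos.le⟩) fun x y => hL.γ_le x y).continuous

theorem IsLogLipschitz.continuous_logScale_k : Continuous (logScale K.k) :=
  (LipschitzWith.of_dist_le_mul (K := ⟨L, hL.pos.le⟩) fun x y => hL.k_le x y).continuous

theorem IsLogLipschitz.continuousOn_meanLogRatio {p : ℝ → ℤ → ℝ}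
    (hc : ∀ n, ContinuousOn (fun t => p t n) (Ioi 0)) (hp : ∀ t, 0 < t → ∀ n, |p t n| ≤ 1)
    (n : ℤ) : ContinuousOn (fun t => K.meanLogRatio (p t) n) (Ioi 0) := by
  unfold meanLogRatio
  refine continuousOn_tsum (fun i => ?_) (summable_half_pow.mul_right (2 + 6 * L))
    fun i t ht => hL.norm_term_le (hp t ht) n i
  refine continuousOn_const.mul ?_
  unfold logRatio
  have h1 : ∀ (c : ℝ) (m : ℤ), ContinuousOn (fun t => logScale K.γ (c + p t m)) (Ioi 0) :=
    fun c m => hL.continuous_logScale_γ.comp_continuousOn (continuousOn_const.add (hc m))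
  have h2 : ∀ (c : ℝ) (m : ℤ), ContinuousOn (fun t => logScale K.k (c + p t m)) (Ioi 0) :=
    fun c m => hL.continuous_logScale_k.comp_continuousOn (continuousOn_const.add (hc m))
  exact ((continuousOn_const.mul ((hc _).sub (hc _))).add ((h2 _ _).sub (h2 _ _))).add
    ((h1 _ _).sub (h1 _ _))

/-- At `-∞` both coefficients tend to positive constants, so each logarithmic ratio at zero shift
tends to zero, and the average follows by dominated convergence. -/
theorem IsLogLipschitz.tendsto_meanLogRatio_zero :
    Tendsto (K.meanLogRatio 0) atBot (𝓝 0) := by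
  have hk := tendsto_logScale_atBot K.k₀_pos
    (tendsto_of_isBigO_sub_rpow (by linarith [K.αbar_gt]) K.k_zero)
  have hγ := tendsto_logScale_atBot K.γ₀_pos
    (tendsto_of_isBigO_sub_rpow (by linarith [K.βbar_gt]) K.γ_zero)
  have hcast : ∀ c : ℝ, Tendsto (fun n : ℤ => (n : ℝ) + c) atBot atBot := fun c =>
    tendsto_atBot_add_const_right _ c (tendsto_intCast_atBot_iff.mpr tendsto_id)
  have hlr : Tendsto (K.logRatio 0) atBot (𝓝 0) := by
    have h := ((hk.comp (hcast 1)).sub (hk.comp (hcast 0))).add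
      ((hγ.comp (hcast 1)).sub (hγ.comp (hcast 2)))
    rw [sub_self, sub_self, add_zero] at h
    refine h.congr fun n => ?_
    simp [logRatio, Function.comp]
  have hlim := tendsto_tsum_of_dominated_convergence (𝓕 := (atBot : Filter ℤ))
    (f := fun n (i : ℕ) => (1 / 2 : ℝ) ^ (i + 1) * K.logRatio 0 (n + i)) (g := fun _ => 0)
    (summable_half_pow.mul_right (2 + 6 * L)) (fun i => ?_)
    (Eventually.of_forall fun n i => hL.norm_term_le (fun n => by simp) n i)
  · rw [tsum_zero] at hlim
    exact hlim
  · have h := (hlr.comp (tendsto_atBot_add_const_right _ (i : ℤ) tendsto_id)).const_mul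
      ((1 / 2 : ℝ) ^ (i + 1))
    rwa [mul_zero] at h

end Estimates

end Kernels

/-! ### From regular shifts to perturbed rates -/

/-- The properties of the shifts on which the estimates for the rates depend. -/
structure IsRegularShift (β θ₁ η : ℝ) (p : ℝ → ℤ → ℝ) : Prop where
  cont : ∀ n, ContinuousOn (fun t => p t n) (Ioi 0)
  le : ∀ t, 0 < t → ∀ n, |p t n| ≤ η
  diff_le : ∀ t, 0 < t → ∀ n : ℤ, 0 ≤ n →
    |p t (n + 1) - p t n| ≤ η * (t ^ (-θ₁ / β) * (2 : ℝ) ^ (-(θ₁ * (n : ℝ))))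

theorem abs_exp_sub_exp_le {u v : ℝ} (hv : v ≤ 1) (h : |u - v| ≤ 1) :
    |Real.exp u - Real.exp v| ≤ 6 * |u - v| := by
  have h1 : Real.exp u - Real.exp v = Real.exp v * (Real.exp (u - v) - 1) := by
    rw [Real.exp_sub]; field_simp
  have h2 : Real.exp v ≤ 3 := (Real.exp_le_exp.mpr hv).trans (by linarith [Real.exp_one_lt_d9])
  rw [h1, abs_mul, abs_of_pos (Real.exp_pos v)]
  calc _ ≤ 3 * (2 * |u - v|) :=
        mul_le_mul h2 (Real.abs_exp_sub_one_le h) (abs_nonneg _) (by norm_num)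
    _ = _ := by ring

/-- The increments of a regular shift are controlled by the self-similar time. -/
theorem IsRegularShift.abs_diff_le_scaled {β θ₁ η ρ t : ℝ} {p : ℝ → ℤ → ℝ}
    (hp : IsRegularShift β θ₁ η p) (hη : η ≤ 1) (hβ : 0 < β) (hρ : 0 < ρ) (hρθ : ρ ≤ θ₁)
    (hθβ : θ₁ ≤ β) (ht : 0 < t) {n : ℤ} (hn : 0 ≤ n) :
    |p t (n + 1) - p t n| ≤ 4 * (1 + 2 ^ (β * (n : ℝ)) * t) ^ (-(ρ / β)) := by
  have hδ1 : ρ / β ≤ 1 := (div_le_one hβ).mpr (hρθ.trans hθβ)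
  have hδ0 : 0 < ρ / β := by positivity
  have h2 : (0 : ℝ) < 2 ^ (β * (n : ℝ)) := by positivity
  have hhalf : (1 / 2 : ℝ) ≤ 2 ^ (-(ρ / β)) := by
    have := Real.rpow_le_rpow_of_exponent_le one_le_two (neg_le_neg hδ1)
    rwa [Real.rpow_neg_one, ← one_div] at this
  set s : ℝ := 2 ^ (β * (n : ℝ)) * t with hs
  have hs0 : 0 < s := by positivity
  -- For `s = 2^{βn}t ≤ 1` the uniform bound on the shifts is enough; for `s ≥ 1` the hypothesis on
  -- the increments reads exactly `η s^{-θ₁/β}`.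
  rcases le_total s 1 with h1 | h1
  · have h3 : (2 : ℝ) ^ (-(ρ / β)) ≤ (1 + s) ^ (-(ρ / β)) :=
      Real.rpow_le_rpow_of_nonpos (by positivity) (by linarith) (by linarith)
    have h4 := (abs_sub (p t (n + 1)) (p t n)).trans
      (add_le_add (hp.le t ht (n + 1)) (hp.le t ht n))
    linarith
  · have h3 : (2 * s) ^ (-(ρ / β)) ≤ (1 + s) ^ (-(ρ / β)) :=
      Real.rpow_le_rpow_of_nonpos (by positivity) (by linarith) (by linarith)
    rw [Real.mul_rpow two_pos.le hs0.le] at h3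
    have h5 : s ^ (-θ₁ / β) = t ^ (-θ₁ / β) * (2 : ℝ) ^ (-(θ₁ * (n : ℝ))) := by
      rw [hs, Real.mul_rpow h2.le ht.le, ← Real.rpow_mul two_pos.le, mul_comm]
      congr 2
      field_simp
    have h6 : s ^ (-θ₁ / β) ≤ s ^ (-(ρ / β)) := by
      refine Real.rpow_le_rpow_of_exponent_le h1 ?_
      rw [neg_div]
      exact neg_le_neg (by gcongr)
    have h7 := hp.diff_le t ht n hn
    rw [← h5] at h7
    have h8 : 0 < s ^ (-θ₁ / β) := by positivity
    have h9 : 1 / 2 * s ^ (-(ρ / β)) ≤ 2 ^ (-(ρ / β)) * s ^ (-(ρ / β)) := by gcongr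
    have h10 := mul_le_mul_of_nonneg_right hη h8.le
    linarith

/-- For `t ≤ 1` the rescaled time is at most `2 · 2^{βn}`. Spatial remainders of the kernel are
thereby expressed in the same variable as the increments of the shifts. -/
theorem two_rpow_neg_le_scaled {β ρ t : ℝ} (hβ : 0 < β) (hρ : 0 < ρ) (hρβ : ρ ≤ β) (ht : t ∈ Ioc 0 1)
    {n : ℤ} (hn : 0 ≤ n) :
    (2 : ℝ) ^ (-(ρ * (n : ℝ))) ≤ 2 * (1 + 2 ^ (β * (n : ℝ)) * t) ^ (-(ρ / β)) := by
  have hδ1 : ρ / β ≤ 1 := (div_le_one hβ).mpr hρβ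
  have hδ0 : 0 < ρ / β := by positivity
  have h2 : (0 : ℝ) < 2 ^ (β * (n : ℝ)) := by positivity
  have h1 : (1 : ℝ) ≤ 2 ^ (β * (n : ℝ)) :=
    Real.one_le_rpow one_le_two (mul_nonneg hβ.le (by exact_mod_cast hn))
  have hhalf : (1 / 2 : ℝ) ≤ 2 ^ (-(ρ / β)) := by
    have := Real.rpow_le_rpow_of_exponent_le one_le_two (neg_le_neg hδ1)
    rwa [Real.rpow_neg_one, ← one_div] at this
  have ht0 := ht.1
  have hle : 1 + 2 ^ (β * (n : ℝ)) * t ≤ 2 * 2 ^ (β * (n : ℝ)) := by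
    have := mul_le_mul_of_nonneg_left ht.2 h2.le
    linarith
  have h3 : (2 * 2 ^ (β * (n : ℝ))) ^ (-(ρ / β)) ≤ (1 + 2 ^ (β * (n : ℝ)) * t) ^ (-(ρ / β)) :=
    Real.rpow_le_rpow_of_nonpos (by positivity) hle (by linarith)
  have h4 : ((2 : ℝ) ^ (β * (n : ℝ))) ^ (-(ρ / β)) = 2 ^ (-(ρ * (n : ℝ))) := by
    rw [← Real.rpow_mul two_pos.le]
    congr 1
    field_simp
  rw [Real.mul_rpow two_pos.le h2.le, h4] at h3
  have h5 : 1 / 2 * (2 : ℝ) ^ (-(ρ * (n : ℝ))) ≤ 2 ^ (-(ρ / β)) * 2 ^ (-(ρ * (n : ℝ))) := by gcongr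
  linarith

namespace Kernels

variable {K : Kernels} {L : ℝ}

theorem exists_γ_remainder (K : Kernels) : ∃ C, 0 < C ∧ ∀ x ≥ -1,
    |logScale K.γ x - K.β * x * Real.log 2| ≤ C * 2 ^ (-((K.β - K.βtilde) * x)) :=
  exists_logScale_remainder K.γ_contDiffOn.continuousOn K.γ_pos K.βtilde_lt K.γ_atTop

/-- The limits at `-∞` are `γ₀/4` and `2γ₀ = 8 · γ₀/4`. At `+∞` the factor `e^{-A2^n}` with `A > 0`
beats every power of `2^n`, while the averaged logarithmic ratios stay bounded. -/
theorem IsLogLipschitz.isReferenceRates (hL : K.IsLogLipschitz L) {A : ℝ} (hA : 0 < A) :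
    IsReferenceRates K.β (K.γ₀ / 4) (K.downRate 0) (K.upRate A 0) := by
  have hγ := tendsto_logScale_atBot K.γ₀_pos
    (tendsto_of_isBigO_sub_rpow (by linarith [K.βbar_gt]) K.γ_zero)
  have hcast : ∀ c : ℝ, Tendsto (fun n : ℤ => (n : ℝ) + c) atBot atBot := fun c =>
    tendsto_atBot_add_const_right _ c (tendsto_intCast_atBot_iff.mpr tendsto_id)
  obtain ⟨C, hC, hrem⟩ := K.exists_γ_remainder
  have hβ := K.β_mem.1
  have hrem' : ∀ x, 0 ≤ x → |logScale K.γ x - K.β * x * Real.log 2| ≤ C := fun x hx => by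
    refine (hrem x (by linarith)).trans ?_
    have : (2 : ℝ) ^ (-((K.β - K.βtilde) * x)) ≤ 1 := Real.rpow_le_one_of_one_le_of_nonpos
      one_le_two (neg_nonpos.mpr (mul_nonneg (sub_pos.mpr K.βtilde_lt).le hx))
    nlinarith
  have h2exp : ∀ y : ℝ, (2 : ℝ) ^ y = Real.exp (y * Real.log 2) := fun y => by
    rw [Real.rpow_def_of_pos two_pos, mul_comm]
  refine ⟨by linarith [K.γ₀_pos], fun n => ?_, fun n => ?_, ?_, ?_, ⟨4 * Real.exp C,
    by positivity, fun n hn => ?_⟩, fun q => ?_⟩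
  · unfold downRate; positivity
  · unfold upRate; positivity
  · have h := ((Real.continuous_exp.tendsto _).comp (hγ.comp (hcast 0))).div_const 4
    rw [Real.exp_log K.γ₀_pos] at h
    exact h
  · have hz : Tendsto (fun n : ℤ => (2 : ℝ) ^ n) atBot (𝓝 0) := by
      have h := (tendsto_two_rpow_atBot.mono_right nhdsWithin_le_nhds).comp (hcast 0)
      refine h.congr fun n => ?_
      simp [Function.comp]
    have h := (((hz.const_mul (-A)).sub hL.tendsto_meanLogRatio_zero).add (hγ.comp (hcast 1)))
    rw [mul_zero, sub_zero, zero_add] at h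
    have h' := ((Real.continuous_exp.tendsto _).comp h).const_mul 2
    rw [Real.exp_log K.γ₀_pos, show 2 * K.γ₀ = 8 * (K.γ₀ / 4) by ring] at h'
    refine h'.congr fun n => ?_
    simp [upRate, Function.comp]
  · have hn' : (0 : ℝ) ≤ n := by exact_mod_cast hn
    obtain ⟨h1, h2⟩ := abs_le.mp (hrem' n hn')
    have e : Real.exp C * Real.exp (logScale K.γ n) = Real.exp (C + logScale K.γ n) :=
      (Real.exp_add _ _).symm
    unfold downRate
    simp only [Pi.zero_apply, add_zero]
    rw [h2exp, show K.β * (n : ℝ) * Real.log 2 = K.β * n * Real.log 2 by ring]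
    constructor
    · calc _ ≤ Real.exp (C + logScale K.γ n) := Real.exp_le_exp.mpr (by linarith)
        _ = _ := by rw [← e]; ring
    · have h3 : Real.exp (logScale K.γ n) ≤ Real.exp (C + K.β * n * Real.log 2) :=
        Real.exp_le_exp.mpr (by linarith)
      rw [Real.exp_add] at h3
      have h4 : 0 < Real.exp C * Real.exp (K.β * n * Real.log 2) := by positivity
      linarith
  · have hx : Tendsto (fun n : ℤ => (2 : ℝ) ^ (n : ℝ)) atTop atTop :=
      tendsto_two_rpow_atTop.comp (tendsto_intCast_atTop_iff.mpr tendsto_id)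
    have h := ((tendsto_rpow_mul_exp_neg_mul_atTop_nhds_zero (q + K.β) A hA).comp hx).const_mul
      (2 * Real.exp (2 + 6 * L + C + K.β))
    rw [mul_zero] at h
    refine squeeze_zero' (Eventually.of_forall fun n => by unfold upRate; positivity) ?_ h
    filter_upwards [eventually_ge_atTop 0] with n hn
    have hn' : (0 : ℝ) ≤ n := by exact_mod_cast hn
    have h1 := abs_le.mp (hrem' (n + 1) (by linarith))
    have h2 := abs_le.mp (hL.abs_meanLogRatio_le (p := 0) (fun n => by simp) n)
    obtain ⟨hl0, hl1⟩ := log_two_bounds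
    have e : ((2 : ℝ) ^ (n : ℝ)) ^ (q + K.β) =
        Real.exp (q * n * Real.log 2 + K.β * n * Real.log 2) := by
      rw [← Real.rpow_mul two_pos.le, h2exp]
      ring_nf
    simp only [Function.comp]
    unfold upRate
    rw [e, h2exp (q * n)]
    simp only [Pi.zero_apply, add_zero]
    rw [mul_left_comm, mul_assoc 2, ← Real.exp_add, ← Real.exp_add, ← Real.exp_add,
      Real.rpow_intCast]
    refine mul_le_mul_of_nonneg_left (Real.exp_le_exp.mpr ?_) two_pos.le
    have h3 : K.β * Real.log 2 ≤ K.β := by nlinarith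
    linarith [h1.2, h2.1]

/-- In `early` the constant `c₀` need not be small, so any shift bounded by one will do. Smallness
of `η₀` serves only the closeness of the rates and the slow variation in `late`. -/
theorem exists_isPerturbedRates (K : Kernels) {θ₁ : ℝ} (hθ₁ : θ₁ ∈ Ioo (K.β - 1) 1) (A : ℝ) :
    ∃ c₀ δ ε₁ : ℝ, 0 ≤ c₀ ∧ 0 < δ ∧ δ ≤ 1 ∧ 0 < ε₁ ∧ ε₁ ≤ K.β ∧ ∀ ε, 0 < ε → ε ≤ 1 / 2 →
      ∃ η₀ ∈ Ioo (0 : ℝ) 1, ∀ p, IsRegularShift K.β θ₁ η₀ p →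
        IsPerturbedRates K.β (K.downRate 0) (K.upRate A 0) c₀ δ ε₁ ε
          (fun t => K.downRate (p t)) (fun t => K.upRate A (p t)) := by
  obtain ⟨L, hL⟩ := K.exists_isLogLipschitz
  obtain ⟨C, hC, hrem⟩ := K.exists_γ_remainder
  obtain ⟨hl0, hl1⟩ := log_two_bounds
  have hβ := K.β_mem.1
  have hθ0 : 0 < θ₁ := by linarith [hθ₁.1]
  have hθ1 := hθ₁.2
  have hLp := hL.pos
  have hd : 0 < K.β - K.βtilde := sub_pos.mpr K.βtilde_lt
  set d := K.β - K.βtilde with hd_def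
  -- The common decay exponent of the increments of the shifts and of the remainder of `γ`.
  set ρ := min θ₁ d with hρ_def
  have hρ : 0 < ρ := lt_min hθ0 hd
  have hρθ : ρ ≤ θ₁ := min_le_left _ _
  have hρd : ρ ≤ d := min_le_right _ _
  set C₁ := C * 2 ^ d with hC₁_def
  have hC₁ : 0 < C₁ := by positivity
  set C₂ := K.β + 4 * C₁ with hC₂_def
  have hC₂ : 0 < C₂ := by positivity
  have hremn : ∀ (x : ℝ) (n : ℤ), 0 ≤ n → (n : ℝ) - 1 ≤ x →
      |logScale K.γ x - K.β * x * Real.log 2| ≤ C₁ * 2 ^ (-(ρ * (n : ℝ))) := by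
    intro x n hn hx
    have hn' : (0 : ℝ) ≤ n := by exact_mod_cast hn
    refine (hrem x (by linarith)).trans ?_
    rw [hC₁_def, mul_assoc, ← Real.rpow_add two_pos]
    have h1 := mul_le_mul_of_nonneg_right hρd hn'
    have h2 := mul_le_mul_of_nonneg_left hx hd.le
    exact mul_le_mul_of_nonneg_left
      (Real.rpow_le_rpow_of_exponent_le one_le_two (by linarith)) hC.le
  -- In `c₀`, `4β` comes from the increment of the shift and `4C₁` from two kernel remainders, each
  -- at most `2C₁` times the power of the rescaled time. `ε₁` is only `ρ/2` because half the decay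
  -- is given up to gain smallness.
  refine ⟨4 * K.β + 4 * C₁, ρ / K.β, ρ / 2, by positivity, by positivity,
    (div_le_one (by linarith)).mpr (by linarith), by positivity, by linarith,
    fun ε hε hε2 => ?_⟩
  -- The second entry controls the perturbation of the rates, whose exponents change by at most `(2
  -- + 5L)η₀`; the third is for the interpolation at the end, with `72 = 36 · 2`.
  set η₀ := min (1 / 2) (min (ε / (2 * (2 + 5 * L))) (ε ^ 2 / (72 * L * C₂))) with hη_def
  have hη0 : 0 < η₀ := by positivity
  have hη1 : η₀ ≤ 1 / 2 := min_le_left _ _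
  have hη2 : 2 * (2 + 5 * L) * η₀ ≤ ε := by
    have : η₀ ≤ ε / (2 * (2 + 5 * L)) := (min_le_right _ _).trans (min_le_left _ _)
    rwa [le_div_iff₀ (by positivity), mul_comm] at this
  have hη3 : 72 * L * C₂ * η₀ ≤ ε ^ 2 := by
    have : η₀ ≤ ε ^ 2 / (72 * L * C₂) := (min_le_right _ _).trans (min_le_right _ _)
    rwa [le_div_iff₀ (by positivity), mul_comm] at this
  have hLη : 0 < L * η₀ := by positivity
  refine ⟨η₀, ⟨hη0, by linarith⟩, fun p hp => ?_⟩
  have hple : ∀ t, 0 < t → ∀ n, |p t n| ≤ 1 := fun t ht n => (hp.le t ht n).trans (by linarith)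
  have hu : ∀ t, 0 < t → ∀ (c : ℝ) n,
      |logScale K.γ (c + p t n) - logScale K.γ c| ≤ L * η₀ := fun t ht c n => by
    refine (hL.γ_le _ _).trans ?_
    rw [add_sub_cancel_left]
    exact mul_le_mul_of_nonneg_left (hp.le t ht n) hLp.le
  have hsmall : ∀ x y : ℝ, 0 < y → |x| ≤ (2 + 5 * L) * η₀ →
      |y * Real.exp x - y| ≤ ε * y := fun x y hy hx => by
    have h1 := Real.abs_exp_sub_one_le (x := x) (by linarith)
    rw [show y * Real.exp x - y = (Real.exp x - 1) * y by ring, abs_mul, abs_of_pos hy]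
    exact mul_le_mul_of_nonneg_right (by linarith) hy.le
  refine ⟨fun n => ?_, fun n => ?_, fun t ht n => ?_, fun t ht n => ?_, fun t ht n hn => ?_,
    fun t ht n hn => ?_⟩
  · unfold downRate
    exact ((Real.continuous_exp.comp hL.continuous_logScale_γ).comp_continuousOn
      (continuousOn_const.add (hp.cont n))).div_const 4
  · unfold upRate
    exact continuousOn_const.mul (Real.continuous_exp.comp_continuousOn
      ((continuousOn_const.sub (hL.continuousOn_meanLogRatio hp.cont hple n)).add
        (hL.continuous_logScale_γ.comp_continuousOn (continuousOn_const.add (hp.cont (n + 1))))))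
  · have e : K.downRate (p t) n = K.downRate 0 n *
        Real.exp (logScale K.γ (n + p t n) - logScale K.γ n) := by
      unfold downRate
      rw [Real.exp_sub]
      simp only [Pi.zero_apply, add_zero]
      field_simp
    simp only [e]
    refine hsmall _ _ (by unfold downRate; positivity) ((hu t ht n n).trans ?_)
    linarith
  · have e : K.upRate A (p t) n = K.upRate A 0 n *
        Real.exp (-(K.meanLogRatio (p t) n - K.meanLogRatio 0 n) +
          (logScale K.γ ((n : ℝ) + 1 + p t (n + 1)) - logScale K.γ ((n : ℝ) + 1))) := by
      unfold upRate
      rw [mul_assoc, ← Real.exp_add]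
      simp only [Pi.zero_apply, add_zero]
      ring_nf
    simp only [e]
    refine hsmall _ _ (by unfold upRate; positivity) ((abs_add_le _ _).trans ?_)
    rw [abs_neg]
    have h1 := hL.abs_meanLogRatio_sub_le (by linarith) (hp.le t ht) n
    have h2 := hu t ht (n + 1) (n + 1)
    linarith
  · have ht0 := ht.1
    have hX := hp.abs_diff_le_scaled (by linarith) (by linarith) hρ hρθ (by linarith) ht0 hn
    have hY := two_rpow_neg_le_scaled (β := K.β) (by linarith) hρ (by linarith) ht hn
    have h1 := hremn (n + p t n) n hn (by linarith [(abs_le.mp (hple t ht0 n)).1])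
    have h2 := hremn ((n : ℝ) + 1 + p t (n + 1)) n hn
      (by linarith [(abs_le.mp (hple t ht0 (n + 1))).1])
    set X := (1 + 2 ^ (K.β * (n : ℝ)) * t) ^ (-(ρ / K.β)) with hX_def
    set Δ := p t (n + 1) - p t n with hΔ
    have e : K.downRate (p t) (n + 1) = 2 ^ K.β * K.downRate (p t) n *
        Real.exp (logScale K.γ ((n : ℝ) + 1 + p t (n + 1)) - logScale K.γ (n + p t n) -
          K.β * Real.log 2) := by
      unfold downRate
      rw [Real.exp_sub, Real.exp_sub, mul_comm K.β, ← Real.rpow_def_of_pos two_pos]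
      push_cast
      field_simp
    have h3 : -((4 * K.β + 4 * C₁) * X) ≤ logScale K.γ ((n : ℝ) + 1 + p t (n + 1)) -
        logScale K.γ (n + p t n) - K.β * Real.log 2 := by
      have h4 := (abs_le.mp h1).2
      have h5 := (abs_le.mp h2).1
      have h6 : -(K.β * (4 * X)) ≤ K.β * (Δ * Real.log 2) := by
        rw [← mul_neg]
        refine mul_le_mul_of_nonneg_left ?_ (by linarith)
        have h7 : |Δ * Real.log 2| ≤ 4 * X := by
          rw [abs_mul, abs_of_pos hl0]
          calc _ ≤ |Δ| * 1 := mul_le_mul_of_nonneg_left hl1 (abs_nonneg _)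
            _ ≤ _ := by rwa [mul_one]
        exact (abs_le.mp h7).1
      have h8 := mul_le_mul_of_nonneg_left hY hC₁.le
      have h9 : K.β * (Δ * Real.log 2) = K.β * ((n : ℝ) + 1 + p t (n + 1)) * Real.log 2 -
          K.β * (n + p t n) * Real.log 2 - K.β * Real.log 2 := by rw [hΔ]; ring
      linarith
    have h10 : 0 < 2 ^ K.β * K.downRate (p t) n := by unfold downRate; positivity
    simp only [e]
    rw [mul_comm]
    refine mul_le_mul_of_nonneg_left ?_ h10.le
    refine le_trans ?_ (Real.add_one_le_exp _)
    linarith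
  · have ht0 : 0 < t := by linarith
    have hn' : (0 : ℝ) ≤ n := by exact_mod_cast hn
    have e : ∀ m : ℤ, K.downRate (p t) m / K.downRate 0 m =
        Real.exp (logScale K.γ (m + p t m) - logScale K.γ m) := fun m => by
      unfold downRate
      rw [Real.exp_sub]
      simp only [Pi.zero_apply, add_zero]
      field_simp
    simp only [e]
    rw [wt_of_nonneg hn]
    set u := logScale K.γ (((n + 1 : ℤ) : ℝ) + p t (n + 1)) - logScale K.γ ((n + 1 : ℤ) : ℝ)
      with hu_def
    set v := logScale K.γ (n + p t n) - logScale K.γ n with hv_def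
    have hub : |u| ≤ L * η₀ := hu t ht0 _ _
    have hvb : |v| ≤ L * η₀ := hu t ht0 _ _
    have huv : |u - v| ≤ 2 * L * η₀ := (abs_sub _ _).trans (by linarith)
    have hLη' : 2 * L * η₀ ≤ 1 := by linarith
    refine (abs_exp_sub_exp_le (by linarith [(abs_le.mp hvb).2]) (by linarith)).trans ?_
    set Y := (2 : ℝ) ^ (-(ρ * (n : ℝ))) with hY_def
    have hY0 : 0 < Y := by positivity
    have hΔ : |p t (n + 1) - p t n| ≤ Y := by
      refine (hp.diff_le t ht0 n hn).trans ?_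
      have h1 : t ^ (-θ₁ / K.β) ≤ 1 := Real.rpow_le_one_of_one_le_of_nonpos ht
        (div_nonpos_of_nonpos_of_nonneg (by linarith) (by linarith))
      have h2 : (2 : ℝ) ^ (-(θ₁ * (n : ℝ))) ≤ Y := Real.rpow_le_rpow_of_exponent_le one_le_two
        (neg_le_neg (mul_le_mul_of_nonneg_right hρθ hn'))
      calc _ ≤ 1 * (1 * Y) := by gcongr; linarith
        _ = Y := by ring
    have huv2 : |u - v| ≤ C₂ * Y := by
      have h1 := abs_le.mp (hremn (n + p t n) n hn (by linarith [(abs_le.mp (hple t ht0 n)).1]))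
      have h2 := abs_le.mp (hremn (((n + 1 : ℤ) : ℝ) + p t (n + 1)) n hn
        (by push_cast; linarith [(abs_le.mp (hple t ht0 (n + 1))).1]))
      have h3 := abs_le.mp (hremn n n hn (by linarith))
      have h4 := abs_le.mp (hremn ((n + 1 : ℤ) : ℝ) n hn (by push_cast; linarith))
      have h5 : |K.β * ((p t (n + 1) - p t n) * Real.log 2)| ≤ K.β * Y := by
        rw [abs_mul, abs_of_pos (show 0 < K.β by linarith), abs_mul, abs_of_pos hl0]
        refine mul_le_mul_of_nonneg_left ?_ (by linarith)
        calc _ ≤ Y * 1 := mul_le_mul hΔ hl1 hl0.le hY0.le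
          _ = Y := mul_one _
      have h6 := abs_le.mp h5
      have h7 : K.β * ((p t (n + 1) - p t n) * Real.log 2) =
          K.β * (((n + 1 : ℤ) : ℝ) + p t (n + 1)) * Real.log 2 - K.β * ((n + 1 : ℤ) : ℝ) * Real.log 2
          - (K.β * (n + p t n) * Real.log 2 - K.β * n * Real.log 2) := by ring
      rw [h7] at h6
      refine abs_le.mpr ⟨?_, ?_⟩
      · linarith only [h1.2, h2.1, h3.1, h4.2, h6.1, hu_def, hv_def, hC₂_def]
      · linarith only [h1.1, h2.2, h3.2, h4.1, h6.2, hu_def, hv_def, hC₂_def]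
    set Z := (2 : ℝ) ^ (-(ρ / 2 * (n : ℝ))) with hZ
    have hZ0 : 0 < Z := by positivity
    have hsq : Z ^ 2 = Y := by
      rw [hZ, ← Real.rpow_natCast, ← Real.rpow_mul two_pos.le]
      congr 1
      push_cast
      ring
    -- One bound on `|u - v|` is small in `η₀` and uniform in `n`, the other decays like `2^{-ρn}`
    -- without being small. Their geometric mean has both properties, at half the exponent.
    refine abs_le_of_sq_le_sq' ?_ (by positivity) |>.2
    have h1 : |u - v| ^ 2 ≤ (2 * L * η₀) * (C₂ * Y) := by
      rw [sq]
      exact mul_le_mul huv huv2 (abs_nonneg _) (by positivity)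
    calc (6 * |u - v|) ^ 2 = 36 * |u - v| ^ 2 := by ring
      _ ≤ 36 * ((2 * L * η₀) * (C₂ * Y)) := by gcongr
      _ = 72 * L * C₂ * η₀ * Y := by ring
      _ ≤ ε ^ 2 * Y := by gcongr
      _ = (ε * Z) ^ 2 := by rw [← hsq]; ring

end Kernels

/-! ### Norms, time translation and the main theorem -/

theorem abs_le_mul_wt_of_normY_le {θ E : ℝ} {x : ℤ → ℝ} (hE : 0 ≤ E)
    (h : normY θ x ≤ ENNReal.ofReal E) (n : ℤ) : |x n| ≤ E * wt θ n := by
  rcases le_or_gt n 0 with hn | hn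
  · have h1 : ENNReal.ofReal ((2 : ℝ) ^ n * |x n|) ≤ ENNReal.ofReal E :=
      ((le_iSup₂_of_le (f := fun (n : ℤ) (_ : n ≤ 0) => ENNReal.ofReal ((2 : ℝ) ^ n * |x n|))
        n hn le_rfl).trans le_self_add).trans h
    have h2 := (ENNReal.ofReal_le_ofReal_iff hE).mp h1
    have h3 : (2 : ℝ) ^ n * wt θ n = 1 := by
      rw [wt_of_nonpos hn, ← Real.rpow_intCast, ← Real.rpow_add two_pos, add_neg_cancel,
        Real.rpow_zero]
    calc |x n| = ((2 : ℝ) ^ n * |x n|) * wt θ n := by rw [mul_right_comm, h3, one_mul]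
      _ ≤ _ := mul_le_mul_of_nonneg_right h2 (wt_pos _ _).le
  · have h1 : ENNReal.ofReal ((2 : ℝ) ^ (θ * (n : ℝ)) * |x n|) ≤ ENNReal.ofReal E :=
      ((le_iSup₂_of_le (f := fun (n : ℤ) (_ : 0 < n) =>
        ENNReal.ofReal ((2 : ℝ) ^ (θ * (n : ℝ)) * |x n|)) n hn le_rfl).trans le_add_self).trans h
    have h2 := (ENNReal.ofReal_le_ofReal_iff hE).mp h1
    have h3 : (2 : ℝ) ^ (θ * (n : ℝ)) * wt θ n = 1 := by
      rw [wt_of_nonneg hn.le, ← Real.rpow_add two_pos, add_neg_cancel, Real.rpow_zero]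
    calc |x n| = ((2 : ℝ) ^ (θ * (n : ℝ)) * |x n|) * wt θ n := by rw [mul_right_comm, h3, one_mul]
      _ ≤ _ := mul_le_mul_of_nonneg_right h2 (wt_pos _ _).le

/-- The factor `2` appears because the norm adds the suprema over the two half-lines. -/
theorem normY_le_of_abs_le_mul_wt {θ E : ℝ} {x : ℤ → ℝ} (hE : 0 ≤ E)
    (h : ∀ n, |x n| ≤ E * wt θ n) : normY θ x ≤ ENNReal.ofReal (2 * E) := by
  rw [two_mul, ENNReal.ofReal_add hE hE]
  refine add_le_add (iSup₂_le fun n hn => ENNReal.ofReal_le_ofReal ?_)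
    (iSup₂_le fun n hn => ENNReal.ofReal_le_ofReal ?_)
  · calc (2 : ℝ) ^ n * |x n| ≤ (2 : ℝ) ^ n * (E * wt θ n) := by gcongr; exact h n
      _ = E := by
        rw [wt_of_nonpos hn, ← Real.rpow_intCast, mul_left_comm, ← Real.rpow_add two_pos,
          add_neg_cancel, Real.rpow_zero, mul_one]
  · calc (2 : ℝ) ^ (θ * (n : ℝ)) * |x n| ≤ (2 : ℝ) ^ (θ * (n : ℝ)) * (E * wt θ n) := by
          gcongr; exact h n
      _ = E := by
        rw [wt_of_nonneg hn.le, mul_left_comm, ← Real.rpow_add two_pos, add_neg_cancel,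
          Real.rpow_zero, mul_one]

namespace Kernels

variable {K : Kernels}

/-- Restarting at `t₀ ≥ 0` only improves the bounds: the singular power of `t₀ + t` is at most that
of `t`, and the exponential factor is at most one. All estimates may thus be proved with initial
time zero. -/
theorem IsAdmissibleShift.isRegularShift {θ₁ η₀ ν t₀ : ℝ} {p : ℝ → ℤ → ℝ} (hθ₁ : 0 ≤ θ₁)
    (hη₀ : 0 ≤ η₀) (hν : 0 ≤ ν) (ht₀ : 0 ≤ t₀) (hp : K.IsAdmissibleShift θ₁ η₀ ν p) :
    IsRegularShift K.β θ₁ η₀ fun s => p (t₀ + s) := by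
  have hβ := K.β_mem.1
  refine ⟨fun n t ht => ?_, fun t ht => hp.bound _ (by linarith), fun t ht n hn => ?_⟩
  · have ht' : 0 < t₀ + t := add_pos_of_nonneg_of_pos ht₀ ht
    have h := (hp.differentiable _ ht' n).continuousAt
    exact (ContinuousAt.comp (f := fun s => t₀ + s) h (by fun_prop)).continuousWithinAt
  · have ht' : 0 < t₀ + t := by linarith
    have h := CoagFrag.abs_le_mul_wt_of_normY_le (by positivity) (hp.bound_diff _ ht') n
    rw [wt_of_nonneg hn] at h
    refine h.trans ?_
    have h1 : (t₀ + t) ^ (-θ₁ / K.β) ≤ t ^ (-θ₁ / K.β) :=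
      Real.rpow_le_rpow_of_nonpos ht (by linarith)
        (div_nonpos_of_nonpos_of_nonneg (by linarith) (by linarith))
    have h2 : Real.exp (-(ν / 2) * (t₀ + t)) ≤ 1 := Real.exp_le_one_iff.mpr (by
      rw [neg_mul]
      exact neg_nonpos.mpr (by positivity))
    calc _ ≤ η₀ * t ^ (-θ₁ / K.β) * 1 * (2 : ℝ) ^ (-(θ₁ * (n : ℝ))) := by gcongr
      _ = _ := by ring

theorem isSolution_iff {A κ t₀ : ℝ} {p y : ℝ → ℤ → ℝ} {y₀ : ℤ → ℝ} :
    K.IsSolution A p κ t₀ y₀ y ↔ IsBackwardSolution (fun s => K.downRate (p (t₀ + s)))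
      (fun s => K.upRate A (p (t₀ + s))) κ y₀ (fun s => y (t₀ + s)) := by
  have hcont : ∀ n, ContinuousOn (fun t => y t n) (Ici t₀) ↔
      ContinuousOn (fun s => y (t₀ + s) n) (Ici 0) := fun n => by
    constructor
    · exact fun h => h.comp (f := fun s => t₀ + s) (by fun_prop) fun s hs => by
        simpa using hs
    · intro h
      have h' := h.comp (f := fun s => s - t₀) (s := Ici t₀) (by fun_prop) fun s hs => by
        simpa using hs
      refine h'.congr fun s _ => ?_
      simp
  have hderiv : ∀ t n, HasDerivAt (fun s => y (t₀ + s) n)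
      (K.downRate (p (t₀ + t)) n * (y (t₀ + t) (n - 1) - y (t₀ + t) n) +
        K.upRate A (p (t₀ + t)) n * (y (t₀ + t) (n + 1) - y (t₀ + t) n)) t ↔
      HasDerivAt (fun s => y s n) (K.linOp A (p (t₀ + t)) (y (t₀ + t)) n) (t₀ + t) :=
    fun t n => by
      rw [linOp_eq]
      refine ⟨fun h => ?_, fun h => h.comp_const_add t₀ t⟩
      have h' := HasDerivAt.comp_const_add (-t₀) (t₀ + t) (by rwa [neg_add_cancel_left])
      simpa only [add_neg_cancel_left] using h'
  constructor
  · intro h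
    refine ⟨by simpa using h.init, fun n => (hcont n).mp (h.continuousOn n),
      fun t ht n => (hderiv t n).mpr (h.ode _ (by linarith) n), fun T => ?_⟩
    obtain ⟨B, hB⟩ := h.locally_bounded (t₀ + T)
    refine ⟨max B 0, fun t ht => abs_le_mul_wt_of_normY_le (le_max_right _ _) ((hB _ ?_).trans
      (ENNReal.ofReal_le_ofReal (le_max_left _ _)))⟩
    exact ⟨by linarith [ht.1], by linarith [ht.2]⟩
  · intro h
    refine ⟨by simpa using h.init, fun n => (hcont n).mpr (h.cont n), fun t ht n => ?_,
      fun T => ?_⟩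
    · have h1 := (hderiv (t - t₀) n).mp (h.deriv (t - t₀) (by linarith) n)
      rwa [add_sub_cancel] at h1
    · obtain ⟨B, hB⟩ := h.bound (T - t₀)
      refine ⟨2 * max B 0, fun t ht => normY_le_of_abs_le_mul_wt (le_max_right _ _) fun n => ?_⟩
      have h1 := hB (t - t₀) ⟨by linarith [ht.1], by linarith [ht.2]⟩ n
      rw [add_sub_cancel] at h1
      exact h1.trans (mul_le_mul_of_nonneg_right (le_max_left _ _) (wt_pos _ _).le)

end Kernels

end CoagFrag

theorem theorem4p2 (K : CoagFrag.Kernels) (θ₁ : ℝ) (hθ₁ : θ₁ ∈ Set.Ioo (K.β - 1) 1)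
    (M A : ℝ) (hM : 0 < M) (hA : K.IsMassParameter M A) :
    ∃ η₀ ∈ Set.Ioo (0 : ℝ) 1, ∃ ν : ℝ, 0 < ν ∧
      ∀ θ ∈ Set.Ioo (-1 : ℝ) K.β, ∀ θ' ∈ Set.Icc θ K.β, θ' - θ < K.β →
        ∃ C₁ C₂ : ℝ, 0 < C₁ ∧ 0 < C₂ ∧
          ∀ p : ℝ → ℤ → ℝ, K.IsAdmissibleShift θ₁ η₀ ν p →
          ∀ t₀ : ℝ, 0 ≤ t₀ → ∀ y₀ : ℤ → ℝ, CoagFrag.normY θ y₀ < ⊤ →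
            ∃ y : ℝ → ℤ → ℝ,
              K.IsSolution A p (min θ 0) t₀ y₀ y ∧
              (∀ z : ℝ → ℤ → ℝ, K.IsSolution A p (min θ 0) t₀ y₀ z →
                ∀ t, t₀ ≤ t → z t = y t) ∧
              (∀ t, t₀ < t →
                CoagFrag.normY θ' (CoagFrag.Dplus (y t)) ≤
                  ENNReal.ofReal
                    (C₁ * (t - t₀) ^ (-(θ' - θ) / K.β) * Real.exp (-ν * (t - t₀))) *
                    CoagFrag.normY θ y₀) ∧
              ∃ yinf : ℝ → ℝ, ∀ t, t₀ < t →
                Filter.Tendsto (fun n : ℤ => y t n) Filter.atTop (nhds (yinf t)) ∧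
                (0 < θ' →
                  CoagFrag.normY θ' (fun n => y t n - yinf t) ≤
                    ENNReal.ofReal
                      (C₂ * (t - t₀) ^ (-(θ' - θ) / K.β) * Real.exp (-ν * (t - t₀))) *
                      CoagFrag.normY θ y₀) := by
  have hβ := K.β_mem.1
  have hβ2 := K.β_mem.2
  obtain ⟨L, hL⟩ := K.exists_isLogLipschitz
  obtain ⟨c₀, δ, ε₁, hc₀, hδ, hδ1, hε₁, hε₁β, hpert⟩ := K.exists_isPerturbedRates hθ₁ A
  have href := hL.isReferenceRates hA.1
  obtain ⟨ε₀, ν, hε₀, hε₀2, hν, hdecay⟩ :=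
    href.exists_decay_estimate hβ.le hβ2.le hε₁ hε₁β
  obtain ⟨η₀, hη₀, hrates⟩ := hpert ε₀ hε₀ hε₀2
  refine ⟨η₀, hη₀, ν, hν, fun θ hθ θ' hθ' _ => ?_⟩
  obtain ⟨C, hC, hest⟩ :=
    hdecay c₀ δ hc₀ hδ hδ1 θ θ' hθ.1.le hθ.2 hθ'.1 hθ'.2
  -- The estimate with target weight `β > 0` makes the differences summable at `+∞`, so the limit
  -- exists even when `θ' ≤ 0`.
  obtain ⟨C', hC', hest'⟩ :=
    hdecay c₀ δ hc₀ hδ hδ1 θ K.β hθ.1.le hθ.2 hθ.2.le le_rfl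
  set b : ℝ := |(min (1 / 2) (1 - 2 ^ (-θ')))⁻¹| with hb
  -- `6 = 2 · 3`: a factor `3` bounds the initial differences by the initial data, since one step
  -- right at most doubles the weight, and `2` comes from converting pointwise bounds into the norm.
  -- The absolute value in `b` and the `+ 1` keep the constant positive for every `θ'`.
  refine ⟨6 * C, 6 * C * b + 1, by positivity, by positivity,
    fun p hp t₀ ht₀ y₀ hy₀ => ?_⟩
  have hR := hrates _ (hp.isRegularShift (by linarith [hθ₁.1]) hη₀.1.le hν.le ht₀)
  set Y := (CoagFrag.normY θ y₀).toReal with hY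
  have hY0 : 0 ≤ Y := ENNReal.toReal_nonneg
  have hYeq : CoagFrag.normY θ y₀ = ENNReal.ofReal Y := (ENNReal.ofReal_toReal hy₀.ne).symm
  have hy₀' := CoagFrag.abs_le_mul_wt_of_normY_le hY0 hYeq.le
  have hκ : -1 ≤ min θ 0 := le_min hθ.1.le (by norm_num)
  obtain ⟨x, hx⟩ := hR.exists_solution href hε₀2 hκ (min_le_right _ _) (M := Y)
    (y₀ := y₀) fun n => (hy₀' n).trans
      (mul_le_mul_of_nonneg_left (CoagFrag.wt_anti (min_le_left _ _) n) hY0)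
  have hd := hx.dplus hκ
  have hd0 : ∀ n, |CoagFrag.Dplus (x 0) n| ≤ 3 * Y * CoagFrag.wt θ n := by
    intro n
    rw [hx.init]
    have h1 := hy₀' (n + 1)
    have h2 := mul_le_mul_of_nonneg_left (CoagFrag.wt_succ_le hθ.1.le n) hY0
    exact (abs_sub _ _).trans (by linarith [hy₀' n])
  have hmain := hest ε₀ _ _ hR hε₀.le le_rfl _ hd (3 * Y) (by positivity) hd0
  have hmain' := hest' ε₀ _ _ hR hε₀.le le_rfl _ hd (3 * Y) (by positivity) hd0
  have hlim : ∀ t, 0 < t → ∃ l, Filter.Tendsto (x t) Filter.atTop (nhds l) := fun t ht => by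
    obtain ⟨l, hl, -⟩ := CoagFrag.exists_tendsto_of_dplus_le (by linarith) (by positivity)
      (hmain' t ht)
    exact ⟨l, hl⟩
  choose! l hl using hlim
  have hcomb : ∀ s c : ℝ, 0 ≤ c → ENNReal.ofReal
      (c * s ^ (-(θ' - θ) / K.β) * Real.exp (-ν * s)) * CoagFrag.normY θ y₀ = ENNReal.ofReal
      (c * s ^ (-(θ' - θ) / K.β) * Real.exp (-ν * s) * Y) := by
    intro s c hc
    rw [hYeq, ENNReal.ofReal_mul' hY0]
  refine ⟨fun t => x (t - t₀), ?_, fun z hz t ht => ?_, fun t ht => ?_, fun t => l (t - t₀),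
    fun t ht => ⟨hl _ (sub_pos.mpr ht), fun hθ'0 => ?_⟩⟩
  · rw [CoagFrag.Kernels.isSolution_iff]
    simpa only [add_sub_cancel_left] using hx
  · have h := hR.solution_unique href hε₀2 hκ hx (CoagFrag.Kernels.isSolution_iff.mp hz) (t - t₀)
      (sub_nonneg.mpr ht)
    simpa using h
  · have hs := sub_pos.mpr ht
    rw [hcomb _ _ (by positivity)]
    refine (CoagFrag.normY_le_of_abs_le_mul_wt (by positivity) (hmain _ hs)).trans
      (ENNReal.ofReal_le_ofReal (le_of_eq (by ring)))
  · have hs := sub_pos.mpr ht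
    rw [hcomb _ _ (by positivity)]
    obtain ⟨l', hl', hbound⟩ := CoagFrag.exists_tendsto_of_dplus_le hθ'0 (by positivity)
      (hmain _ hs)
    have e : l' = l (t - t₀) := tendsto_nhds_unique hl' (hl _ hs)
    rw [e] at hbound
    have hb' : ∀ n, |x (t - t₀) n - l (t - t₀)| ≤ b * (C * (3 * Y) *
        ((t - t₀) ^ (-(θ' - θ) / K.β) * Real.exp (-ν * (t - t₀)))) * CoagFrag.wt θ' n :=
      fun n => (hbound n).trans (by
        have := CoagFrag.wt_pos θ' n
        gcongr
        exact le_abs_self _)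
    refine (CoagFrag.normY_le_of_abs_le_mul_wt (by positivity) hb').trans
      (ENNReal.ofReal_le_ofReal ?_)
    have h1 : 0 ≤ (t - t₀) ^ (-(θ' - θ) / K.β) * Real.exp (-ν * (t - t₀)) * Y := by positivity
    linarith
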